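/- **Setting.** An episodic MDP has a measurable state space $\mathcal S$, a finite action set $\mathcal A$, an initial distribution $\mu$, transitions $P(\cdot\mid s,a)$, reward distributions $R(s,a)$ on $[0,1]$ and a horizon $H\ge 1$. In an episode $s_1\sim\mu$, $r_h\sim R(s_h,a_h)$, $s_{h+1}\sim P(\cdot\mid s_h,a_h)$ for $h<H$, and $\sum_{h=1}^H r_h\in[0,1]$ almost surely under every policy. $V^\star=\sup_\pi \mathbb E_\pi[\sum_{h=1}^H r_h]$ is the optimal value over deterministic nonstationary policies $\pi=(\pi_1,\dots,\pi_H)$, $\pi_h:\mathcal S\to\mathcal A$. Let $d\ge1$, let $\mathbb B_d$ be the closed Euclidean unit ball of $\mathbb R^d$, $\phi:\mathcal S\times\mathcal A\to\mathbb B_d$ a (measurable) feature map, $f:[-1,1]\to[-1,1]$ a link function, and $\|x\|_A=\sqrt{x^\top A x}$ for $A\succeq0$. Put $$\mathcal G=\{(s,a)\mapsto f(\langle\phi(s,a),\theta\rangle):\theta\in\mathbb B_d\},$$ $$\mathcal G_{\rm up}=\{(s,a)\mapsto\min\{1,f(\langle\phi(s,a),\theta\rangle)+\gamma'\|\phi(s,a)\|_A\}:\theta\in\mathbb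 B_d,\ 0\le\gamma'\le\Gamma,\ A\succeq0,\ \|A\|_{\rm op}\le1\},$$ and define the Bellman updates $\mathcal T_h(Q)(s,a)=\mathbb E[r+\max_{a'}Q(s',a')]$ with $r\sim R(s,a)$, $s'\sim P(\cdot\mid s,a)$ for $h<H$, and $\mathcal T_H(Q)(s,a)=\mathbb E[r]$. **Assumptions.** (i) *Link regularity*: $f$ is monotone and twice differentiable with $0<\kappa\le|f'(z)|\le K$ and $|f''(z)|\le M$ for all $|z|\le1$. (ii) *Optimistic closure*: $\mathcal T_h(g)\in\mathcal G$ for all $1\le h\le H$ and $g\in\mathcal G_{\rm up}$. **Algorithm (LSVI-UCB)** with $T\ge1$ episodes and bonus multiplier $\gamma=CK\kappa^{-1}\sqrt{1+M+K+d^2\ln((1+K+\Gamma)TH)}$, where $\Gamma$ satisfies $\gamma\le\Gamma$. Set $\bar Q_{h,0}\equiv1$ for $h\le H$ and $\bar Q_{H+1,t}\equiv0$. In episode $t=1,\dots,T$ follow a greedy policy $\hat\pi_{h,t}(s)\in\arg\max_a\bar Q_{h,t-1}(s,a)$ and observe $(s_{h,t},a_{h,t},r_{h,t})_{h\le H}$;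 then for $h=H,\dots,1$ let $x_{h,\tau}=\phi(s_{h,\tau},a_{h,\tau})$ and $y_{h,\tau}=r_{h,\tau}+\max_{a}\bar Q_{h+1,t}(s_{h+1,\tau},a)$ for $\tau\le t$ (so $y_{H,\tau}=r_{H,\tau}$), and $$\hat\theta_{h,t}\in\arg\min_{\|\theta\|_2\le1}\sum_{\tau\le t}\big(y_{h,\tau}-f(\langle x_{h,\tau},\theta\rangle)\big)^2,\qquad \Lambda_{h,t}=I+\sum_{\tau\le t}x_{h,\tau}x_{h,\tau}^\top,$$ $$\bar Q_{h,t}(s,a)=\min\{1,f(\langle\phi(s,a),\hat\theta_{h,t}\rangle)+\gamma\|\phi(s,a)\|_{\Lambda_{h,t}^{-1}}\}.$$ Maximizers and minimizers may be chosen by any measurable rule. With $\mathcal F_{t-1}$ the $\sigma$-algebra of the first $t-1$ trajectories, the regret is $$\mathrm{Reg}(T)=TV^\star-\sum_{t=1}^T\mathbb E\Big[\sum_{h=1}^H r_{h,t}\,\Big|\,\mathcal F_{t-1}\Big].$$ **Theorem.** There is a universal constant $C_0>0$ such that for every $C\ge C_0$ and every $p\in\mathbb N$ there is a constant $C_1>0$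 depending only on $C$ and $p$ with the following property. For every MDP, $\phi$, $f$, $\kappa,K,M$, $d,H,T\ge1$ and $\Gamma\ge\gamma$ as above satisfying the two assumptions: 1. If $\Gamma\le\big((2+M+K+K\kappa^{-1})\,dTH\big)^p$, then with probability at least $1-\frac1{TH}$ $$\mathrm{Reg}(T)\le C_1\Big(H\sqrt{T\ln(TH)}+HK\kappa^{-1}\sqrt{(M+K+d^2\ln(KTH))\cdot Td\ln(1+T/d)}\Big)$$ (where $\sqrt x$ is read as $0$ for $x<0$). 2. With probability at least $1-\frac1{TH}$, $$\mathrm{Reg}(T)\le C_1\big(1+K\kappa^{-1}\sqrt{1+M+K+\ln(1+K+\Gamma)}\big)\cdot H\sqrt{d^3T}\cdot(1+\ln(TH)),$$ that is, $\mathrm{Reg}(T)=\tilde O(H\sqrt{d^3T})$, where $\tilde O$ suppresses factors of $M,K,\kappa,\Gamma$ and logarithms. -/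

import Mathlib

open MeasureTheory ProbabilityTheory Set

universe u v w

noncomputable section

namespace GLMRL

/-- The Euclidean space `ℝ^d`. -/
abbrev Vec (d : ℕ) := EuclideanSpace ℝ (Fin d)

/-! ### Episodic Markov decision processes -/

/-- An episodic MDP with state space `S` and action space `A` (the horizon is a separate
parameter): initial distribution, transition kernel, and reward distributions on `[0,1]`. -/
structure MDP (S : Type u) (A : Type v) [MeasurableSpace S] [MeasurableSpace A] where
  init : Measure S
  init_prob : IsProbabilityMeasure init
  trans : Kernel (S × A) S
  trans_markov : IsMarkovKernel trans
  reward : Kernel (S × A) ℝ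
  reward_markov : IsMarkovKernel reward
  reward_mem : ∀ x, ∀ᵐ ρ ∂(reward x), ρ ∈ Icc (0 : ℝ) 1

/-- A deterministic nonstationary policy: `π h : S → A` is used at time point `h = 1, 2, …`. -/
structure Policy (S : Type u) (A : Type v) [MeasurableSpace S] [MeasurableSpace A] where
  act : ℕ → S → A
  measurable_act : ∀ h, Measurable (act h)

section Value

variable {S : Type u} {A : Type v} [MeasurableSpace S] [MeasurableSpace A]

instance (M : MDP S A) : IsProbabilityMeasure M.init := M.init_prob
instance (M : MDP S A) : IsMarkovKernel M.trans := M.trans_markov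
instance (M : MDP S A) : IsMarkovKernel M.reward := M.reward_markov

/-- Given the state `s`, produce `(s, a, ρ)` with `a = p s` and `ρ ∼ R(s, a)`. -/
def MDP.emit (M : MDP S A) (p : S → A) (hp : Measurable p) : Kernel S (S × A × ℝ) :=
  Kernel.id ×ₖ (Kernel.deterministic p hp ×ₖ
    M.reward.comap (fun s => (s, p s)) (measurable_id.prodMk hp))

instance (M : MDP S A) (p : S → A) (hp : Measurable p) : IsMarkovKernel (M.emit p hp) := by
  unfold MDP.emit
  infer_instance

/-- One step of the decision process: from `(s, a, ρ)` draw `s' ∼ P(s, a)`, play `a' = p s'` and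
receive `ρ' ∼ R(s', a')`. -/
def MDP.next (M : MDP S A) (p : S → A) (hp : Measurable p) :
    Kernel (S × A × ℝ) (S × A × ℝ) :=
  M.emit p hp ∘ₖ M.trans.comap (fun z => (z.1, z.2.1)) (by fun_prop)

instance (M : MDP S A) (p : S → A) (hp : Measurable p) : IsMarkovKernel (M.next p hp) := by
  unfold MDP.next
  infer_instance

/-- The law of the trajectory `(s_1, a_1, r_1), (s_2, a_2, r_2), …` when `s_1 ∼ init` and actions
are chosen by `π`. Coordinate `n` of the sequence is time point `n + 1`. -/
def MDP.law (M : MDP S A) (π : Policy S A) : Measure (ℕ → S × A × ℝ) :=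
  Kernel.trajMeasure (X := fun _ => S × A × ℝ)
    (M.init.bind (M.emit (π.act 1) (π.measurable_act 1)))
    (fun n => (M.next (π.act (n + 2)) (π.measurable_act (n + 2))).comap
      (fun z => z ⟨n, Finset.mem_Iic.2 le_rfl⟩) (measurable_pi_apply _))

/-- `V^π`, the expected total reward of `π` over `H` steps. -/
def MDP.value (M : MDP S A) (H : ℕ) (π : Policy S A) : ℝ :=
  ∫ z, ∑ n ∈ Finset.range H, (z n).2.2 ∂(M.law π)

/-- `V^⋆`, the optimal value over nonstationary policies. -/
def MDP.optValue (M : MDP S A) (H : ℕ) : ℝ := ⨆ π : Policy S A, M.value H π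

/-- Normalization: the total reward of an episode is almost surely in `[0,1]`. -/
def MDP.Normalized (M : MDP S A) (H : ℕ) : Prop :=
  ∀ π : Policy S A, ∀ᵐ z ∂(M.law π), ∑ n ∈ Finset.range H, (z n).2.2 ∈ Icc (0 : ℝ) 1

/-- `V_Q(s) = max_a Q(s, a)`. -/
def maxQ (Q : S → A → ℝ) (s : S) : ℝ := ⨆ a, Q s a

/-- The Bellman update operator `𝒯_h`; it is degenerate at `h = H`. -/
def MDP.bellman (M : MDP S A) (H h : ℕ) (Q : S → A → ℝ) (s : S) (a : A) : ℝ :=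
  (∫ ρ, ρ ∂(M.reward (s, a))) + if h < H then ∫ s', maxQ Q s' ∂(M.trans (s, a)) else 0

end Value

/-! ### Generalized linear models and optimistic closure -/

/-- Regularity of the link function `f : [-1,1] → [-1,1]` with constants `κ, K, M`
(derivatives at the endpoints are one-sided). -/
structure LinkRegular (f : ℝ → ℝ) (κ K M : ℝ) : Prop where
  maps : MapsTo f (Icc (-1) 1) (Icc (-1) 1)
  monotone : MonotoneOn f (Icc (-1) 1) ∨ AntitoneOn f (Icc (-1) 1)
  diff : DifferentiableOn ℝ f (Icc (-1) 1)
  diff_deriv : DifferentiableOn ℝ (derivWithin f (Icc (-1) 1)) (Icc (-1) 1)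
  kappa_pos : 0 < κ
  deriv_lower : ∀ z ∈ Icc (-1 : ℝ) 1, κ ≤ |derivWithin f (Icc (-1) 1) z|
  deriv_upper : ∀ z ∈ Icc (-1 : ℝ) 1, |derivWithin f (Icc (-1) 1) z| ≤ K
  second_deriv : ∀ z ∈ Icc (-1 : ℝ) 1,
    |derivWithin (derivWithin f (Icc (-1) 1)) (Icc (-1) 1) z| ≤ M

/-- The Mahalanobis seminorm `‖x‖_B = √(xᵀ B x)`. -/
def mahalanobis {d : ℕ} (B : Matrix (Fin d) (Fin d) ℝ) (x : Vec d) : ℝ :=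
  √(x.ofLp ⬝ᵥ B.mulVec x.ofLp)

section Closure

variable {S : Type u} {A : Type v} {d : ℕ}

/-- The class `𝒢` of generalized linear models. -/
def glmClass (φ : S → A → Vec d) (f : ℝ → ℝ) : Set (S → A → ℝ) :=
  {g | ∃ θ : Vec d, ‖θ‖ ≤ 1 ∧ ∀ s a, g s a = f (inner ℝ (φ s a) θ)}

/-- The class `𝒢_up` of upper confidence bounds, with bonus multiplier at most `Γ`. -/
def glmUpClass (φ : S → A → Vec d) (f : ℝ → ℝ) (Γ : ℝ) : Set (S → A → ℝ) :=
  {g | ∃ (θ : Vec d) (γ : ℝ) (B : Matrix (Fin d) (Fin d) ℝ),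
    ‖θ‖ ≤ 1 ∧ 0 ≤ γ ∧ γ ≤ Γ ∧ B.PosSemidef ∧ ‖Matrix.toEuclideanCLM (𝕜 := ℝ) B‖ ≤ 1 ∧
    ∀ s a, g s a = min 1 (f (inner ℝ (φ s a) θ) + γ * mahalanobis B (φ s a))}

/-- Optimistic closure: Bellman updates of functions in `𝒢_up` are in `𝒢`, at every time point
`1 ≤ h ≤ H` (for `h = H` this says that the mean reward is in `𝒢`). -/
def OptimisticClosure [MeasurableSpace S] [MeasurableSpace A] (M : MDP S A) (H : ℕ)
    (φ : S → A → Vec d) (f : ℝ → ℝ) (Γ : ℝ) : Prop :=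
  ∀ h, 1 ≤ h → h ≤ H → ∀ g ∈ glmUpClass φ f Γ, M.bellman H h g ∈ glmClass φ f

end Closure

/-! ### The LSVI-UCB algorithm -/

/-- The bonus multiplier `γ = C K κ⁻¹ √(1 + M + K + d² ln((1 + K + Γ) T H))`. -/
def bonusParam (C κ K M Γ : ℝ) (d H T : ℕ) : ℝ :=
  C * K * κ⁻¹ * √(1 + M + K + (d : ℝ) ^ 2 * Real.log ((1 + K + Γ) * T * H))

/-- The random quantities of an execution of the algorithm; `t = 1, 2, …` is the episode and
`h = 1, …, H` the time point. -/
structure Execution (Ω : Type w) (S : Type u) (A : Type v) (d : ℕ) where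
  /-- states `s_{h,t}` -/
  s : ℕ → ℕ → Ω → S
  /-- actions `a_{h,t}` -/
  a : ℕ → ℕ → Ω → A
  /-- rewards `r_{h,t}` -/
  r : ℕ → ℕ → Ω → ℝ
  /-- policies `π_{h,t}` -/
  π : ℕ → ℕ → Ω → S → A
  /-- estimates `θ_{h,t}` -/
  θ : ℕ → ℕ → Ω → Vec d

namespace Execution

variable {Ω : Type w} {S : Type u} {A : Type v} {d : ℕ} (X : Execution Ω S A d)

section Sigma

variable [MeasurableSpace S] [MeasurableSpace A]

/-- The σ-algebra generated by the trajectories of all episodes before episode `t`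
(this is `ℱ_{t-1}`). -/
@[reducible] def before (H t : ℕ) : MeasurableSpace Ω :=
  ⨆ τ ∈ Finset.Ico 1 t, ⨆ h ∈ Finset.Icc 1 H,
    MeasurableSpace.comap (fun ω => (X.s h τ ω, X.a h τ ω, X.r h τ ω)) inferInstance

/-- All that is observed before the state `s_{h,t}` is revealed. -/
@[reducible] def history (H h t : ℕ) : MeasurableSpace Ω :=
  X.before H t ⊔ ⨆ h' ∈ Finset.Ico 1 h,
    MeasurableSpace.comap (fun ω => (X.s h' t ω, X.a h' t ω, X.r h' t ω)) inferInstance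

/-- All that is observed before the reward `r_{h,t}` is revealed. -/
@[reducible] def historySA (H h t : ℕ) : MeasurableSpace Ω :=
  X.history H h t ⊔ MeasurableSpace.comap (fun ω => (X.s h t ω, X.a h t ω)) inferInstance

end Sigma

/-- The covariate `x_{h,τ} = φ(s_{h,τ}, a_{h,τ})`. -/
def x (φ : S → A → Vec d) (h τ : ℕ) (ω : Ω) : Vec d := φ (X.s h τ ω) (X.a h τ ω)

/-- `Λ_{h,t} = ∑_{τ ≤ t} x_{h,τ} x_{h,τ}ᵀ + I`. -/
def Lam (φ : S → A → Vec d) (h t : ℕ) (ω : Ω) : Matrix (Fin d) (Fin d) ℝ :=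
  (∑ τ ∈ Finset.Icc 1 t, Matrix.vecMulVec (X.x φ h τ ω).ofLp (X.x φ h τ ω).ofLp) + 1

/-- The optimistic estimates `Q̄_{h,t}`: `Q̄_{H+1,t} ≡ 0`, `Q̄_{h,0} ≡ 1` for `h ≤ H`, and
`Q̄_{h,t}(s,a) = min{1, f(⟨φ(s,a), θ_{h,t}⟩) + γ ‖φ(s,a)‖_{Λ_{h,t}⁻¹}}` otherwise. -/
def Qbar (φ : S → A → Vec d) (f : ℝ → ℝ) (γ : ℝ) (H h t : ℕ) (ω : Ω) (s : S) (a : A) : ℝ :=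
  if H < h then 0
  else if t = 0 then 1
  else min 1 (f (inner ℝ (φ s a) (X.θ h t ω)) + γ * mahalanobis (X.Lam φ h t ω)⁻¹ (φ s a))

/-- The regression target `y_{h,τ} = r_{h,τ} + max_a Q̄_{h+1,t}(s_{h+1,τ}, a)` of episode `t`. -/
def y (φ : S → A → Vec d) (f : ℝ → ℝ) (γ : ℝ) (H h t τ : ℕ) (ω : Ω) : ℝ :=
  X.r h τ ω + maxQ (X.Qbar φ f γ H (h + 1) t ω) (X.s (h + 1) τ ω)

/-- The least squares objective `∑_{τ ≤ t} (y_{h,τ} - f(⟨x_{h,τ}, ϑ⟩))²`. -/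
def loss (φ : S → A → Vec d) (f : ℝ → ℝ) (γ : ℝ) (H h t : ℕ) (ω : Ω) (ϑ : Vec d) : ℝ :=
  ∑ τ ∈ Finset.Icc 1 t, (X.y φ f γ H h t τ ω - f (inner ℝ (X.x φ h τ ω) ϑ)) ^ 2

end Execution

/-- The conditional law of `Y` given the σ-algebra `m` is `ν`. -/
def HasCondLaw {Ω : Type w} {E : Type u} [MeasurableSpace Ω] [MeasurableSpace E] (P : Measure Ω)
    (m : MeasurableSpace Ω) (Y : Ω → E) (ν : Ω → Measure E) : Prop :=
  ∀ B, MeasurableSet B →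
    P[(Y ⁻¹' B).indicator (fun _ => (1 : ℝ)) | m] =ᵐ[P] fun ω => (ν ω).real B

/-- `X` is an execution of LSVI-UCB for `T` episodes of horizon `H` in the MDP `M`, with feature map
`φ`, link function `f` and bonus multiplier `γ`. The greedy policy and the constrained least squares
estimate may be any (measurable) choice of maximizers and minimizers. -/
structure IsLSVIUCB {Ω : Type w} {S : Type u} {A : Type v} {d : ℕ} [MeasurableSpace Ω]
    [mS : MeasurableSpace S] [MeasurableSpace A] (P : Measure Ω) (M : MDP S A) (H T : ℕ)
    (φ : S → A → Vec d) (f : ℝ → ℝ) (γ : ℝ) (X : Execution Ω S A d) : Prop where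
  measurable_s : ∀ t ∈ Icc 1 T, ∀ h ∈ Icc 1 H, Measurable (X.s h t)
  measurable_a : ∀ t ∈ Icc 1 T, ∀ h ∈ Icc 1 H, Measurable (X.a h t)
  measurable_r : ∀ t ∈ Icc 1 T, ∀ h ∈ Icc 1 H, Measurable (X.r h t)
  /-- the policy of episode `t` is determined by the episodes before `t` … -/
  measurable_policy : ∀ t ∈ Icc 1 T, ∀ h ∈ Icc 1 H,
    @Measurable (Ω × S) A ((X.before H t).prod mS) _ (fun z => X.π h t z.1 z.2)
  /-- … and it is greedy for `Q̄_{h,t-1}` -/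
  greedy : ∀ t ∈ Icc 1 T, ∀ h ∈ Icc 1 H, ∀ ω s a,
    X.Qbar φ f γ H h (t - 1) ω s a ≤ X.Qbar φ f γ H h (t - 1) ω s (X.π h t ω s)
  /-- the policy is used to collect a trajectory -/
  action : ∀ t ∈ Icc 1 T, ∀ h ∈ Icc 1 H, ∀ ω, X.a h t ω = X.π h t ω (X.s h t ω)
  init_law : ∀ t ∈ Icc 1 T, HasCondLaw P (X.before H t) (X.s 1 t) (fun _ => M.init)
  trans_law : ∀ t ∈ Icc 1 T, ∀ h, 1 ≤ h → h < H →
    HasCondLaw P (X.history H (h + 1) t) (X.s (h + 1) t)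
      (fun ω => M.trans (X.s h t ω, X.a h t ω))
  reward_law : ∀ t ∈ Icc 1 T, ∀ h ∈ Icc 1 H,
    HasCondLaw P (X.historySA H h t) (X.r h t) (fun ω => M.reward (X.s h t ω, X.a h t ω))
  /-- the estimate is computed from the trajectories up to episode `t` … -/
  measurable_est : ∀ t ∈ Icc 1 T, ∀ h ∈ Icc 1 H, Measurable[X.before H (t + 1)] (X.θ h t)
  /-- … as a minimizer of the least squares objective over the unit ball -/
  est_mem : ∀ t ∈ Icc 1 T, ∀ h ∈ Icc 1 H, ∀ ω, ‖X.θ h t ω‖ ≤ 1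
  est_min : ∀ t ∈ Icc 1 T, ∀ h ∈ Icc 1 H, ∀ ω, ∀ ϑ : Vec d, ‖ϑ‖ ≤ 1 →
    X.loss φ f γ H h t ω (X.θ h t ω) ≤ X.loss φ f γ H h t ω ϑ

/-- The cumulative regret `∑_{t ≤ T} (V^⋆ - 𝔼[∑_h r_{h,t} | ℱ_{t-1}])`. -/
def regret {Ω : Type w} {S : Type u} {A : Type v} {d : ℕ} [MeasurableSpace Ω]
    [MeasurableSpace S] [MeasurableSpace A] (P : Measure Ω) (M : MDP S A) (H T : ℕ)
    (X : Execution Ω S A d) (ω : Ω) : ℝ :=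
  T * M.optValue H -
    ∑ t ∈ Finset.Icc 1 T, (P[fun ω' => ∑ h ∈ Finset.Icc 1 H, X.r h t ω' | X.before H t]) ω

/-- The explicit regret bound, up to a universal constant. -/
def regretBound (κ K M : ℝ) (d H T : ℕ) : ℝ :=
  H * √(T * Real.log (T * H)) +
    H * K * κ⁻¹ * √((M + K + (d : ℝ) ^ 2 * Real.log (K * T * H)) *
      (T * d * Real.log (1 + T / d)))

end GLMRL

end

/-!
The proof follows the scheme "optimism plus concentration plus potential argument".

*Concentration.* Every random fluctuation is controlled by one exponential supermartingale: if the
noise `ξ i` is bounded by `c` and centered given the past, and `D i` is predictable, then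
`exp (∑ (D i ξ i - c² D i² / 2))` has expectation at most `1` (`IsNoise.tail_bound`); constant
coefficients give the Azuma–Hoeffding inequality (`IsNoise.azuma`). The conditional laws in the
definition of an execution enter through `HasCondLaw.condExp_eq`: since `Q̄_{h,t}` is determined by
finitely many real parameters, conditional expectations of its values at the next state are integrals
of a fixed jointly measurable function against the transition kernel.

*Confidence bounds.* By optimistic closure the Bellman update of `Q̄_{h+1,t}` is a generalized linear
model with some parameter `θ̄`, and the least squares problem defining `θ̂_{h,t}` is a regression on
this model, with the Bellman noise of `max_a Q̄_{h+1,t}`. The optimality of `θ̂` bounds the squared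
prediction errors `∑ Δ²` by `2 ∑ ξ Δ`. Both `ξ` and `Δ` depend on all the data, but they depend
continuously on `d² + 3d` real parameters; a union bound over a net of polynomial mesh
(`exists_net`, `exists_mesh`) and the supermartingale with coefficients `Δ / 18`, whose
compensator is absorbed into `∑ Δ²`, yield `∑ Δ² = O(d² ln((1 + K + Γ) T H))`. With the lower
bound `κ` on the slopes and the Cauchy–Schwarz inequality this is the confidence bound
`abs_clampLink_sub_le_bonus`, uniform in states and actions.

*Regret.* On this event `Q̄_{h,t}` dominates the Bellman update of `Q̄_{h+1,t}` and exceeds it by at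
most twice the bonus. Domination makes `Q̄_{1,t}` an upper bound for the optimal value
(`MDP.value_le_of_bellman_le`); the regret is then telescoped along the observed trajectories
into bonuses and martingale differences (`regret_le_of_confidence`), and the bonuses are summed with
the elliptical potential lemma (`sum_mahalanobis_le`). Since the bonus multiplier dominates the
square root of the confidence level, the martingale terms are absorbed too, so that
`Reg(T) = O(H γ √(T d ln(1 + T/d)))` as soon as `d ≤ T` (`measureReal_regret_le_bonus`).

*Comparison with the stated bounds.* If `d`, `M + K` or `K / κ` is at least `T`, then the bounds
exceed the number of episodes. If `K T H ≤ √(T H)`, where the logarithm `ln (K T H)` may be negative,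
then all mean rewards nearly coincide and the regret is at most `2 K T H`. In the remaining case
`ln (K T H)` is comparable to `ln (T H)`, and hence to the logarithm in the bonus multiplier.
-/

noncomputable section

namespace GLMRL

/-! ### Exponential supermartingales -/

section Concentration

variable {Ω : Type*} {m m0 : MeasurableSpace Ω} {P : Measure[m0] Ω}

theorem integral_mul_eq_zero_of_condExp_eq_zero (hm : m ≤ m0) [IsProbabilityMeasure P]
    {W ξ : Ω → ℝ} {c B : ℝ} (hW : Measurable[m] W) (hWB : ∀ᵐ ω ∂P, |W ω| ≤ B)
    (hξ : Measurable ξ) (hξc : ∀ᵐ ω ∂P, |ξ ω| ≤ c) (hcond : P[ξ | m] =ᵐ[P] 0) :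
    Integrable (fun ω => W ω * ξ ω) P ∧ ∫ ω, W ω * ξ ω ∂P = 0 := by
  have hξi : Integrable ξ P := Integrable.of_bound hξ.aestronglyMeasurable c hξc
  have hint : Integrable (fun ω => W ω * ξ ω) P :=
    hξi.bdd_mul (hW.mono hm le_rfl).aestronglyMeasurable hWB
  refine ⟨hint, ?_⟩
  have h1 : P[fun ω => W ω * ξ ω | m] =ᵐ[P] 0 := by
    have := condExp_mul_of_stronglyMeasurable_left (m := m) (μ := P) hW.stronglyMeasurable hint hξi
    refine (this.trans ?_)
    filter_upwards [hcond] with ω hω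
    simp [hω]
  rw [← integral_condExp hm, integral_congr_ae h1]
  simp

/-- One step of the exponential supermartingale: the conditional form of Hoeffding's lemma for a
noise `ξ` in `[-c, c]`, with a predictable coefficient `D`. -/
theorem integral_mul_exp_le (hm : m ≤ m0) [IsProbabilityMeasure P]
    {W D ξ : Ω → ℝ} {c B b : ℝ} (hW : Measurable[m] W) (hW0 : ∀ ω, 0 ≤ W ω)
    (hWB : ∀ᵐ ω ∂P, W ω ≤ B) (hD : Measurable[m] D) (hDb : ∀ ω, |D ω| ≤ b)
    (hξ : Measurable ξ) (hc : 0 < c) (hξc : ∀ᵐ ω ∂P, |ξ ω| ≤ c) (hcond : P[ξ | m] =ᵐ[P] 0) :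
    ∫ ω, W ω * Real.exp (D ω * ξ ω - c ^ 2 * D ω ^ 2 / 2) ∂P ≤ ∫ ω, W ω ∂P := by
  have hWi : Integrable W P := by
    refine Integrable.of_bound (hW.mono hm le_rfl).aestronglyMeasurable B ?_
    filter_upwards [hWB] with ω hω
    rwa [Real.norm_of_nonneg (hW0 ω)]
  set W2 : Ω → ℝ := fun ω => W ω * Real.exp (-(c ^ 2 * D ω ^ 2 / 2)) * Real.sinh (c * D ω) / c
    with hW2
  have hW2m : Measurable[m] W2 := by
    have h1 : Measurable fun p : ℝ × ℝ =>
        p.1 * Real.exp (-(c ^ 2 * p.2 ^ 2 / 2)) * Real.sinh (c * p.2) / c := by fun_prop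
    exact h1.comp (hW.prodMk hD)
  have hW2b : ∀ᵐ ω ∂P, |W2 ω| ≤ B * Real.sinh (c * b) / c := by
    filter_upwards [hWB] with ω hω
    have hB : 0 ≤ B := (hW0 ω).trans hω
    have h1 : |Real.sinh (c * D ω)| ≤ Real.sinh (c * b) := by
      rw [Real.abs_sinh, abs_mul, abs_of_pos hc]
      exact Real.sinh_le_sinh.2 (mul_le_mul_of_nonneg_left (hDb ω) hc.le)
    have h2 : Real.exp (-(c ^ 2 * D ω ^ 2 / 2)) ≤ 1 := by
      rw [Real.exp_le_one_iff]
      have : 0 ≤ c ^ 2 * D ω ^ 2 := by positivity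
      linarith
    rw [hW2]
    simp only [abs_div, abs_mul, abs_of_pos hc, abs_of_nonneg (hW0 ω), Real.abs_exp]
    have h3 : W ω * Real.exp (-(c ^ 2 * D ω ^ 2 / 2)) ≤ B := by
      nlinarith [hW0 ω, Real.exp_pos (-(c ^ 2 * D ω ^ 2 / 2))]
    exact div_le_div_of_nonneg_right (mul_le_mul h3 h1 (abs_nonneg _) hB) hc.le
  obtain ⟨hint, hzero⟩ := integral_mul_eq_zero_of_condExp_eq_zero hm hW2m hW2b hξ hξc hcond
  calc ∫ ω, W ω * Real.exp (D ω * ξ ω - c ^ 2 * D ω ^ 2 / 2) ∂P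
      ≤ ∫ ω, (W ω + W2 ω * ξ ω) ∂P := by
        refine integral_mono_of_nonneg (Filter.Eventually.of_forall fun ω =>
          mul_nonneg (hW0 ω) (Real.exp_pos _).le) (hWi.add hint) ?_
        filter_upwards [hξc] with ω hω
        have h1 := Real.exp_mul_le_cosh_add_mul_sinh (t := ξ ω / c)
          (by rw [abs_div, abs_of_pos hc]; exact (div_le_one hc).2 hω) (c * D ω)
        have h2 := Real.cosh_le_exp_half_sq (c * D ω)
        have e1 : ξ ω / c * (c * D ω) = D ω * ξ ω := by field_simp
        rw [e1] at h1
        have h3 : Real.exp (D ω * ξ ω - c ^ 2 * D ω ^ 2 / 2) =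
            Real.exp (D ω * ξ ω) * Real.exp (-(c ^ 2 * D ω ^ 2 / 2)) := by
          rw [← Real.exp_add]; ring_nf
        set E := Real.exp (-(c ^ 2 * D ω ^ 2 / 2)) with hE
        have hE0 : 0 < E := Real.exp_pos _
        have h4 : Real.cosh (c * D ω) * E ≤ 1 := by
          calc Real.cosh (c * D ω) * E ≤ Real.exp ((c * D ω) ^ 2 / 2) * E := by gcongr
            _ = 1 := by rw [hE, ← Real.exp_add]; ring_nf; simp
        have h5 : Real.exp (D ω * ξ ω) * E ≤ 1 + ξ ω / c * Real.sinh (c * D ω) * E := by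
          nlinarith
        calc W ω * Real.exp (D ω * ξ ω - c ^ 2 * D ω ^ 2 / 2)
            ≤ W ω * (1 + ξ ω / c * Real.sinh (c * D ω) * E) := by
              rw [h3]; exact mul_le_mul_of_nonneg_left h5 (hW0 ω)
          _ = W ω + W2 ω * ξ ω := by rw [hW2]; simp only [← hE]; field_simp
    _ = ∫ ω, W ω ∂P := by rw [integral_add hWi hint, hzero, add_zero]

/-- Noise variables `ξ i`, bounded by `c` and centered given the past `m i`, for `i < n`. -/
structure IsNoise (P : Measure[m0] Ω) (m : ℕ → MeasurableSpace Ω) (n : ℕ) (c : ℝ)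
    (ξ : ℕ → Ω → ℝ) : Prop where
  le : ∀ i < n, m i ≤ m0
  measurable : ∀ i < n, Measurable (ξ i)
  past : ∀ i < n, ∀ j < i, Measurable[m i] (ξ j)
  bound : ∀ i < n, ∀ᵐ ω ∂P, |ξ i ω| ≤ c
  centered : ∀ i < n, P[ξ i | m i] =ᵐ[P] 0

theorem IsNoise.integral_exp_le_one [IsProbabilityMeasure P] {m : ℕ → MeasurableSpace Ω} {n : ℕ}
    {c b : ℝ} {ξ D : ℕ → Ω → ℝ} (h : IsNoise P m n c ξ) (hc : 0 < c)
    (hD : ∀ i < n, ∀ j ≤ i, Measurable[m i] (D j)) (hDb : ∀ i < n, ∀ ω, |D i ω| ≤ b) :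
    ∀ k ≤ n, (∃ B : ℝ, ∀ᵐ ω ∂P,
        Real.exp (∑ i ∈ Finset.range k, (D i ω * ξ i ω - c ^ 2 * D i ω ^ 2 / 2)) ≤ B) ∧
      ∫ ω, Real.exp (∑ i ∈ Finset.range k, (D i ω * ξ i ω - c ^ 2 * D i ω ^ 2 / 2)) ∂P ≤ 1 := by
  intro k
  induction k with
  | zero => intro _; exact ⟨⟨1, by simp⟩, by simp⟩
  | succ k ih =>
    intro hk
    obtain ⟨⟨B, hB⟩, h1⟩ := ih (by omega)
    have hkn : k < n := by omega
    have hsplit : ∀ ω, Real.exp (∑ i ∈ Finset.range (k + 1),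
        (D i ω * ξ i ω - c ^ 2 * D i ω ^ 2 / 2)) =
        Real.exp (∑ i ∈ Finset.range k, (D i ω * ξ i ω - c ^ 2 * D i ω ^ 2 / 2)) *
          Real.exp (D k ω * ξ k ω - c ^ 2 * D k ω ^ 2 / 2) := fun ω => by
      rw [Finset.sum_range_succ, Real.exp_add]
    constructor
    · refine ⟨B * Real.exp (b * c), ?_⟩
      filter_upwards [hB, h.bound k hkn] with ω hω hξ
      rw [hsplit]
      have hb : 0 ≤ b := (abs_nonneg _).trans (hDb k hkn ω)
      have : D k ω * ξ k ω ≤ b * c := (le_abs_self _).trans (by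
        rw [abs_mul]; exact mul_le_mul (hDb k hkn ω) hξ (abs_nonneg _) hb)
      have h2 : 0 ≤ c ^ 2 * D k ω ^ 2 / 2 := by positivity
      exact mul_le_mul hω (Real.exp_le_exp.2 (by linarith)) (Real.exp_pos _).le
        ((Real.exp_pos _).le.trans hω)
    · simp_rw [hsplit]
      refine le_trans (integral_mul_exp_le (m := m k) (h.le k hkn) ?_ (fun ω => (Real.exp_pos _).le)
        hB (hD k hkn k le_rfl) (hDb k hkn) (h.measurable k hkn) hc (h.bound k hkn)
        (h.centered k hkn)) h1
      refine Real.measurable_exp.comp ?_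
      refine Finset.measurable_sum _ fun i hi => ?_
      have hi' : i < k := Finset.mem_range.1 hi
      have h1 : Measurable fun p : ℝ × ℝ => p.1 * p.2 - c ^ 2 * p.1 ^ 2 / 2 := by fun_prop
      exact h1.comp ((hD k hkn i hi'.le).prodMk (h.past k hkn i hi'))

/-- Markov's inequality for the exponential supermartingale. -/
theorem IsNoise.tail_bound [IsProbabilityMeasure P] {m : ℕ → MeasurableSpace Ω} {n : ℕ}
    {c b : ℝ} {ξ D : ℕ → Ω → ℝ} (h : IsNoise P m n c ξ) (hc : 0 < c)
    (hD : ∀ i < n, ∀ j ≤ i, Measurable[m i] (D j)) (hDb : ∀ i < n, ∀ ω, |D i ω| ≤ b) (ℓ : ℝ) :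
    P.real {ω | ℓ ≤ ∑ i ∈ Finset.range n, (D i ω * ξ i ω - c ^ 2 * D i ω ^ 2 / 2)} ≤
      Real.exp (-ℓ) := by
  obtain ⟨⟨B, hB⟩, h1⟩ := h.integral_exp_le_one hc hD hDb n le_rfl
  have hmeas : Measurable fun ω =>
      Real.exp (∑ i ∈ Finset.range n, (D i ω * ξ i ω - c ^ 2 * D i ω ^ 2 / 2)) := by
    refine Real.measurable_exp.comp ?_
    refine Finset.measurable_sum _ fun i hi => ?_
    have hi' : i < n := Finset.mem_range.1 hi
    have h1 : Measurable fun p : ℝ × ℝ => p.1 * p.2 - c ^ 2 * p.1 ^ 2 / 2 := by fun_prop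
    exact h1.comp (((hD i hi' i le_rfl).mono (h.le i hi') le_rfl).prodMk (h.measurable i hi'))
  have hint : Integrable (fun ω =>
      Real.exp (∑ i ∈ Finset.range n, (D i ω * ξ i ω - c ^ 2 * D i ω ^ 2 / 2))) P := by
    refine Integrable.of_bound hmeas.aestronglyMeasurable B ?_
    filter_upwards [hB] with ω hω
    rwa [Real.norm_of_nonneg (Real.exp_pos _).le]
  have h2 := mul_meas_ge_le_integral_of_nonneg
    (Filter.Eventually.of_forall fun ω => (Real.exp_pos _).le) hint (Real.exp ℓ)
  have h3 : {ω | Real.exp ℓ ≤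
      Real.exp (∑ i ∈ Finset.range n, (D i ω * ξ i ω - c ^ 2 * D i ω ^ 2 / 2))} =
      {ω | ℓ ≤ ∑ i ∈ Finset.range n, (D i ω * ξ i ω - c ^ 2 * D i ω ^ 2 / 2)} := by
    ext ω; simp
  rw [h3] at h2
  rw [Real.exp_neg, ← one_div, le_div_iff₀ (Real.exp_pos _), mul_comm]
  exact h2.trans h1

/-- The Azuma–Hoeffding inequality. -/
theorem IsNoise.azuma [IsProbabilityMeasure P] {m : ℕ → MeasurableSpace Ω} {n : ℕ}
    {c : ℝ} {ξ : ℕ → Ω → ℝ} (h : IsNoise P m n c ξ) (hc : 0 < c) {ℓ : ℝ} (hℓ : 0 < ℓ) :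
    P.real {ω | c * √(2 * n * ℓ) < ∑ i ∈ Finset.range n, ξ i ω} ≤ Real.exp (-ℓ) := by
  rcases Nat.eq_zero_or_pos n with rfl | hn
  · simp [Real.exp_nonneg]
  have hn' : (0 : ℝ) < n := by exact_mod_cast hn
  set q : ℝ := √(2 * n * ℓ) with hq
  have hq0 : 0 < q := Real.sqrt_pos.2 (by positivity)
  have hqq : q * q = 2 * n * ℓ := Real.mul_self_sqrt (by positivity)
  set lam : ℝ := q / (n * c) with hlam
  refine le_trans (measureReal_mono ?_) (h.tail_bound (D := fun _ _ => lam) (b := |lam|) hc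
    (fun _ _ _ _ => measurable_const) (fun _ _ _ => le_rfl) ℓ)
  intro ω hω
  simp only [mem_ofPred_eq] at hω ⊢
  rw [Finset.sum_sub_distrib, ← Finset.mul_sum, Finset.sum_const, Finset.card_range, nsmul_eq_mul]
  have h1 : lam * (c * q) = 2 * ℓ := by
    rw [hlam]; field_simp; nlinarith
  have h2 : (n : ℝ) * (c ^ 2 * lam ^ 2 / 2) = ℓ := by
    rw [hlam]; field_simp; nlinarith
  have h3 : lam * (c * q) ≤ lam * ∑ i ∈ Finset.range n, ξ i ω :=
    mul_le_mul_of_nonneg_left hω.le (by positivity)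
  linarith

end Concentration

/-! ### Conditional laws -/

section CondLaw

variable {Ω : Type w} {m m0 : MeasurableSpace Ω} {P : Measure[m0] Ω}
  {E : Type u} {Z' : Type v} [MeasurableSpace E] [MeasurableSpace Z']

/-- If `κ (Z ω)` is the conditional law of `Y` given `m` and `Z` is `m`-measurable, then conditional
expectations of functions of `(Z, Y)` are integrals against `κ`. -/
theorem HasCondLaw.condExp_eq [IsProbabilityMeasure P] (hm : m ≤ m0) {Y : Ω → E}
    (hY : Measurable Y) {Z : Ω → Z'} (hZ : Measurable[m] Z) (κ : Kernel Z' E) [IsMarkovKernel κ]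
    (h : HasCondLaw P m Y (fun ω => κ (Z ω))) {G : Z' × E → ℝ} (hG : Measurable G) {c : ℝ}
    (hc : ∀ z, |G z| ≤ c) :
    P[fun ω => G (Z ω, Y ω) | m] =ᵐ[P] fun ω => ∫ y, G (Z ω, y) ∂(κ (Z ω)) := by
  have hZ0 : Measurable Z := hZ.mono hm le_rfl
  have hGint : ∀ μ : Measure (Z' × E), IsFiniteMeasure μ → Integrable G μ := fun μ _ =>
    Integrable.of_bound hG.aestronglyMeasurable c (Filter.Eventually.of_forall hc)
  have hker : StronglyMeasurable fun z => ∫ y, G (z, y) ∂(κ z) :=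
    hG.stronglyMeasurable.integral_kernel_prod_right'
  have hkerb : ∀ z, ‖∫ y, G (z, y) ∂(κ z)‖ ≤ c := fun z => by
    have := norm_integral_le_of_norm_le_const (μ := κ z) (f := fun y => G (z, y)) (C := c)
      (Filter.Eventually.of_forall fun y => hc _)
    simpa using this
  symm
  refine ae_eq_condExp_of_forall_setIntegral_eq hm ?_ ?_ ?_ ?_
  · exact Integrable.of_bound (hG.comp (hZ0.prodMk hY)).aestronglyMeasurable c
      (Filter.Eventually.of_forall fun ω => hc _)
  · intro s _ _
    exact (Integrable.of_bound (hker.measurable.comp hZ0).aestronglyMeasurable c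
      (Filter.Eventually.of_forall fun ω => hkerb _)).integrableOn
  · intro s hs _
    have hs0 : MeasurableSet s := hm s hs
    have key : (P.restrict s).map (fun ω => (Z ω, Y ω)) = ((P.restrict s).map Z) ⊗ₘ κ := by
      refine Measure.ext_prod (fun {B D} hB hD => ?_)
      rw [Measure.map_apply (hZ0.prodMk hY) (hB.prod hD),
        Measure.restrict_apply ((hZ0.prodMk hY) (hB.prod hD)),
        Measure.compProd_apply_prod hB hD]
      have hsB : MeasurableSet[m] (s ∩ Z ⁻¹' B) := hs.inter (hZ hB)
      have hsB0 : MeasurableSet (s ∩ Z ⁻¹' B) := hm _ hsB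
      have e1 := setIntegral_condExp hm (f := (Y ⁻¹' D).indicator (fun _ => (1 : ℝ))) (μ := P)
        ((integrable_const (1 : ℝ)).indicator (hY hD)) hsB
      have e2 : ∫ ω in s ∩ Z ⁻¹' B, (κ (Z ω)).real D ∂P =
          ∫ ω in s ∩ Z ⁻¹' B, (Y ⁻¹' D).indicator (fun _ => (1 : ℝ)) ω ∂P := by
        rw [← e1]
        exact setIntegral_congr_ae hsB0 ((h D hD).mono fun ω hω _ => hω.symm)
      rw [integral_indicator_const _ (hY hD), smul_eq_mul, mul_one] at e2
      rw [setLIntegral_map hB (κ.measurable_coe hD) hZ0, Measure.restrict_restrict (hZ0 hB),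
        inter_comm (Z ⁻¹' B) s]
      have e3 : (∫⁻ ω in s ∩ Z ⁻¹' B, κ (Z ω) D ∂P) =
          ENNReal.ofReal (∫ ω in s ∩ Z ⁻¹' B, (κ (Z ω)).real D ∂P) := by
        rw [ofReal_integral_eq_lintegral_ofReal]
        · exact lintegral_congr fun ω => by simp
        · refine (Integrable.of_bound (C := 1) ?_ ?_).integrableOn
          · exact (((κ.measurable_coe hD).comp hZ0).ennreal_toReal).aestronglyMeasurable
          · exact Filter.Eventually.of_forall fun ω => by
              rw [Real.norm_of_nonneg measureReal_nonneg]; exact measureReal_le_one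
        · exact Filter.Eventually.of_forall fun ω => measureReal_nonneg
      rw [e3, e2, ofReal_measureReal, Measure.restrict_apply (hY hD)]
      congr 1
      ext ω
      simp only [mem_inter_iff, mem_preimage, mem_prod]
      tauto
    have h1 : ∫ ω in s, G (Z ω, Y ω) ∂P = ∫ z, G z ∂((P.restrict s).map fun ω => (Z ω, Y ω)) :=
      (integral_map (hZ0.prodMk hY).aemeasurable hG.aestronglyMeasurable).symm
    rw [h1, key, Measure.integral_compProd (hGint _ inferInstance),
      integral_map hZ0.aemeasurable hker.aestronglyMeasurable]
  · exact (hker.measurable.comp hZ).stronglyMeasurable.aestronglyMeasurable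

/-- A property that holds almost surely under all conditional laws holds almost surely. -/
theorem HasCondLaw.ae_of_forall_ae [IsProbabilityMeasure P] (hm : m ≤ m0) {Y : Ω → E}
    (hY : Measurable Y) {ν : Ω → Measure E} (h : HasCondLaw P m Y ν) {B : Set E}
    (hB : MeasurableSet B) (hν : ∀ ω, ∀ᵐ y ∂(ν ω), y ∈ B) : ∀ᵐ ω ∂P, Y ω ∈ B := by
  have h1 := setIntegral_condExp hm (f := (Y ⁻¹' Bᶜ).indicator (fun _ => (1 : ℝ))) (μ := P)
    ((integrable_const (1 : ℝ)).indicator (hY hB.compl)) MeasurableSet.univ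
  rw [setIntegral_univ, setIntegral_univ, integral_congr_ae (h Bᶜ hB.compl),
    integral_indicator_const _ (hY hB.compl)] at h1
  have h2 : ∀ ω, (ν ω).real Bᶜ = 0 := fun ω => by
    rw [measureReal_def, show ν ω Bᶜ = 0 from hν ω]; rfl
  simp only [h2, integral_zero, smul_eq_mul, mul_one] at h1
  have h3 : P (Y ⁻¹' Bᶜ) = 0 := by
    rw [measureReal_def] at h1
    exact ((ENNReal.toReal_eq_zero_iff _).1 h1.symm).resolve_right (measure_ne_top _ _)
  exact h3

end CondLaw

/-! ### Regularized Gram matrices -/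

section Gram

open Matrix

variable {d : ℕ}

theorem inner_eq_dotProduct (x y : Vec d) : inner ℝ x y = x.ofLp ⬝ᵥ y.ofLp := by
  rw [EuclideanSpace.inner_eq_star_dotProduct, dotProduct_comm]
  simp

theorem norm_sq_eq_dotProduct (x : Vec d) : ‖x‖ ^ 2 = x.ofLp ⬝ᵥ x.ofLp := by
  rw [← inner_eq_dotProduct, real_inner_self_eq_norm_sq]

/-- The regularized Gram matrix `I + ∑_{τ ≤ t} x_τ x_τᵀ`. -/
def gram (x : ℕ → Vec d) (t : ℕ) : Matrix (Fin d) (Fin d) ℝ :=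
  (∑ τ ∈ Finset.Icc 1 t, vecMulVec (x τ).ofLp (x τ).ofLp) + 1

theorem gram_zero (x : ℕ → Vec d) : gram x 0 = 1 := by simp [gram]

theorem gram_succ (x : ℕ → Vec d) (t : ℕ) :
    gram x (t + 1) = gram x t + vecMulVec (x (t + 1)).ofLp (x (t + 1)).ofLp := by
  simp only [gram, Finset.sum_Icc_succ_top (Nat.le_add_left 1 t)]
  abel

theorem dotProduct_gram_mulVec (x : ℕ → Vec d) (t : ℕ) (v : Vec d) :
    v.ofLp ⬝ᵥ (gram x t *ᵥ v.ofLp) =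
      ∑ τ ∈ Finset.Icc 1 t, inner ℝ (x τ) v ^ 2 + ‖v‖ ^ 2 := by
  simp only [gram, add_mulVec, one_mulVec, dotProduct_add, norm_sq_eq_dotProduct,
    sum_mulVec, dotProduct_sum]
  congr 1
  refine Finset.sum_congr rfl fun τ _ => ?_
  rw [vecMulVec_mulVec, inner_eq_dotProduct]
  simp [dotProduct_smul, dotProduct_comm, sq]

theorem gram_isHermitian (x : ℕ → Vec d) (t : ℕ) : (gram x t).IsHermitian := by
  induction t with
  | zero => rw [gram_zero]; exact isHermitian_one
  | succ t ih =>
    rw [gram_succ]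
    refine ih.add ?_
    ext i j
    simp [vecMulVec_apply, mul_comm]

theorem gram_posDef (x : ℕ → Vec d) (t : ℕ) : (gram x t).PosDef := by
  refine Matrix.PosDef.of_dotProduct_mulVec_pos (gram_isHermitian x t) fun v hv => ?_
  have h := dotProduct_gram_mulVec x t (WithLp.toLp 2 v)
  simp only [star_trivial]
  rw [show v = (WithLp.toLp 2 v).ofLp from rfl, h]
  have h1 : 0 < ‖(WithLp.toLp 2 v : Vec d)‖ := by
    rw [norm_pos_iff]
    intro h0
    exact hv (by simpa using h0)
  have h2 : 0 ≤ ∑ τ ∈ Finset.Icc 1 t, inner ℝ (x τ) (WithLp.toLp 2 v) ^ 2 :=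
    Finset.sum_nonneg fun _ _ => sq_nonneg _
  positivity

theorem gram_mulVec_inv (x : ℕ → Vec d) (t : ℕ) (v : Fin d → ℝ) :
    gram x t *ᵥ ((gram x t)⁻¹ *ᵥ v) = v := by
  rw [mulVec_mulVec, mul_nonsing_inv _ ((isUnit_iff_isUnit_det _).1 (gram_posDef x t).isUnit),
    one_mulVec]

theorem gram_inv_posSemidef (x : ℕ → Vec d) (t : ℕ) : (gram x t)⁻¹.PosSemidef :=
  (gram_posDef x t).inv.posSemidef

/-- The inverse Gram matrix is a contraction, since the Gram matrix dominates the identity. -/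
theorem norm_gram_inv_mulVec_le (x : ℕ → Vec d) (t : ℕ) (v : Vec d) :
    ‖(WithLp.toLp 2 ((gram x t)⁻¹ *ᵥ v.ofLp) : Vec d)‖ ≤ ‖v‖ := by
  set w : Vec d := WithLp.toLp 2 ((gram x t)⁻¹ *ᵥ v.ofLp) with hw
  have h := dotProduct_gram_mulVec x t w
  rw [show gram x t *ᵥ w.ofLp = v.ofLp from gram_mulVec_inv x t _, ← inner_eq_dotProduct] at h
  have h2 : 0 ≤ ∑ τ ∈ Finset.Icc 1 t, inner ℝ (x τ) w ^ 2 :=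
    Finset.sum_nonneg fun _ _ => sq_nonneg _
  have h3 := real_inner_le_norm w v
  by_contra! hlt
  nlinarith [norm_nonneg v, norm_nonneg w]

theorem norm_toEuclideanCLM_gram_inv_le (x : ℕ → Vec d) (t : ℕ) :
    ‖Matrix.toEuclideanCLM (𝕜 := ℝ) (gram x t)⁻¹‖ ≤ 1 := by
  refine ContinuousLinearMap.opNorm_le_bound _ zero_le_one fun v => ?_
  rw [one_mul]
  exact norm_gram_inv_mulVec_le x t v

theorem mahalanobis_nonneg (B : Matrix (Fin d) (Fin d) ℝ) (x : Vec d) : 0 ≤ mahalanobis B x :=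
  Real.sqrt_nonneg _

theorem sq_mahalanobis_gram_inv (x : ℕ → Vec d) (t : ℕ) (v : Vec d) :
    mahalanobis (gram x t)⁻¹ v ^ 2 = v.ofLp ⬝ᵥ ((gram x t)⁻¹ *ᵥ v.ofLp) := by
  have h := (gram_inv_posSemidef x t).dotProduct_mulVec_nonneg v.ofLp
  rw [star_trivial] at h
  exact Real.sq_sqrt h

theorem mahalanobis_gram_inv_le_norm (x : ℕ → Vec d) (t : ℕ) (v : Vec d) :
    mahalanobis (gram x t)⁻¹ v ≤ ‖v‖ := by
  refine (sq_le_sq₀ (mahalanobis_nonneg _ _) (norm_nonneg _)).1 ?_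
  rw [sq_mahalanobis_gram_inv]
  have h := real_inner_le_norm v (WithLp.toLp 2 ((gram x t)⁻¹ *ᵥ v.ofLp))
  rw [inner_eq_dotProduct] at h
  refine h.trans ?_
  rw [sq]
  exact mul_le_mul_of_nonneg_left (norm_gram_inv_mulVec_le x t v) (norm_nonneg _)

/-- The Cauchy–Schwarz inequality for the norms `‖·‖_{Λ⁻¹}` and `‖·‖_Λ`. -/
theorem abs_inner_le_mahalanobis (x : ℕ → Vec d) (t : ℕ) (φ v : Vec d) :
    |inner ℝ φ v| ≤ mahalanobis (gram x t)⁻¹ φ *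
      √(∑ τ ∈ Finset.Icc 1 t, inner ℝ (x τ) v ^ 2 + ‖v‖ ^ 2) := by
  set w : Vec d := WithLp.toLp 2 ((gram x t)⁻¹ *ᵥ φ.ofLp) with hw
  have hgw : gram x t *ᵥ w.ofLp = φ.ofLp := gram_mulVec_inv x t _
  have hq : ∀ s : ℝ, 0 ≤ (mahalanobis (gram x t)⁻¹ φ ^ 2) * (s * s) + (2 * inner ℝ φ v) * s +
      (∑ τ ∈ Finset.Icc 1 t, inner ℝ (x τ) v ^ 2 + ‖v‖ ^ 2) := by
    intro s
    have h := (gram_posDef x t).posSemidef.dotProduct_mulVec_nonneg (s • w + v).ofLp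
    rw [star_trivial] at h
    have hs : w.ofLp ⬝ᵥ (gram x t *ᵥ v.ofLp) = inner ℝ φ v := by
      rw [dotProduct_mulVec, ← mulVec_transpose,
        show (gram x t)ᵀ = gram x t from (by simpa using gram_isHermitian x t : (gram x t).IsSymm), hgw,
        inner_eq_dotProduct]
    have e : (s • w + v).ofLp ⬝ᵥ (gram x t *ᵥ (s • w + v).ofLp) =
        (mahalanobis (gram x t)⁻¹ φ ^ 2) * (s * s) + (2 * inner ℝ φ v) * s +
      (∑ τ ∈ Finset.Icc 1 t, inner ℝ (x τ) v ^ 2 + ‖v‖ ^ 2) := by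
      rw [← dotProduct_gram_mulVec, sq_mahalanobis_gram_inv]
      simp only [WithLp.ofLp_add, WithLp.ofLp_smul, mulVec_add, mulVec_smul, hgw, dotProduct_add,
        add_dotProduct, smul_dotProduct, dotProduct_smul, smul_eq_mul, hs]
      rw [inner_eq_dotProduct, dotProduct_comm v.ofLp φ.ofLp, hw]
      simp only
      rw [dotProduct_comm _ φ.ofLp]
      ring
    rwa [e] at h
  have hdisc := discrim_le_zero hq
  rw [discrim] at hdisc
  rw [mahalanobis_nonneg _ _ |> Real.sqrt_sq |>.symm, ← Real.sqrt_mul (sq_nonneg _)]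
  exact Real.abs_le_sqrt (by nlinarith)

theorem det_gram_succ (x : ℕ → Vec d) (t : ℕ) :
    (gram x (t + 1)).det =
      (gram x t).det * (1 + mahalanobis (gram x t)⁻¹ (x (t + 1)) ^ 2) := by
  have hu : IsUnit (gram x t).det :=
    (isUnit_iff_isUnit_det _).1 (gram_posDef x t).isUnit
  rw [gram_succ, vecMulVec_eq Unit, det_add_replicateCol_mul_replicateRow hu,
    sq_mahalanobis_gram_inv]
  congr 1
  rw [Matrix.mul_assoc, ← replicateCol_mulVec]
  simp [replicateRow_mul_replicateCol_apply]

theorem trace_gram_le (x : ℕ → Vec d) (hx : ∀ τ, ‖x τ‖ ≤ 1) (t : ℕ) :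
    (gram x t).trace ≤ d + t := by
  induction t with
  | zero => rw [gram_zero]; simp
  | succ t ih =>
    rw [gram_succ, trace_add, trace_vecMulVec, ← norm_sq_eq_dotProduct]
    have := pow_le_one₀ (n := 2) (norm_nonneg _) (hx (t + 1))
    push_cast
    linarith

/-- The determinant is at most the `d`-th power of the normalized trace (inequality of arithmetic
and geometric means for the eigenvalues). -/
theorem log_det_gram_le (hd : 1 ≤ d) (x : ℕ → Vec d) (hx : ∀ τ, ‖x τ‖ ≤ 1) (t : ℕ) :
    Real.log (gram x t).det ≤ d * Real.log (1 + t / d) := by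
  have hd' : (0 : ℝ) < d := by exact_mod_cast hd
  have hH := gram_isHermitian x t
  have hpos : ∀ i, 0 < hH.eigenvalues i := (gram_posDef x t).eigenvalues_pos
  have hdet : (gram x t).det = ∏ i, hH.eigenvalues i := by
    simpa using hH.det_eq_prod_eigenvalues
  have htr : (gram x t).trace = ∑ i, hH.eigenvalues i := by
    simpa using hH.trace_eq_sum_eigenvalues
  set a : ℝ := 1 + t / d with ha
  have ha0 : 0 < a := by positivity
  rw [hdet, Real.log_prod (fun i _ => (hpos i).ne')]
  have h1 : ∀ i, Real.log (hH.eigenvalues i) ≤ Real.log a + (hH.eigenvalues i / a - 1) := by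
    intro i
    have := Real.log_le_sub_one_of_pos (div_pos (hpos i) ha0)
    rw [Real.log_div (hpos i).ne' ha0.ne'] at this
    linarith
  refine (Finset.sum_le_sum fun i _ => h1 i).trans ?_
  rw [Finset.sum_add_distrib, Finset.sum_sub_distrib, ← Finset.sum_div, ← htr]
  simp only [Finset.sum_const, Finset.card_univ, Fintype.card_fin, nsmul_eq_mul, mul_one]
  have h2 : (gram x t).trace / a ≤ d := by
    rw [div_le_iff₀ ha0, ha]
    have := trace_gram_le x hx t
    field_simp
    linarith
  linarith

/-- The elliptical potential lemma. -/
theorem sum_sq_mahalanobis_le (hd : 1 ≤ d) (x : ℕ → Vec d) (hx : ∀ τ, ‖x τ‖ ≤ 1) (n : ℕ) :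
    ∑ t ∈ Finset.range n, mahalanobis (gram x t)⁻¹ (x (t + 1)) ^ 2 ≤
      2 * (d * Real.log (1 + n / d)) := by
  refine le_trans ?_ (mul_le_mul_of_nonneg_left (log_det_gram_le hd x hx n) zero_le_two)
  induction n with
  | zero => simp [gram_zero]
  | succ n ih =>
    rw [Finset.sum_range_succ, det_gram_succ]
    set q := mahalanobis (gram x n)⁻¹ (x (n + 1)) with hq
    have hq0 : 0 ≤ q := mahalanobis_nonneg _ _
    have hq1 : q ≤ 1 := (mahalanobis_gram_inv_le_norm x n _).trans (hx _)
    have hpos : 0 < 1 + q ^ 2 := by positivity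
    rw [Real.log_mul (gram_posDef x n).det_pos.ne' hpos.ne', mul_add]
    have h1 := Real.one_sub_inv_le_log_of_pos hpos
    have h2 : q ^ 2 / 2 ≤ 1 - (1 + q ^ 2)⁻¹ := by
      rw [show 1 - (1 + q ^ 2)⁻¹ = q ^ 2 / (1 + q ^ 2) by field_simp; ring]
      have : q ^ 2 ≤ 1 := pow_le_one₀ hq0 hq1
      gcongr
      linarith
    linarith

theorem sum_mahalanobis_le (hd : 1 ≤ d) (x : ℕ → Vec d) (hx : ∀ τ, ‖x τ‖ ≤ 1) (n : ℕ) :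
    ∑ t ∈ Finset.range n, mahalanobis (gram x t)⁻¹ (x (t + 1)) ≤
      √(2 * (n * d * Real.log (1 + n / d))) := by
  refine Real.le_sqrt_of_sq_le ?_
  refine sq_sum_le_card_mul_sum_sq.trans ?_
  rw [Finset.card_range]
  have := mul_le_mul_of_nonneg_left (sum_sq_mahalanobis_le hd x hx n) (Nat.cast_nonneg (α := ℝ) n)
  linarith

end Gram

/-! ### Link functions -/

/-- The link function, extended to `ℝ` by its values at the endpoints of `[-1,1]`. -/
def clampLink (f : ℝ → ℝ) (z : ℝ) : ℝ := f (max (-1) (min 1 z))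

theorem clampLink_of_mem {f : ℝ → ℝ} {z : ℝ} (hz : z ∈ Icc (-1 : ℝ) 1) : clampLink f z = f z := by
  rw [clampLink, min_eq_right hz.2, max_eq_right hz.1]

theorem clamp_mem (z : ℝ) : max (-1) (min 1 z) ∈ Icc (-1 : ℝ) 1 :=
  ⟨le_max_left _ _, max_le (by norm_num) (min_le_left _ _)⟩

theorem inner_mem_Icc {d : ℕ} {x θ : Vec d} (hx : ‖x‖ ≤ 1) (hθ : ‖θ‖ ≤ 1) :
    inner ℝ x θ ∈ Icc (-1 : ℝ) 1 := by
  refine abs_le.1 ((abs_real_inner_le_norm x θ).trans (mul_le_one₀ hx (norm_nonneg _) hθ))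

namespace LinkRegular

variable {f : ℝ → ℝ} {κ K M : ℝ}

theorem exists_slope (h : LinkRegular f κ K M) {x y : ℝ} (hx : x ∈ Icc (-1 : ℝ) 1)
    (hy : y ∈ Icc (-1 : ℝ) 1) :
    ∃ s : ℝ, κ ≤ |s| ∧ |s| ≤ K ∧ f y - f x = s * (y - x) := by
  wlog hxy : x ≤ y generalizing x y
  · obtain ⟨s, h1, h2, h3⟩ := this hy hx (le_of_not_ge hxy)
    exact ⟨s, h1, h2, by linarith⟩
  rcases hxy.eq_or_lt with rfl | hlt
  · exact ⟨_, h.deriv_lower x hx, h.deriv_upper x hx, by simp⟩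
  have hsub : Icc x y ⊆ Icc (-1) 1 := Icc_subset_Icc hx.1 hy.2
  have hnhds : ∀ z ∈ Ioo x y, Icc (-1 : ℝ) 1 ∈ nhds z := fun z hz =>
    Icc_mem_nhds (hx.1.trans_lt hz.1) (hz.2.trans_le hy.2)
  obtain ⟨c, hc, hslope⟩ := exists_deriv_eq_slope f hlt (h.diff.continuousOn.mono hsub)
    (fun z hz => ((h.diff z (hsub (Ioo_subset_Icc_self hz))).differentiableAt
      (hnhds z hz)).differentiableWithinAt)
  have hcm : c ∈ Icc (-1 : ℝ) 1 := hsub (Ioo_subset_Icc_self hc)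
  refine ⟨_, h.deriv_lower c hcm, h.deriv_upper c hcm, ?_⟩
  rw [derivWithin_of_mem_nhds (hnhds c hc), hslope, div_mul_cancel₀ _ (sub_pos.2 hlt).ne']

theorem kappa_le (h : LinkRegular f κ K M) : κ ≤ K := by
  have h0 : (0 : ℝ) ∈ Icc (-1 : ℝ) 1 := by norm_num
  exact (h.deriv_lower 0 h0).trans (h.deriv_upper 0 h0)

theorem K_pos (h : LinkRegular f κ K M) : 0 < K := h.kappa_pos.trans_le h.kappa_le

theorem M_nonneg (h : LinkRegular f κ K M) : 0 ≤ M :=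
  (abs_nonneg _).trans (h.second_deriv 0 (by norm_num))

theorem one_le_ratio (h : LinkRegular f κ K M) : 1 ≤ K * κ⁻¹ := by
  rw [← div_eq_mul_inv, one_le_div h.kappa_pos]
  exact h.kappa_le

theorem kappa_le_one (h : LinkRegular f κ K M) : κ ≤ 1 := by
  have hm : (-1 : ℝ) ∈ Icc (-1 : ℝ) 1 := by norm_num
  have hp : (1 : ℝ) ∈ Icc (-1 : ℝ) 1 := by norm_num
  obtain ⟨s, h1, -, h3⟩ := h.exists_slope hm hp
  have h4 := h.maps hm
  have h5 := h.maps hp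
  have h6 : |s * 2| ≤ 2 := by
    rw [show s * 2 = f 1 - f (-1) by rw [h3]; ring]
    exact abs_le.2 ⟨by linarith [h4.2, h5.1], by linarith [h4.1, h5.2]⟩
  rw [abs_mul, abs_two] at h6
  linarith

theorem abs_clampLink_le (h : LinkRegular f κ K M) (z : ℝ) : |clampLink f z| ≤ 1 :=
  abs_le.2 (h.maps (clamp_mem z))

theorem abs_clampLink_sub_le (h : LinkRegular f κ K M) (x y : ℝ) :
    |clampLink f x - clampLink f y| ≤ K * |x - y| := by
  obtain ⟨s, -, h2, h3⟩ := h.exists_slope (clamp_mem y) (clamp_mem x)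
  rw [clampLink, clampLink, h3, abs_mul]
  refine mul_le_mul h2 ?_ (abs_nonneg _) h.K_pos.le
  calc |max (-1) (min 1 x) - max (-1) (min 1 y)| ≤ |min 1 x - min 1 y| := by
        simpa using abs_max_sub_max_le_max (-1) (min 1 x) (-1) (min 1 y)
    _ ≤ |x - y| := by simpa using abs_min_sub_min_le_max 1 x 1 y

theorem le_abs_clampLink_sub (h : LinkRegular f κ K M) {x y : ℝ} (hx : x ∈ Icc (-1 : ℝ) 1)
    (hy : y ∈ Icc (-1 : ℝ) 1) : κ * |x - y| ≤ |clampLink f x - clampLink f y| := by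
  obtain ⟨s, h1, -, h3⟩ := h.exists_slope hy hx
  rw [clampLink_of_mem hx, clampLink_of_mem hy, h3, abs_mul]
  exact mul_le_mul_of_nonneg_right h1 (abs_nonneg _)

theorem continuous_clampLink (h : LinkRegular f κ K M) : Continuous (clampLink f) := by
  refine (LipschitzWith.of_dist_le_mul (K := K.toNNReal) fun x y => ?_).continuous
  rw [Real.dist_eq, Real.dist_eq, Real.coe_toNNReal _ h.K_pos.le]
  exact h.abs_clampLink_sub_le x y

end LinkRegular

/-! ### Maxima over actions -/

section MaxQ

variable {S : Type u} {A : Type v}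

theorem le_maxQ [Finite A] (Q : S → A → ℝ) (s : S) (a : A) : Q s a ≤ maxQ Q s :=
  le_ciSup (f := fun a => Q s a) (finite_range _).bddAbove a

theorem maxQ_le [Nonempty A] {Q : S → A → ℝ} {s : S} {c : ℝ} (h : ∀ a, Q s a ≤ c) : maxQ Q s ≤ c :=
  ciSup_le h

theorem maxQ_eq_of_greedy [Finite A] [Nonempty A] {Q : S → A → ℝ} {s : S} {b : A} (h : ∀ a, Q s a ≤ Q s b) :
    maxQ Q s = Q s b :=
  le_antisymm (maxQ_le h) (le_maxQ Q s b)

theorem abs_maxQ_le [Finite A] [Nonempty A] {Q : S → A → ℝ} {s : S} {c : ℝ} (h : ∀ a, |Q s a| ≤ c) : |maxQ Q s| ≤ c := by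
  have a : A := Classical.arbitrary A
  exact abs_le.2 ⟨(abs_le.1 (h a)).1.trans (le_maxQ Q s a), maxQ_le fun a => (abs_le.1 (h a)).2⟩

theorem abs_maxQ_sub_le [Finite A] [Nonempty A] {Q Q' : S → A → ℝ} {s : S} {c : ℝ} (h : ∀ a, |Q s a - Q' s a| ≤ c) :
    |maxQ Q s - maxQ Q' s| ≤ c := by
  rw [abs_le]
  constructor
  · have : maxQ Q' s ≤ maxQ Q s + c := maxQ_le fun a => by
      linarith [(abs_le.1 (h a)).1, le_maxQ Q s a]
    linarith
  · have : maxQ Q s ≤ maxQ Q' s + c := maxQ_le fun a => by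
      linarith [(abs_le.1 (h a)).2, le_maxQ Q' s a]
    linarith

theorem maxQ_zero [Nonempty A] (s : S) : maxQ (fun (_ : S) (_ : A) => (0 : ℝ)) s = 0 := by
  simp [maxQ]

end MaxQ

/-! ### Upper confidence bounds -/

section UpFun

variable {S : Type u} {A : Type v} {d : ℕ}

/-- The upper confidence bound `min{1, f(⟨φ, θ⟩) + γ ‖φ‖_B}`, with `f` extended to `ℝ`. -/
def upFun (φ : S → A → Vec d) (f : ℝ → ℝ) (γ : ℝ) (θ : Vec d) (B : Matrix (Fin d) (Fin d) ℝ)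
    (s : S) (a : A) : ℝ :=
  min 1 (clampLink f (inner ℝ (φ s a) θ) + γ * mahalanobis B (φ s a))

variable {φ : S → A → Vec d} {f : ℝ → ℝ} {κ K M γ : ℝ}

theorem abs_upFun_le (h : LinkRegular f κ K M) (hγ : 0 ≤ γ) (θ : Vec d)
    (B : Matrix (Fin d) (Fin d) ℝ) (s : S) (a : A) : |upFun φ f γ θ B s a| ≤ 1 := by
  have h1 := (abs_le.1 (h.abs_clampLink_le (inner ℝ (φ s a) θ))).1
  have h2 := mul_nonneg hγ (mahalanobis_nonneg B (φ s a))
  exact abs_le.2 ⟨le_min (by norm_num) (by linarith), min_le_left _ _⟩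

theorem abs_coord_le_norm (x : Vec d) (i : Fin d) : |x.ofLp i| ≤ ‖x‖ := by
  simpa using PiLp.norm_apply_le x i

theorem abs_inner_sub_le {x θ θ' : Vec d} (hx : ‖x‖ ≤ 1) {ε : ℝ}
    (h : ∀ i, |θ.ofLp i - θ'.ofLp i| ≤ ε) : |inner ℝ x θ - inner ℝ x θ'| ≤ d * ε := by
  rw [← inner_sub_right, inner_eq_dotProduct, dotProduct]
  refine (Finset.abs_sum_le_sum_abs _ _).trans ?_
  refine (Finset.sum_le_sum (g := fun _ => ε) fun i _ => ?_).trans (by simp)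
  rw [abs_mul]
  have h1 : |x.ofLp i| ≤ 1 := (abs_coord_le_norm x i).trans hx
  have h2 := h i
  rw [WithLp.ofLp_sub, Pi.sub_apply]
  nlinarith [abs_nonneg (x.ofLp i), abs_nonneg (θ.ofLp i - θ'.ofLp i)]

theorem abs_sqrt_sub_sqrt_le (a b : ℝ) : |√a - √b| ≤ √|a - b| := by
  have key : ∀ a b : ℝ, √a - √b ≤ √|a - b| := fun a b => by
    rw [sub_le_iff_le_add, Real.sqrt_le_iff]
    refine ⟨by positivity, ?_⟩
    have h1 : |a - b| = √|a - b| ^ 2 := (Real.sq_sqrt (abs_nonneg _)).symm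
    have h2 : b ≤ √b ^ 2 := by
      rcases le_or_gt 0 b with hb | hb
      · rw [Real.sq_sqrt hb]
      · exact hb.le.trans (sq_nonneg _)
    nlinarith [le_abs_self (a - b), mul_nonneg (Real.sqrt_nonneg |a - b|) (Real.sqrt_nonneg b)]
  refine abs_le.2 ⟨?_, key a b⟩
  have := key b a
  rw [abs_sub_comm] at this
  linarith

theorem abs_mahalanobis_sub_le {x : Vec d} (hx : ‖x‖ ≤ 1) {B B' : Matrix (Fin d) (Fin d) ℝ} {ε : ℝ}
    (h : ∀ i j, |B i j - B' i j| ≤ ε) :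
    |mahalanobis B x - mahalanobis B' x| ≤ d * √ε := by
  refine (abs_sqrt_sub_sqrt_le _ _).trans ?_
  rw [← Real.sqrt_sq (Nat.cast_nonneg (α := ℝ) d), ← Real.sqrt_mul (sq_nonneg _)]
  refine Real.sqrt_le_sqrt ?_
  rw [← dotProduct_sub, ← Matrix.sub_mulVec, dotProduct]
  have hx1 : ∀ i, |x.ofLp i| ≤ 1 := fun i => (abs_coord_le_norm x i).trans hx
  refine (Finset.abs_sum_le_sum_abs _ _).trans ?_
  refine (Finset.sum_le_sum (g := fun _ => (d : ℝ) * ε) fun i _ => ?_).trans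
    (le_of_eq (by simp; ring))
  rw [abs_mul]
  have h2 : |(B - B').mulVec x.ofLp i| ≤ d * ε := by
    rw [Matrix.mulVec, dotProduct]
    refine (Finset.abs_sum_le_sum_abs _ _).trans ?_
    refine (Finset.sum_le_sum (g := fun _ => ε) fun j _ => ?_).trans (by simp)
    rw [abs_mul, Matrix.sub_apply]
    nlinarith [abs_nonneg (x.ofLp j), hx1 j, abs_nonneg (B i j - B' i j), h i j]
  nlinarith [abs_nonneg (x.ofLp i), hx1 i, abs_nonneg ((B - B').mulVec x.ofLp i)]

theorem abs_upFun_sub_le (h : LinkRegular f κ K M) (hγ : 0 ≤ γ) {s : S} {a : A}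
    (hφ : ‖φ s a‖ ≤ 1) {θ θ' : Vec d} {B B' : Matrix (Fin d) (Fin d) ℝ} {ε : ℝ}
    (hθ : ∀ i, |θ.ofLp i - θ'.ofLp i| ≤ ε) (hB : ∀ i j, |B i j - B' i j| ≤ ε) :
    |upFun φ f γ θ B s a - upFun φ f γ θ' B' s a| ≤ K * (d * ε) + γ * (d * √ε) := by
  have h1 := h.abs_clampLink_sub_le (inner ℝ (φ s a) θ) (inner ℝ (φ s a) θ')
  have h2 := mul_le_mul_of_nonneg_left (abs_inner_sub_le hφ hθ) h.K_pos.le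
  have h3 := mul_le_mul_of_nonneg_left (abs_mahalanobis_sub_le hφ hB) hγ
  have h4 : |upFun φ f γ θ B s a - upFun φ f γ θ' B' s a| ≤
      |(clampLink f (inner ℝ (φ s a) θ) + γ * mahalanobis B (φ s a)) -
        (clampLink f (inner ℝ (φ s a) θ') + γ * mahalanobis B' (φ s a))| := by
    simpa [upFun] using abs_min_sub_min_le_max 1
      (clampLink f (inner ℝ (φ s a) θ) + γ * mahalanobis B (φ s a)) 1
      (clampLink f (inner ℝ (φ s a) θ') + γ * mahalanobis B' (φ s a))
  refine h4.trans ?_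
  rw [show (clampLink f (inner ℝ (φ s a) θ) + γ * mahalanobis B (φ s a)) -
        (clampLink f (inner ℝ (φ s a) θ') + γ * mahalanobis B' (φ s a)) =
      (clampLink f (inner ℝ (φ s a) θ) - clampLink f (inner ℝ (φ s a) θ')) +
        γ * (mahalanobis B (φ s a) - mahalanobis B' (φ s a)) by ring]
  refine (abs_add_le _ _).trans ?_
  rw [abs_mul, abs_of_nonneg hγ]
  linarith

/-- Joint measurability of upper confidence bounds in their parameters and in the state. The matrix
is presented as an element of a product space. -/
theorem measurable_upFun [MeasurableSpace S] [MeasurableSpace A] (h : LinkRegular f κ K M)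
    (hφ : Measurable fun z : S × A => φ z.1 z.2) (a : A) :
    Measurable fun z : (Vec d × (Fin d → Fin d → ℝ)) × S =>
      upFun φ f γ z.1.1 (Matrix.of z.1.2) z.2 a := by
  have hφa : Measurable fun z : (Vec d × (Fin d → Fin d → ℝ)) × S => φ z.2 a :=
    hφ.comp (measurable_snd.prodMk measurable_const)
  have hc : ∀ i, Measurable fun z : (Vec d × (Fin d → Fin d → ℝ)) × S => (φ z.2 a).ofLp i :=
    fun i => (by fun_prop : Measurable fun x : Vec d => x.ofLp i).comp hφa
  refine measurable_const.min ((h.continuous_clampLink.measurable.comp ?_).add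
    (measurable_const.mul ?_))
  · exact Measurable.inner hφa (measurable_fst.comp measurable_fst)
  · refine Real.continuous_sqrt.measurable.comp ?_
    simp only [dotProduct, Matrix.mulVec, Matrix.of_apply]
    refine Finset.measurable_sum _ fun i _ => (hc i).mul
      (Finset.measurable_sum _ fun j _ => Measurable.mul ?_ (hc j))
    exact (measurable_pi_apply j).comp ((measurable_pi_apply i).comp
      (measurable_snd.comp measurable_fst))

theorem measurable_maxQ_upFun [MeasurableSpace S] [MeasurableSpace A] [Finite A]
    (h : LinkRegular f κ K M) (hφ : Measurable fun z : S × A => φ z.1 z.2) :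
    Measurable fun z : (Vec d × (Fin d → Fin d → ℝ)) × S =>
      maxQ (upFun φ f γ z.1.1 (Matrix.of z.1.2)) z.2 :=
  Measurable.iSup fun a => measurable_upFun h hφ a

end UpFun

/-! ### Covering numbers -/

/-- A set whose elements have `ι`-many coordinates in `[-1,1]` has a net of mesh `1 / n` (in the
coordinates) of cardinality at most `(2 n + 1) ^ |ι|`: round the coordinates down to multiples of
`1 / n`, and choose one element for each value that occurs. -/
theorem exists_net {α ι : Type*} [Fintype ι] [DecidableEq ι] (P : Set α) (c : α → ι → ℝ)
    (hc : ∀ p ∈ P, ∀ i, |c p i| ≤ 1) {n : ℕ} (hn : 1 ≤ n) :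
    ∃ N : Finset α, N.card ≤ (2 * n + 1) ^ Fintype.card ι ∧
      ∀ p ∈ P, ∃ q ∈ N, ∀ i, |c p i - c q i| ≤ 1 / (n : ℝ) := by
  have hn0 : (0 : ℝ) < n := by exact_mod_cast hn
  let g : α → ι → ℤ := fun p i => ⌊c p i * n⌋
  have hg : g '' P ⊆ ↑(Fintype.piFinset fun _ : ι => Finset.Icc (-(n : ℤ)) n) := by
    rintro _ ⟨p, hp, rfl⟩
    simp only [Finset.mem_coe, Fintype.mem_piFinset, Finset.mem_Icc]
    intro i
    have h1 := abs_le.1 (hc p hp i)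
    constructor
    · rw [Int.le_floor]; push_cast; nlinarith
    · have : (⌊c p i * n⌋ : ℝ) ≤ n := (Int.floor_le _).trans (by nlinarith)
      exact_mod_cast this
  have hfin : (g '' P).Finite := (Finset.finite_toSet _).subset hg
  obtain ⟨P', -, hbij⟩ := (surjOn_image g P).exists_bijOn_subset
  have hP'fin : P'.Finite := hbij.finite_iff_finite.2 hfin
  refine ⟨hP'fin.toFinset, ?_, ?_⟩
  · calc hP'fin.toFinset.card = (hfin.toFinset).card := by
          refine Finset.card_bij (fun p _ => g p) ?_ ?_ ?_
          · intro p hp; simpa using hbij.mapsTo (by simpa using hp)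
          · intro p hp q hq hpq; exact hbij.injOn (by simpa using hp) (by simpa using hq) hpq
          · intro b hb
            obtain ⟨p, hp, hpb⟩ := hbij.surjOn (by simpa using hb)
            exact ⟨p, by simpa using hp, hpb⟩
      _ ≤ (Fintype.piFinset fun _ : ι => Finset.Icc (-(n : ℤ)) n).card :=
          Finset.card_le_card (by simpa [← Finset.coe_subset] using hg)
      _ = (2 * n + 1) ^ Fintype.card ι := by
          rw [Fintype.card_piFinset]
          simp only [Int.card_Icc, Finset.prod_const, Finset.card_univ]
          congr 1
          omega
  · intro p hp
    obtain ⟨q, hq, hgq⟩ := hbij.surjOn (mem_image_of_mem g hp)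
    refine ⟨q, by simpa using hq, fun i => ?_⟩
    have h1 : ⌊c q i * n⌋ = ⌊c p i * n⌋ := congrFun hgq i
    have h2 := Int.abs_sub_lt_one_of_floor_eq_floor h1.symm
    rw [← sub_mul, abs_mul, abs_of_pos hn0] at h2
    rw [le_div_iff₀ hn0]
    exact h2.le

/-! ### Values of policies -/

section PolicyValue

variable {S : Type u} {A : Type v} [MeasurableSpace S] [MeasurableSpace A]

theorem integral_bind_kernel {α β : Type*} [MeasurableSpace α] [MeasurableSpace β] {μ : Measure α}
    {κ : Kernel α β} {g : β → ℝ} (hg : Integrable g (μ.bind κ)) :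
    ∫ y, g y ∂(μ.bind κ) = ∫ x, ∫ y, g y ∂(κ x) ∂μ := by
  rw [Measure.comp_eq_comp_const_apply] at hg ⊢
  rw [Kernel.integral_comp hg]
  simp

/-- The mean reward of a state-action pair. -/
def MDP.meanReward (M : MDP S A) (s : S) (a : A) : ℝ := ∫ ρ, ρ ∂(M.reward (s, a))

/-- The mean of `V` at the next state. -/
def MDP.meanNext (M : MDP S A) (V : S → ℝ) (s : S) (a : A) : ℝ := ∫ s', V s' ∂(M.trans (s, a))

variable (M : MDP S A)

theorem MDP.measurable_meanReward : Measurable fun z : S × A => M.meanReward z.1 z.2 :=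
  (StronglyMeasurable.integral_kernel (κ := M.reward) measurable_id.stronglyMeasurable).measurable

theorem MDP.measurable_meanNext {V : S → ℝ} (hV : Measurable V) :
    Measurable fun z : S × A => M.meanNext V z.1 z.2 :=
  (StronglyMeasurable.integral_kernel (κ := M.trans) hV.stronglyMeasurable).measurable

theorem MDP.meanReward_mem (s : S) (a : A) : M.meanReward s a ∈ Icc (0 : ℝ) 1 := by
  constructor
  · exact integral_nonneg_of_ae ((M.reward_mem (s, a)).mono fun ρ h => h.1)
  · have := norm_integral_le_of_norm_le_const (μ := M.reward (s, a)) (f := fun ρ : ℝ => ρ) (C := 1)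
      ((M.reward_mem (s, a)).mono fun ρ h => by rw [Real.norm_of_nonneg h.1]; exact h.2)
    refine (le_abs_self _).trans ?_
    simpa [MDP.meanReward] using this

theorem MDP.abs_meanNext_le {V : S → ℝ} {c : ℝ} (hV : ∀ s, |V s| ≤ c) (s : S) (a : A) :
    |M.meanNext V s a| ≤ c := by
  have := norm_integral_le_of_norm_le_const (μ := M.trans (s, a)) (f := V) (C := c)
    (Filter.Eventually.of_forall hV)
  simpa [MDP.meanNext] using this

theorem MDP.bellman_eq (H h : ℕ) (Q : S → A → ℝ) (s : S) (a : A) :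
    M.bellman H h Q s a = M.meanReward s a + if h < H then M.meanNext (maxQ Q) s a else 0 := rfl

theorem MDP.emit_apply (p : S → A) (hp : Measurable p) (s : S) :
    M.emit p hp s = (M.reward (s, p s)).map fun ρ => (s, p s, ρ) := by
  rw [MDP.emit, Kernel.prod_apply, Kernel.prod_apply, Kernel.id_apply,
    Kernel.deterministic_apply, Kernel.comap_apply, Measure.dirac_prod, Measure.dirac_prod,
    Measure.map_map (by fun_prop) (by fun_prop)]
  rfl

theorem MDP.map_fst_bind_emit (p : S → A) (hp : Measurable p) (μ : Measure S) [SFinite μ] :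
    (μ.bind (M.emit p hp)).map Prod.fst = μ := by
  rw [Measure.map_comp _ _ measurable_fst]
  have : (M.emit p hp).map Prod.fst = Kernel.id := by
    rw [← Kernel.fst_eq, MDP.emit, Kernel.fst_prod]
  rw [this, Measure.id_comp]

/-- The law of the state at time point `n + 1`. -/
def MDP.stateLaw (π : Policy S A) (n : ℕ) : Measure S := (M.law π).map fun z => (z n).1

instance (π : Policy S A) : IsProbabilityMeasure (M.law π) := by
  unfold MDP.law
  have : IsProbabilityMeasure (M.init.bind (M.emit (π.act 1) (π.measurable_act 1))) :=
    inferInstance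
  infer_instance

instance (π : Policy S A) (n : ℕ) : IsProbabilityMeasure (M.stateLaw π n) :=
  Measure.isProbabilityMeasure_map
    (by fun_prop : Measurable fun z : ℕ → S × A × ℝ => (z n).1).aemeasurable

theorem MDP.map_law_zero (π : Policy S A) :
    (M.law π).map (fun z => z 0) = M.init.bind (M.emit (π.act 1) (π.measurable_act 1)) := by
  set μ₀ := M.init.bind (M.emit (π.act 1) (π.measurable_act 1)) with hμ₀
  have e : (fun z : ℕ → S × A × ℝ => z 0) =
      (fun y : (i : Finset.Iic 0) → S × A × ℝ => y ⟨0, Finset.mem_Iic.2 le_rfl⟩) ∘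
        Preorder.frestrictLe (π := fun _ => S × A × ℝ) 0 := rfl
  rw [e, ← Measure.map_map (by fun_prop) (by fun_prop), MDP.law, Kernel.trajMeasure,
    Measure.map_comp _ _ (by fun_prop), Kernel.traj_map_frestrictLe, Kernel.partialTraj_self,
    Measure.id_comp, Measure.map_map (by fun_prop) (by fun_prop)]
  exact Measure.map_id

theorem MDP.map_law_succ (π : Policy S A) (n : ℕ) :
    (M.law π).map (fun z => z (n + 1)) = ((M.law π).map fun z => z n).bind
      (M.next (π.act (n + 2)) (π.measurable_act (n + 2))) := by
  have key := Kernel.map_frestrictLe_trajMeasure_compProd_eq_map_trajMeasure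
    (X := fun _ => S × A × ℝ) (μ₀ := M.init.bind (M.emit (π.act 1) (π.measurable_act 1)))
    (κ := fun n => (M.next (π.act (n + 2)) (π.measurable_act (n + 2))).comap
      (fun z => z ⟨n, Finset.mem_Iic.2 le_rfl⟩) (measurable_pi_apply _)) (a := n)
  have h2 := congrArg Measure.snd key
  rw [Measure.snd_compProd, Measure.snd_map_prodMk (by fun_prop)] at h2
  rw [MDP.law, ← h2]
  ext B hB
  rw [Measure.bind_apply hB (Kernel.aemeasurable _), Measure.bind_apply hB (Kernel.aemeasurable _),
    lintegral_map (Kernel.measurable_coe _ hB) (by fun_prop),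
    lintegral_map (Kernel.measurable_coe _ hB) (by fun_prop)]
  rfl

theorem MDP.map_law_eq (π : Policy S A) (n : ℕ) :
    (M.law π).map (fun z => z n) =
      (M.stateLaw π n).bind (M.emit (π.act (n + 1)) (π.measurable_act (n + 1))) := by
  have hfst : M.stateLaw π n = ((M.law π).map fun z => z n).map Prod.fst := by
    rw [Measure.map_map measurable_fst (by fun_prop)]; rfl
  rw [hfst]
  cases n with
  | zero => rw [MDP.map_law_zero, MDP.map_fst_bind_emit]
  | succ n =>
    rw [MDP.map_law_succ, MDP.next, ← Measure.comp_assoc, MDP.map_fst_bind_emit]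

theorem MDP.stateLaw_zero (π : Policy S A) : M.stateLaw π 0 = M.init := by
  have hfst : M.stateLaw π 0 = ((M.law π).map fun z => z 0).map Prod.fst := by
    rw [Measure.map_map measurable_fst (by fun_prop)]; rfl
  rw [hfst, MDP.map_law_zero, MDP.map_fst_bind_emit]

theorem MDP.stateLaw_succ (π : Policy S A) (n : ℕ) :
    M.stateLaw π (n + 1) = ((M.law π).map fun z => z n).bind
      (M.trans.comap (fun z => (z.1, z.2.1)) (by fun_prop)) := by
  have hfst : M.stateLaw π (n + 1) = ((M.law π).map fun z => z (n + 1)).map Prod.fst := by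
    rw [Measure.map_map measurable_fst (by fun_prop)]; rfl
  rw [hfst, MDP.map_law_succ, MDP.next, ← Measure.comp_assoc, MDP.map_fst_bind_emit]

theorem MDP.integral_stateLaw_succ (π : Policy S A) (n : ℕ) {V : S → ℝ} (hV : Measurable V) {c : ℝ}
    (hc : ∀ s, |V s| ≤ c) :
    ∫ s, V s ∂(M.stateLaw π (n + 1)) =
      ∫ s, M.meanNext V s (π.act (n + 1) s) ∂(M.stateLaw π n) := by
  have hm : Measurable fun z : S × A × ℝ => M.meanNext V z.1 z.2.1 :=
    (M.measurable_meanNext hV).comp (by fun_prop : Measurable fun z : S × A × ℝ => (z.1, z.2.1))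
  have i1 : Integrable V (M.stateLaw π (n + 1)) :=
    Integrable.of_bound hV.aestronglyMeasurable c (Filter.Eventually.of_forall hc)
  rw [M.stateLaw_succ] at i1 ⊢
  rw [integral_bind_kernel i1, MDP.map_law_eq]
  have i2 : Integrable (fun z : S × A × ℝ => M.meanNext V z.1 z.2.1) ((M.stateLaw π n).bind
      (M.emit (π.act (n + 1)) (π.measurable_act (n + 1)))) :=
    Integrable.of_bound hm.aestronglyMeasurable c
      (Filter.Eventually.of_forall fun z => M.abs_meanNext_le hc _ _)
  refine (integral_bind_kernel i2).trans (integral_congr_ae (Filter.Eventually.of_forall fun s => ?_))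
  simp only
  rw [MDP.emit_apply, integral_map (by fun_prop) hm.aestronglyMeasurable]
  simp

theorem MDP.ae_reward_mem (π : Policy S A) (n : ℕ) :
    ∀ᵐ z ∂((M.law π).map fun z => z n), z.2.2 ∈ Icc (0 : ℝ) 1 := by
  have hB : MeasurableSet {z : S × A × ℝ | z.2.2 ∈ Icc (0 : ℝ) 1} :=
    (by fun_prop : Measurable fun z : S × A × ℝ => z.2.2) measurableSet_Icc
  rw [MDP.map_law_eq]
  refine Measure.ae_comp_of_ae_ae hB (Filter.Eventually.of_forall fun s => ?_)
  rw [MDP.emit_apply, ae_map_iff (by fun_prop) hB]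
  exact M.reward_mem _

theorem MDP.integral_reward (π : Policy S A) (n : ℕ) :
    Integrable (fun z => (z n).2.2) (M.law π) ∧ ∫ z, (z n).2.2 ∂(M.law π) =
      ∫ s, M.meanReward s (π.act (n + 1) s) ∂(M.stateLaw π n) := by
  have hm : Measurable fun z : S × A × ℝ => z.2.2 := by fun_prop
  have hn : Measurable fun z : ℕ → S × A × ℝ => z n := by fun_prop
  have i1 : Integrable (fun z : S × A × ℝ => z.2.2) ((M.law π).map fun z => z n) := by
    have : IsProbabilityMeasure ((M.law π).map fun z => z n) :=
      Measure.isProbabilityMeasure_map hn.aemeasurable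
    exact Integrable.of_bound hm.aestronglyMeasurable 1 ((M.ae_reward_mem π n).mono fun z hz => by
      rw [Real.norm_of_nonneg hz.1]; exact hz.2)
  refine ⟨(integrable_map_measure hm.aestronglyMeasurable hn.aemeasurable).1 i1, ?_⟩
  rw [← integral_map (f := fun z : S × A × ℝ => z.2.2) hn.aemeasurable hm.aestronglyMeasurable]
  rw [MDP.map_law_eq] at i1 ⊢
  rw [integral_bind_kernel i1]
  refine integral_congr_ae (Filter.Eventually.of_forall fun s => ?_)
  simp only
  rw [MDP.emit_apply, integral_map (by fun_prop) hm.aestronglyMeasurable]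
  rfl

theorem MDP.value_eq (H : ℕ) (π : Policy S A) :
    M.value H π =
      ∑ n ∈ Finset.range H, ∫ s, M.meanReward s (π.act (n + 1) s) ∂(M.stateLaw π n) := by
  rw [MDP.value, integral_finsetSum _ fun n _ => (M.integral_reward π n).1]
  exact Finset.sum_congr rfl fun n _ => (M.integral_reward π n).2

theorem MDP.integrable_meanReward (π : Policy S A) (n : ℕ) :
    Integrable (fun s => M.meanReward s (π.act (n + 1) s)) (M.stateLaw π n) := by
  refine Integrable.of_bound (C := 1) (M.measurable_meanReward.comp
    (measurable_id.prodMk (π.measurable_act (n + 1)))).aestronglyMeasurable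
    (Filter.Eventually.of_forall fun s => ?_)
  have := M.meanReward_mem s (π.act (n + 1) s)
  rw [Real.norm_of_nonneg this.1]
  exact this.2

/-- Functions `Q h` that dominate their Bellman updates dominate the values of all policies. -/
theorem MDP.value_le_of_bellman_le [Finite A] [Nonempty A] {H : ℕ} (hH : 1 ≤ H) (Q : ℕ → S → A → ℝ)
    (hmeas : ∀ h, 1 ≤ h → h ≤ H → Measurable (maxQ (Q h)))
    (hbd : ∀ h, 1 ≤ h → h ≤ H → ∀ s, |maxQ (Q h) s| ≤ 1)
    (hQ : ∀ h, 1 ≤ h → h ≤ H → ∀ s a, M.bellman H h (Q (h + 1)) s a ≤ Q h s a)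
    (π : Policy S A) : M.value H π ≤ ∫ s, maxQ (Q 1) s ∂M.init := by
  let v : ℕ → ℝ := fun n => if n < H then ∫ s, maxQ (Q (n + 1)) s ∂(M.stateLaw π n) else 0
  have hint : ∀ n < H, Integrable (maxQ (Q (n + 1))) (M.stateLaw π n) := fun n hn =>
    Integrable.of_bound (hmeas (n + 1) (by omega) (by omega)).aestronglyMeasurable 1
      (Filter.Eventually.of_forall (hbd (n + 1) (by omega) (by omega)))
  have hstep : ∀ n < H,
      ∫ s, M.meanReward s (π.act (n + 1) s) ∂(M.stateLaw π n) ≤ v n - v (n + 1) := by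
    intro n hn
    have hpt : ∀ s, M.bellman H (n + 1) (Q (n + 1 + 1)) s (π.act (n + 1) s) ≤ maxQ (Q (n + 1)) s :=
      fun s => (hQ (n + 1) (by omega) (by omega) s _).trans (le_maxQ _ _ _)
    rw [le_sub_iff_add_le]
    simp only [v, if_pos hn]
    by_cases hn1 : n + 1 < H
    · have i2 : Integrable (fun s => M.meanNext (maxQ (Q (n + 1 + 1))) s (π.act (n + 1) s))
          (M.stateLaw π n) :=
        Integrable.of_bound (C := 1) ((M.measurable_meanNext (hmeas (n + 1 + 1) (by omega)
          (by omega))).comp (measurable_id.prodMk (π.measurable_act (n + 1)))).aestronglyMeasurable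
          (Filter.Eventually.of_forall fun s => M.abs_meanNext_le
            (hbd (n + 1 + 1) (by omega) (by omega)) _ _)
      rw [if_pos hn1, M.integral_stateLaw_succ π n (hmeas (n + 1 + 1) (by omega) (by omega))
        (hbd (n + 1 + 1) (by omega) (by omega)), ← integral_add (M.integrable_meanReward π n) i2]
      refine integral_mono ((M.integrable_meanReward π n).add i2) (hint n hn) fun s => ?_
      have := hpt s
      rwa [MDP.bellman_eq, if_pos hn1] at this
    · rw [if_neg hn1, add_zero]
      refine integral_mono (M.integrable_meanReward π n) (hint n hn) fun s => ?_
      have := hpt s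
      rwa [MDP.bellman_eq, if_neg hn1, add_zero] at this
  rw [MDP.value_eq]
  refine (Finset.sum_le_sum fun n hn => hstep n (Finset.mem_range.1 hn)).trans ?_
  rw [Finset.sum_range_sub']
  simp only [v, if_pos (show 0 < H by omega), lt_irrefl, if_false, sub_zero, M.stateLaw_zero]
  exact le_rfl

instance [Nonempty A] : Nonempty (Policy S A) :=
  ⟨⟨fun _ _ => Classical.arbitrary A, fun _ => measurable_const⟩⟩

theorem MDP.optValue_le [Nonempty A] {H : ℕ} {c : ℝ} (h : ∀ π : Policy S A, M.value H π ≤ c) :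
    M.optValue H ≤ c := ciSup_le h

theorem MDP.value_le_one {H : ℕ} (hN : M.Normalized H) (π : Policy S A) : M.value H π ≤ 1 := by
  refine (le_abs_self _).trans ?_
  have := norm_integral_le_of_norm_le_const (μ := M.law π) (C := 1)
    ((hN π).mono fun z h => by rw [Real.norm_of_nonneg h.1]; exact h.2)
  simpa [MDP.value] using this

theorem MDP.value_le_mul {H : ℕ} {c : ℝ} (hc : ∀ s a, M.meanReward s a ≤ c) (π : Policy S A) :
    M.value H π ≤ H * c := by
  rw [MDP.value_eq]
  refine (Finset.sum_le_sum (g := fun _ => c) fun n _ => ?_).trans (by simp)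
  have := integral_mono (M.integrable_meanReward π n) (integrable_const c) fun s => hc s _
  simpa using this

end PolicyValue

/-! ### Noise along an execution -/

section ExecutionNoise

variable {Ω : Type w} {S : Type u} {A : Type v} {d : ℕ}
  [MeasurableSpace S] [MeasurableSpace A]

namespace Execution

variable (X : Execution Ω S A d)

theorem before_mono (H : ℕ) {t t' : ℕ} (h : t ≤ t') : X.before H t ≤ X.before H t' :=
  biSup_mono fun τ hτ => by
    simp only [Finset.mem_Ico] at hτ ⊢
    omega

theorem before_le_history (H h t : ℕ) : X.before H t ≤ X.history H h t := le_sup_left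

theorem history_le_historySA (H h t : ℕ) : X.history H h t ≤ X.historySA H h t := le_sup_left

theorem before_le_historySA (H h t : ℕ) : X.before H t ≤ X.historySA H h t :=
  (X.before_le_history H h t).trans (X.history_le_historySA H h t)

theorem measurable_before {H h τ t : ℕ} (hτ : τ ∈ Finset.Ico 1 t) (hh : h ∈ Finset.Icc 1 H) :
    Measurable[X.before H t] fun ω => (X.s h τ ω, X.a h τ ω, X.r h τ ω) := by
  refine Measurable.mono (comap_measurable _) ?_ le_rfl
  exact le_trans (le_biSup (fun h => MeasurableSpace.comap
      (fun ω => (X.s h τ ω, X.a h τ ω, X.r h τ ω)) inferInstance) hh)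
    (le_biSup (fun τ => ⨆ h ∈ Finset.Icc 1 H, MeasurableSpace.comap
      (fun ω => (X.s h τ ω, X.a h τ ω, X.r h τ ω)) inferInstance) hτ)

theorem measurable_history {H h h' t : ℕ} (hh : h' ∈ Finset.Ico 1 h) :
    Measurable[X.history H h t] fun ω => (X.s h' t ω, X.a h' t ω, X.r h' t ω) := by
  refine Measurable.mono (comap_measurable _) ?_ le_rfl
  exact (le_biSup (fun h => MeasurableSpace.comap
      (fun ω => (X.s h t ω, X.a h t ω, X.r h t ω)) inferInstance) hh).trans le_sup_right

theorem measurable_historySA (H h t : ℕ) :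
    Measurable[X.historySA H h t] fun ω => (X.s h t ω, X.a h t ω) :=
  Measurable.mono (comap_measurable _) le_sup_right le_rfl

theorem historySA_le_history_succ {H h : ℕ} (hh : 1 ≤ h) (t : ℕ) :
    X.historySA H h t ≤ X.history H (h + 1) t := by
  refine sup_le (sup_le le_sup_left (le_trans ?_ le_sup_right)) ?_
  · exact biSup_mono fun h' hh' => by
      simp only [Finset.mem_Ico] at hh' ⊢
      omega
  · have := X.measurable_history (H := H) (h := h + 1) (h' := h) (t := t)
      (Finset.mem_Ico.2 ⟨hh, by omega⟩)
    exact ((measurable_fst.comp this).prodMk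
      (measurable_fst.comp (measurable_snd.comp this))).comap_le

theorem historySA_le_before_succ {H h t : ℕ} (hh : h ∈ Finset.Icc 1 H) (ht : 1 ≤ t) :
    X.historySA H h t ≤ X.before H (t + 1) := by
  have htm : t ∈ Finset.Ico 1 (t + 1) := Finset.mem_Ico.2 ⟨ht, by omega⟩
  have hh' := Finset.mem_Icc.1 hh
  refine sup_le (sup_le (X.before_mono H (Nat.le_succ t)) (iSup₂_le fun h' hm => ?_)) ?_
  · have := Finset.mem_Ico.1 hm
    exact (X.measurable_before htm (Finset.mem_Icc.2 ⟨this.1, by omega⟩)).comap_le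
  · have := X.measurable_before htm hh
    exact ((measurable_fst.comp this).prodMk
      (measurable_fst.comp (measurable_snd.comp this))).comap_le

/-- The Bellman noise: the reward plus the value `V` of the next state, minus its conditional mean
given the current state and action. -/
def noise (M : MDP S A) (H h t : ℕ) (V : S → ℝ) (ω : Ω) : ℝ :=
  X.r h t ω + (if h < H then V (X.s (h + 1) t ω) else 0) -
    (M.meanReward (X.s h t ω) (X.a h t ω) +
      if h < H then M.meanNext V (X.s h t ω) (X.a h t ω) else 0)

/-- The deviation of the value `V` of the initial state from its mean. -/
def initNoise (M : MDP S A) (t : ℕ) (V : S → ℝ) (ω : Ω) : ℝ :=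
  ∫ s, V s ∂M.init - V (X.s 1 t ω)

/-- The total reward of an episode. -/
def totalReward (H t : ℕ) (ω : Ω) : ℝ := ∑ h ∈ Finset.Icc 1 H, X.r h t ω

end Execution

variable [mΩ : MeasurableSpace Ω] {P : Measure Ω} {M : MDP S A} {H T : ℕ}
  {φ : S → A → Vec d} {f : ℝ → ℝ} {γ : ℝ} {X : Execution Ω S A d}

namespace IsLSVIUCB

theorem before_le (hX : IsLSVIUCB P M H T φ f γ X) {t : ℕ} (ht : t ≤ T + 1) :
    X.before H t ≤ mΩ := by
  refine iSup₂_le fun τ hτ => iSup₂_le fun h hh => ?_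
  simp only [Finset.mem_Ico, Finset.mem_Icc] at hτ hh
  have hτ' : τ ∈ Icc 1 T := ⟨hτ.1, by omega⟩
  exact ((hX.measurable_s τ hτ' h hh).prodMk
    ((hX.measurable_a τ hτ' h hh).prodMk (hX.measurable_r τ hτ' h hh))).comap_le

theorem historySA_le (hX : IsLSVIUCB P M H T φ f γ X) {h t : ℕ} (hh : h ∈ Icc 1 H)
    (ht : t ∈ Icc 1 T) : X.historySA H h t ≤ mΩ :=
  (X.historySA_le_before_succ (Finset.mem_Icc.2 hh) ht.1).trans
    (hX.before_le (by have := ht.2; omega))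

theorem history_le (hX : IsLSVIUCB P M H T φ f γ X) {h t : ℕ} (hh : h ∈ Icc 1 H)
    (ht : t ∈ Icc 1 T) : X.history H h t ≤ mΩ :=
  (X.history_le_historySA H h t).trans (hX.historySA_le hh ht)

variable [IsProbabilityMeasure P]

theorem ae_reward_mem (hX : IsLSVIUCB P M H T φ f γ X) {h t : ℕ} (hh : h ∈ Icc 1 H)
    (ht : t ∈ Icc 1 T) : ∀ᵐ ω ∂P, X.r h t ω ∈ Icc (0 : ℝ) 1 :=
  (hX.reward_law t ht h hh).ae_of_forall_ae (hX.historySA_le hh ht) (hX.measurable_r t ht h hh)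
    measurableSet_Icc fun _ => M.reward_mem _

theorem condExp_reward (hX : IsLSVIUCB P M H T φ f γ X) {h t : ℕ} (hh : h ∈ Icc 1 H)
    (ht : t ∈ Icc 1 T) : P[X.r h t | X.historySA H h t] =ᵐ[P]
      fun ω => M.meanReward (X.s h t ω) (X.a h t ω) := by
  -- the identity is truncated to `[0,1]`, where rewards lie
  have hcl : Measurable fun z : (S × A) × ℝ => max 0 (min 1 z.2) := by fun_prop
  have h1 := (hX.reward_law t ht h hh).condExp_eq (hX.historySA_le hh ht)
    (hX.measurable_r t ht h hh) (X.measurable_historySA H h t) M.reward hcl (c := 1)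
    (fun z => abs_le.2 ⟨by linarith [le_max_left (0 : ℝ) (min 1 z.2)],
      max_le zero_le_one (min_le_left _ _)⟩)
  have h2 : X.r h t =ᵐ[P] fun ω => max 0 (min 1 (X.r h t ω)) := by
    filter_upwards [hX.ae_reward_mem hh ht] with ω hω
    rw [min_eq_right hω.2, max_eq_right hω.1]
  refine (condExp_congr_ae h2).trans (h1.trans (Filter.Eventually.of_forall fun ω => ?_))
  refine integral_congr_ae ((M.reward_mem _).mono fun ρ hρ => ?_)
  simp only
  rw [min_eq_right hρ.2, max_eq_right hρ.1]

section Noise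

variable {Z' : Type*} [MeasurableSpace Z'] {G : Z' × S → ℝ}

theorem measurable_meanNext_param (hG : Measurable G) :
    Measurable fun z : Z' × S × A => M.meanNext (fun s => G (z.1, s)) z.2.1 z.2.2 := by
  have : Measurable fun y : (Z' × S × A) × S => G (y.1.1, y.2) :=
    hG.comp (by fun_prop)
  exact (StronglyMeasurable.integral_kernel_prod_right'
    (κ := M.trans.comap (fun z : Z' × S × A => z.2) measurable_snd)
    this.stronglyMeasurable).measurable

theorem condExp_next (hX : IsLSVIUCB P M H T φ f γ X) {h t : ℕ} (hh : 1 ≤ h) (hH : h < H)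
    (ht : t ∈ Icc 1 T) {Z : Ω → Z'} (hZ : Measurable[X.historySA H h t] Z) (hG : Measurable G)
    {c : ℝ} (hc : ∀ z, |G z| ≤ c) :
    P[fun ω => G (Z ω, X.s (h + 1) t ω) | X.historySA H h t] =ᵐ[P]
      fun ω => M.meanNext (fun s => G (Z ω, s)) (X.s h t ω) (X.a h t ω) := by
  have hle := X.historySA_le_history_succ (H := H) hh t
  have hle' := hX.history_le (h := h + 1) ⟨by omega, by omega⟩ ht
  have hZ2 : Measurable[X.historySA H h t] fun ω => (Z ω, X.s h t ω, X.a h t ω) :=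
    hZ.prodMk (X.measurable_historySA H h t)
  have hG2 : Measurable fun y : (Z' × S × A) × S => G (y.1.1, y.2) := hG.comp (by fun_prop)
  have h1 := HasCondLaw.condExp_eq hle' (hX.measurable_s t ht (h + 1) ⟨by omega, by omega⟩)
    (hZ2.mono hle le_rfl) (M.trans.comap (fun z : Z' × S × A => z.2) measurable_snd)
    (hX.trans_law t ht h hh hH) hG2 (fun z => hc _)
  refine (condExp_condExp_of_le hle hle').symm.trans ((condExp_congr_ae h1).trans ?_)
  have hm := (measurable_meanNext_param (M := M) hG).comp hZ2
  have hint : Integrable (fun ω => M.meanNext (fun s => G (Z ω, s)) (X.s h t ω) (X.a h t ω)) P :=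
    Integrable.of_bound (hm.mono (hle.trans hle') le_rfl).aestronglyMeasurable c
      (Filter.Eventually.of_forall fun ω => M.abs_meanNext_le (fun s => hc _) _ _)
  exact (condExp_of_stronglyMeasurable (hle.trans hle') hm.stronglyMeasurable hint).eventuallyEq

theorem measurable_noise {Ω : Type w} {X : Execution Ω S A d} {h t : ℕ} (hh : h ∈ Icc 1 H)
    (ht : 1 ≤ t) {Z : Ω → Z'} (hZ : Measurable[X.historySA H h t] Z) (hG : Measurable G) :
    Measurable[X.before H (t + 1)] fun ω => X.noise M H h t (fun s => G (Z ω, s)) ω := by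
  have htm : t ∈ Finset.Ico 1 (t + 1) := Finset.mem_Ico.2 ⟨ht, by omega⟩
  have hle := X.historySA_le_before_succ (Finset.mem_Icc.2 hh) ht
  have hsar := X.measurable_before htm (Finset.mem_Icc.2 hh)
  have hZ1 := hZ.mono hle le_rfl
  have hsa := (X.measurable_historySA H h t).mono hle le_rfl
  refine Measurable.sub (Measurable.add (measurable_snd.comp (measurable_snd.comp hsar)) ?_)
    (Measurable.add (M.measurable_meanReward.comp hsa) ?_)
  · by_cases hH : h < H
    · simp only [if_pos hH]
      exact hG.comp (hZ1.prodMk (measurable_fst.comp (X.measurable_before htm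
        (Finset.mem_Icc.2 ⟨by omega, by omega⟩))))
    · simp only [if_neg hH]; exact measurable_const
  · by_cases hH : h < H
    · simp only [if_pos hH]
      exact (measurable_meanNext_param (M := M) hG).comp (hZ1.prodMk hsa)
    · simp only [if_neg hH]; exact measurable_const

theorem ae_abs_noise_le (hX : IsLSVIUCB P M H T φ f γ X) {h t : ℕ} (hh : h ∈ Icc 1 H)
    (ht : t ∈ Icc 1 T) : ∀ᵐ ω ∂P, ∀ V : S → ℝ, (∀ s, |V s| ≤ 1) → |X.noise M H h t V ω| ≤ 3 := by
  filter_upwards [hX.ae_reward_mem hh ht] with ω hω V hV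
  have h1 := M.meanReward_mem (X.s h t ω) (X.a h t ω)
  have h2 : |(if h < H then V (X.s (h + 1) t ω) else 0)| ≤ 1 := by
    split_ifs
    · exact hV _
    · simp
  have h3 : |(if h < H then M.meanNext V (X.s h t ω) (X.a h t ω) else 0)| ≤ 1 := by
    split_ifs
    · exact M.abs_meanNext_le hV _ _
    · simp
  rw [abs_le] at h2 h3 ⊢
  rw [Execution.noise]
  constructor <;> linarith [hω.1, hω.2, h1.1, h1.2]

theorem condExp_noise (hX : IsLSVIUCB P M H T φ f γ X) {h t : ℕ} (hh : h ∈ Icc 1 H)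
    (ht : t ∈ Icc 1 T) {Z : Ω → Z'} (hZ : Measurable[X.historySA H h t] Z) (hG : Measurable G)
    (hc : ∀ z, |G z| ≤ 1) :
    P[fun ω => X.noise M H h t (fun s => G (Z ω, s)) ω | X.historySA H h t] =ᵐ[P] 0 := by
  have hle := hX.historySA_le hh ht
  have hr : Integrable (X.r h t) P :=
    Integrable.of_bound (C := 1) (hX.measurable_r t ht h hh).aestronglyMeasurable
      ((hX.ae_reward_mem hh ht).mono fun ω hω => by
        rw [Real.norm_of_nonneg hω.1]; exact hω.2)
  have hsa := X.measurable_historySA H h t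
  have hmr : Measurable[X.historySA H h t] fun ω => M.meanReward (X.s h t ω) (X.a h t ω) :=
    M.measurable_meanReward.comp hsa
  have hri : Integrable (fun ω => M.meanReward (X.s h t ω) (X.a h t ω)) P :=
    Integrable.of_bound (C := 1) (hmr.mono hle le_rfl).aestronglyMeasurable
      (Filter.Eventually.of_forall fun ω => by
        have := M.meanReward_mem (X.s h t ω) (X.a h t ω)
        rw [Real.norm_of_nonneg this.1]; exact this.2)
  have e1 : P[X.r h t - (fun ω => M.meanReward (X.s h t ω) (X.a h t ω)) | X.historySA H h t]
      =ᵐ[P] 0 := by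
    refine (condExp_sub hr hri _).trans ?_
    rw [condExp_of_stronglyMeasurable hle hmr.stronglyMeasurable hri]
    filter_upwards [hX.condExp_reward hh ht] with ω hω
    simp [hω]
  by_cases hH : h < H
  · have hs := hX.measurable_s t ht (h + 1) ⟨by omega, by omega⟩
    have hVi : Integrable (fun ω => G (Z ω, X.s (h + 1) t ω)) P :=
      Integrable.of_bound (C := 1) (hG.comp ((hZ.mono hle le_rfl).prodMk hs)).aestronglyMeasurable
        (Filter.Eventually.of_forall fun ω => hc _)
    have hmn : Measurable[X.historySA H h t] fun ω =>
        M.meanNext (fun s => G (Z ω, s)) (X.s h t ω) (X.a h t ω) :=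
      (measurable_meanNext_param (M := M) hG).comp (hZ.prodMk hsa)
    have hni : Integrable (fun ω => M.meanNext (fun s => G (Z ω, s)) (X.s h t ω) (X.a h t ω)) P :=
      Integrable.of_bound (C := 1) (hmn.mono hle le_rfl).aestronglyMeasurable
        (Filter.Eventually.of_forall fun ω => M.abs_meanNext_le (fun s => hc _) _ _)
    have e2 : P[(fun ω => G (Z ω, X.s (h + 1) t ω)) -
        (fun ω => M.meanNext (fun s => G (Z ω, s)) (X.s h t ω) (X.a h t ω)) | X.historySA H h t]
        =ᵐ[P] 0 := by
      refine (condExp_sub hVi hni _).trans ?_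
      rw [condExp_of_stronglyMeasurable hle hmn.stronglyMeasurable hni]
      filter_upwards [hX.condExp_next hh.1 hH ht hZ hG hc] with ω hω
      simp [hω]
    have e3 : (fun ω => X.noise M H h t (fun s => G (Z ω, s)) ω) =
        (X.r h t - (fun ω => M.meanReward (X.s h t ω) (X.a h t ω))) +
        ((fun ω => G (Z ω, X.s (h + 1) t ω)) -
        (fun ω => M.meanNext (fun s => G (Z ω, s)) (X.s h t ω) (X.a h t ω))) := by
      funext ω
      simp only [Execution.noise, if_pos hH, Pi.add_apply, Pi.sub_apply]
      ring
    rw [e3]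
    refine (condExp_add (hr.sub hri) (hVi.sub hni) _).trans ?_
    filter_upwards [e1, e2] with ω h1 h2
    simp [h1, h2]
  · have e3 : (fun ω => X.noise M H h t (fun s => G (Z ω, s)) ω) =
        X.r h t - (fun ω => M.meanReward (X.s h t ω) (X.a h t ω)) := by
      funext ω
      simp only [Execution.noise, if_neg hH, Pi.sub_apply]
      ring
    rw [e3]
    exact e1

/-- Bellman noise at a fixed time point, along the episodes `k, k + 1, …`. -/
theorem isNoise_noise (hX : IsLSVIUCB P M H T φ f γ X) {h k n : ℕ} (hh : h ∈ Icc 1 H) (hk : 1 ≤ k)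
    (hn : n + k ≤ T + 1) {Z : ℕ → Ω → Z'}
    (hZ : ∀ i < n, Measurable[X.historySA H h (i + k)] (Z (i + k))) (hG : Measurable G)
    (hc : ∀ z, |G z| ≤ 1) :
    IsNoise P (fun i => X.historySA H h (i + k)) n 3
      (fun i ω => X.noise M H h (i + k) (fun s => G (Z (i + k) ω, s)) ω) where
  le i hi := hX.historySA_le hh ⟨by omega, by omega⟩
  measurable i hi := (measurable_noise hh (by omega) (hZ i hi) hG).mono
    (hX.before_le (by omega)) le_rfl
  past i hi j hj := (measurable_noise hh (by omega) (hZ j (by omega)) hG).mono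
    ((X.before_mono H (by omega)).trans (X.before_le_historySA H h _)) le_rfl
  bound i hi := (hX.ae_abs_noise_le hh ⟨by omega, by omega⟩).mono fun ω hω => hω _ fun _ => hc _
  centered i hi := hX.condExp_noise hh ⟨by omega, by omega⟩ (hZ i hi) hG hc

theorem isNoise_initNoise (hX : IsLSVIUCB P M H T φ f γ X) (hH : 1 ≤ H) {k n : ℕ} (hk : 1 ≤ k)
    (hn : n + k ≤ T + 1) {Z : ℕ → Ω → Z'}
    (hZ : ∀ i < n, Measurable[X.before H (i + k)] (Z (i + k))) (hG : Measurable G)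
    (hc : ∀ z, |G z| ≤ 1) :
    IsNoise P (fun i => X.before H (i + k)) n 2
      (fun i ω => X.initNoise M (i + k) (fun s => G (Z (i + k) ω, s)) ω) := by
  have hker : Measurable fun z => ∫ s, G (z, s) ∂M.init :=
    (StronglyMeasurable.integral_prod_right' hG.stronglyMeasurable).measurable
  have hI : ∀ z, |∫ s, G (z, s) ∂M.init| ≤ 1 := fun z => by
    have := norm_integral_le_of_norm_le_const (μ := M.init) (f := fun s => G (z, s)) (C := 1)
      (Filter.Eventually.of_forall fun s => hc _)
    simpa using this
  have hmeas : ∀ i < n, Measurable[X.before H (i + k + 1)]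
      fun ω => X.initNoise M (i + k) (fun s => G (Z (i + k) ω, s)) ω := fun i hi => by
    have hZ1 := (hZ i hi).mono (X.before_mono H (Nat.le_succ (i + k))) le_rfl
    exact (hker.comp hZ1).sub (hG.comp (hZ1.prodMk (measurable_fst.comp (X.measurable_before
      (Finset.mem_Ico.2 ⟨by omega, by omega⟩) (Finset.mem_Icc.2 ⟨le_rfl, hH⟩)))))
  refine ⟨fun i hi => hX.before_le (by omega), fun i hi => (hmeas i hi).mono
    (hX.before_le (by omega)) le_rfl, fun i hi j hj => (hmeas j (by omega)).mono
    (X.before_mono H (by omega)) le_rfl, fun i hi => Filter.Eventually.of_forall fun ω => ?_,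
    fun i hi => ?_⟩
  · have h1 := abs_le.1 (hI (Z (i + k) ω))
    have h2 := abs_le.1 (hc (Z (i + k) ω, X.s 1 (i + k) ω))
    rw [Execution.initNoise, abs_le]
    constructor <;> linarith
  · have hle : X.before H (i + k) ≤ mΩ := hX.before_le (by omega)
    have ht : i + k ∈ Icc 1 T := ⟨by omega, by omega⟩
    have hs := hX.measurable_s (i + k) ht 1 ⟨le_rfl, hH⟩
    have hZi := hZ i hi
    have h1 := HasCondLaw.condExp_eq hle hs hZi (Kernel.const Z' M.init)
      (hX.init_law (i + k) ht) hG hc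
    have hA : Integrable (fun ω => ∫ s, G (Z (i + k) ω, s) ∂M.init) P :=
      Integrable.of_bound (C := 1) ((hker.comp hZi).mono hle le_rfl).aestronglyMeasurable
        (Filter.Eventually.of_forall fun ω => hI _)
    have hB : Integrable (fun ω => G (Z (i + k) ω, X.s 1 (i + k) ω)) P :=
      Integrable.of_bound (C := 1)
        (hG.comp ((hZi.mono hle le_rfl).prodMk hs)).aestronglyMeasurable
        (Filter.Eventually.of_forall fun ω => hc _)
    have hAm : StronglyMeasurable[X.before H (i + k)]
        fun ω => ∫ s, G (Z (i + k) ω, s) ∂M.init := (hker.comp hZi).stronglyMeasurable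
    refine (condExp_sub hA hB _).trans ?_
    rw [condExp_of_stronglyMeasurable hle hAm hA]
    filter_upwards [h1] with ω hω
    simp [hω]

end Noise

theorem integrable_totalReward (hX : IsLSVIUCB P M H T φ f γ X) {t : ℕ} (ht : t ∈ Icc 1 T) :
    Measurable (X.totalReward H t) ∧ (∀ᵐ ω ∂P, X.totalReward H t ω ∈ Icc (0 : ℝ) H) ∧
      Integrable (X.totalReward H t) P := by
  have hm : Measurable (X.totalReward H t) :=
    Finset.measurable_sum _ fun h hh => hX.measurable_r t ht h (Finset.mem_Icc.1 hh)
  have hb : ∀ᵐ ω ∂P, X.totalReward H t ω ∈ Icc (0 : ℝ) H := by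
    have : ∀ᵐ ω ∂P, ∀ h ∈ Finset.Icc 1 H, X.r h t ω ∈ Icc (0 : ℝ) 1 :=
      (Finset.eventually_all _).2 fun h hh => hX.ae_reward_mem (Finset.mem_Icc.1 hh) ht
    filter_upwards [this] with ω hω
    exact ⟨Finset.sum_nonneg fun h hh => (hω h hh).1,
      (Finset.sum_le_sum fun h hh => (hω h hh).2).trans (by simp)⟩
  exact ⟨hm, hb, Integrable.of_bound (C := (H : ℝ)) hm.aestronglyMeasurable
    (hb.mono fun ω hω => by rw [Real.norm_of_nonneg hω.1]; exact hω.2)⟩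

theorem condExp_totalReward_mem (hX : IsLSVIUCB P M H T φ f γ X) {t : ℕ} (ht : t ∈ Icc 1 T) :
    ∀ᵐ ω ∂P, (P[X.totalReward H t | X.before H t]) ω ∈ Icc (0 : ℝ) H := by
  obtain ⟨hm, hb, hi⟩ := hX.integrable_totalReward ht
  have hle := hX.before_le (t := t) (by have := ht.2; omega)
  have h1 := condExp_mono (m := X.before H t) (μ := P) (integrable_zero Ω ℝ P) hi
    (hb.mono fun ω hω => hω.1)
  have h2 := condExp_mono (m := X.before H t) (μ := P) hi (integrable_const (H : ℝ))
    (hb.mono fun ω hω => hω.2)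
  rw [condExp_zero] at h1
  rw [condExp_const hle] at h2
  filter_upwards [h1, h2] with ω a b
  exact ⟨a, b⟩

theorem isNoise_totalReward (hX : IsLSVIUCB P M H T φ f γ X) {k n : ℕ} (hk : 1 ≤ k)
    (hn : n + k ≤ T + 1) :
    IsNoise P (fun i => X.before H (i + k)) n H
      (fun i ω => X.totalReward H (i + k) ω -
        (P[X.totalReward H (i + k) | X.before H (i + k)]) ω) := by
  have hmeas : ∀ i < n, Measurable[X.before H (i + k + 1)] fun ω => X.totalReward H (i + k) ω -
        (P[X.totalReward H (i + k) | X.before H (i + k)]) ω := fun i hi => by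
    refine Measurable.sub (Finset.measurable_sum _ fun h hh => ?_)
      (stronglyMeasurable_condExp.measurable.mono (X.before_mono H (Nat.le_succ _)) le_rfl)
    exact measurable_snd.comp (measurable_snd.comp (X.measurable_before
      (Finset.mem_Ico.2 ⟨by omega, by omega⟩) hh))
  refine ⟨fun i hi => hX.before_le (by omega), fun i hi => (hmeas i hi).mono
    (hX.before_le (by omega)) le_rfl, fun i hi j hj => (hmeas j (by omega)).mono
    (X.before_mono H (by omega)) le_rfl, fun i hi => ?_, fun i hi => ?_⟩
  · have ht : i + k ∈ Icc 1 T := ⟨by omega, by omega⟩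
    filter_upwards [(hX.integrable_totalReward ht).2.1, hX.condExp_totalReward_mem ht] with ω a b
    exact abs_le.2 ⟨by linarith [a.1, b.2], by linarith [a.2, b.1]⟩
  · have ht : i + k ∈ Icc 1 T := ⟨by omega, by omega⟩
    have hi := (hX.integrable_totalReward ht).2.2
    refine (condExp_sub hi integrable_condExp _).trans ?_
    rw [condExp_of_stronglyMeasurable (hX.before_le (by omega)) stronglyMeasurable_condExp
      integrable_condExp]
    exact Filter.Eventually.of_forall fun ω => by simp

/-- Lower bounds for mean rewards give lower bounds for the expected reward of an episode. -/
theorem le_condExp_totalReward (hX : IsLSVIUCB P M H T φ f γ X) {t : ℕ} (ht : t ∈ Icc 1 T) {c : ℝ}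
    (hc : ∀ s a, c ≤ M.meanReward s a) :
    ∀ᵐ ω ∂P, H * c ≤ (P[X.totalReward H t | X.before H t]) ω := by
  have hle0 := hX.before_le (t := t) (by have := ht.2; omega)
  have hri : ∀ h ∈ Finset.Icc 1 H, Integrable (X.r h t) P := fun h hh =>
    Integrable.of_bound (C := 1) (hX.measurable_r t ht h (Finset.mem_Icc.1 hh)).aestronglyMeasurable
      ((hX.ae_reward_mem (Finset.mem_Icc.1 hh) ht).mono fun ω hω => by
        rw [Real.norm_of_nonneg hω.1]; exact hω.2)
  have h1 : ∀ h ∈ Finset.Icc 1 H, ∀ᵐ ω ∂P, c ≤ (P[X.r h t | X.before H t]) ω := by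
    intro h hh
    have hh' := Finset.mem_Icc.1 hh
    have hle := X.before_le_historySA H h t
    have e := condExp_condExp_of_le (μ := P) (f := X.r h t) hle (hX.historySA_le hh' ht)
    have e2 := condExp_mono (m := X.before H t) (μ := P) (integrable_const c)
      (integrable_condExp (m := X.historySA H h t) (f := X.r h t))
      ((hX.condExp_reward hh' ht).mono fun ω hω => by rw [hω]; exact hc _ _)
    rw [condExp_const hle0] at e2
    filter_upwards [e, e2] with ω a b
    rwa [← a]
  have h2 := condExp_finsetSum (μ := P) (s := Finset.Icc 1 H) (f := fun h => X.r h t) hri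
    (X.before H t)
  have h3 : X.totalReward H t = ∑ h ∈ Finset.Icc 1 H, X.r h t := by
    funext ω; simp [Execution.totalReward]
  rw [h3]
  filter_upwards [h2, (Finset.eventually_all _).2 h1] with ω a b
  rw [a, Finset.sum_apply]
  calc H * c = ∑ h ∈ Finset.Icc 1 H, c := by simp
    _ ≤ _ := Finset.sum_le_sum fun h hh => b h hh

end IsLSVIUCB

end ExecutionNoise

/-! ### Confidence sets for the constrained least squares estimates -/

section Regression

/-- If `Δ` is the error of a least squares fit, so that `∑ Δ² ≤ 2 ∑ ξ Δ`, then `∑ Δ²` is controlled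
by the exponential martingale of nearby noises `ξ'` and errors `Δ'`. -/
theorem sum_sq_le_of_stat_le {n : ℕ} {ξ ξ' D D' : ℕ → ℝ} {ε η ℓ : ℝ}
    (hξ : ∀ i < n, |ξ i| ≤ 3) (hD : ∀ i < n, |D i| ≤ 2) (hD' : ∀ i < n, |D' i| ≤ 2)
    (hξξ : ∀ i < n, |ξ i - ξ' i| ≤ 2 * ε) (hDD : ∀ i < n, |D i - D' i| ≤ 2 * η)
    (hfit : ∑ i ∈ Finset.range n, D i ^ 2 ≤ 2 * ∑ i ∈ Finset.range n, ξ i * D i)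
    (hstat : ∑ i ∈ Finset.range n, (D' i / 18 * ξ' i - 3 ^ 2 * (D' i / 18) ^ 2 / 2) ≤ ℓ)
    (hsmall : n * (8 * η + 4 * ε) ≤ 1) :
    ∑ i ∈ Finset.range n, D i ^ 2 ≤ 72 * ℓ + 4 := by
  have hterm : ∀ i ∈ Finset.range n, ξ i * D i ≤
      18 * (D' i / 18 * ξ' i - 3 ^ 2 * (D' i / 18) ^ 2 / 2) + D i ^ 2 / 4 + (8 * η + 4 * ε) := by
    intro i hi
    have hi' := Finset.mem_range.1 hi
    have h1 : ξ i * (D i - D' i) ≤ 3 * (2 * η) := (le_abs_self _).trans (by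
      rw [abs_mul]; exact mul_le_mul (hξ i hi') (hDD i hi') (abs_nonneg _) (by norm_num))
    have h2 : D' i * (ξ i - ξ' i) ≤ 2 * (2 * ε) := (le_abs_self _).trans (by
      rw [abs_mul]; exact mul_le_mul (hD' i hi') (hξξ i hi') (abs_nonneg _) (by norm_num))
    have h3 : (D' i - D i) * (D' i + D i) ≤ 2 * η * 4 := (le_abs_self _).trans (by
      rw [abs_mul, abs_sub_comm]
      refine mul_le_mul (hDD i hi') ?_ (abs_nonneg _) ((abs_nonneg _).trans (hDD i hi'))
      exact (abs_add_le _ _).trans (by linarith [hD i hi', hD' i hi']))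
    nlinarith
  have hsum := Finset.sum_le_sum hterm
  rw [Finset.sum_add_distrib, Finset.sum_add_distrib, ← Finset.mul_sum, ← Finset.sum_div,
    Finset.sum_const, Finset.card_range, nsmul_eq_mul] at hsum
  linarith

variable {Ω : Type w} {S : Type u} {A : Type v} {d : ℕ}
  {H T : ℕ} {φ : S → A → Vec d} {f : ℝ → ℝ} {κ K M₂ γ Γ : ℝ} {X : Execution Ω S A d}

theorem Execution.Lam_eq_gram (h t : ℕ) (ω : Ω) :
    X.Lam φ h t ω = gram (fun τ => X.x φ h τ ω) t := rfl

theorem Execution.Qbar_eq_upFun {h t : ℕ} (hh : h ≤ H) (ht : 1 ≤ t) {ω : Ω}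
    (hφ : ∀ s a, ‖φ s a‖ ≤ 1) (hθ : ‖X.θ h t ω‖ ≤ 1) :
    X.Qbar φ f γ H h t ω = upFun φ f γ (X.θ h t ω) (X.Lam φ h t ω)⁻¹ := by
  funext s a
  rw [Execution.Qbar, if_neg (by omega), if_neg (by omega), upFun,
    clampLink_of_mem (inner_mem_Icc (hφ s a) hθ)]

variable [MeasurableSpace S] [MeasurableSpace A] {M : MDP S A}

theorem Execution.abs_noise_sub_le {h t : ℕ} {V V' : S → ℝ} {ε : ℝ} {ω : Ω} (hV : Measurable V)
    (hV' : Measurable V') (hb : ∀ s, |V s| ≤ 1) (hb' : ∀ s, |V' s| ≤ 1)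
    (hε : ∀ s, |V s - V' s| ≤ ε) : |X.noise M H h t V ω - X.noise M H h t V' ω| ≤ 2 * ε := by
  have hε0 : 0 ≤ ε := (abs_nonneg _).trans (hε (X.s h t ω))
  rw [Execution.noise, Execution.noise]
  split_ifs with hH
  · have h1 := hε (X.s (h + 1) t ω)
    have h2 : |M.meanNext V (X.s h t ω) (X.a h t ω) - M.meanNext V' (X.s h t ω) (X.a h t ω)| ≤ ε := by
      rw [MDP.meanNext, MDP.meanNext, ← integral_sub
        (Integrable.of_bound hV.aestronglyMeasurable 1 (Filter.Eventually.of_forall hb))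
        (Integrable.of_bound hV'.aestronglyMeasurable 1 (Filter.Eventually.of_forall hb'))]
      have := norm_integral_le_of_norm_le_const (μ := M.trans (X.s h t ω, X.a h t ω))
        (f := fun s => V s - V' s) (C := ε) (Filter.Eventually.of_forall hε)
      simpa using this
    rw [abs_le] at h1 h2 ⊢
    constructor <;> linarith
  · simp only [sub_self, abs_zero]
    positivity

/-- The statistic whose uniform smallness makes the least squares estimates accurate: the logarithm
of the exponential martingale for the Bellman noise of the value function with parameters `(θ, B)`,
weighted by the differences of the linear models `θ₁` and `θ₂`. -/
def regressionStat (M : MDP S A) (H : ℕ) (φ : S → A → Vec d) (f : ℝ → ℝ) (γ : ℝ)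
    (X : Execution Ω S A d) (h t : ℕ) (θ : Vec d) (B : Matrix (Fin d) (Fin d) ℝ) (θ₁ θ₂ : Vec d)
    (ω : Ω) : ℝ :=
  ∑ i ∈ Finset.range t,
    ((clampLink f (inner ℝ (X.x φ h (i + 1) ω) θ₁) -
        clampLink f (inner ℝ (X.x φ h (i + 1) ω) θ₂)) / 18 *
        X.noise M H h (i + 1) (maxQ (upFun φ f γ θ B)) ω -
      3 ^ 2 * ((clampLink f (inner ℝ (X.x φ h (i + 1) ω) θ₁) -
        clampLink f (inner ℝ (X.x φ h (i + 1) ω) θ₂)) / 18) ^ 2 / 2)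

/-- Optimistic closure provides a linear model of the Bellman update of `Q̄_{h+1,t}`. -/
theorem exists_bellman_model {h t : ℕ} (hh : h ∈ Icc 1 H) (ht : 1 ≤ t) {ω : Ω}
    (hγ : 0 ≤ γ) (hγΓ : γ ≤ Γ) (hφ : ∀ s a, ‖φ s a‖ ≤ 1) (hO : OptimisticClosure M H φ f Γ)
    (hθ : h < H → ‖X.θ (h + 1) t ω‖ ≤ 1) :
    ∃ θ : Vec d, ‖θ‖ ≤ 1 ∧ ∀ s a,
      M.bellman H h (X.Qbar φ f γ H (h + 1) t ω) s a = clampLink f (inner ℝ (φ s a) θ) := by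
  suffices h0 : ∃ g ∈ glmUpClass φ f Γ,
      M.bellman H h (X.Qbar φ f γ H (h + 1) t ω) = M.bellman H h g by
    obtain ⟨g, hg, he⟩ := h0
    obtain ⟨θ, hθ1, hθ2⟩ := hO h hh.1 hh.2 g hg
    exact ⟨θ, hθ1, fun s a => by
      rw [he, hθ2, clampLink_of_mem (inner_mem_Icc (hφ s a) hθ1)]⟩
  by_cases hH : h < H
  · refine ⟨X.Qbar φ f γ H (h + 1) t ω, ⟨X.θ (h + 1) t ω, γ, (X.Lam φ (h + 1) t ω)⁻¹, hθ hH, hγ,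
      hγΓ, gram_inv_posSemidef _ _, norm_toEuclideanCLM_gram_inv_le _ _, fun s a => ?_⟩, rfl⟩
    rw [Execution.Qbar, if_neg (by omega), if_neg (by omega)]
  · -- the last Bellman update does not depend on its argument
    refine ⟨fun s a => min 1 (f (inner ℝ (φ s a) (0 : Vec d)) +
      0 * mahalanobis (0 : Matrix (Fin d) (Fin d) ℝ) (φ s a)),
      ⟨0, 0, 0, by simp, le_rfl, hγ.trans hγΓ, Matrix.PosSemidef.zero, by simp,
        fun s a => rfl⟩, ?_⟩
    funext s a
    rw [MDP.bellman_eq, MDP.bellman_eq, if_neg hH, if_neg hH]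

variable [Finite A]

theorem measurable_maxQ_upFun_fixed (hf : LinkRegular f κ K M₂)
    (hφm : Measurable fun z : S × A => φ z.1 z.2) (θ : Vec d) (B : Matrix (Fin d) (Fin d) ℝ) :
    Measurable (maxQ (upFun φ f γ θ B)) := by
  have h1 := measurable_maxQ_upFun (φ := φ) (γ := γ) hf hφm
  have h2 : Measurable fun s : S =>
      (((θ, Matrix.of.symm B) : Vec d × (Fin d → Fin d → ℝ)), s) :=
    measurable_const.prodMk measurable_id
  have h3 := h1.comp h2
  simp only [Function.comp_def, Equiv.apply_symm_apply] at h3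
  exact h3

variable [Nonempty A]

/-- The confidence bound at a sample point where the regression statistic is small at all points of
a net of mesh `ε`. -/
theorem abs_clampLink_sub_le_bonus (hf : LinkRegular f κ K M₂) (hγ : 0 ≤ γ) (hγΓ : γ ≤ Γ)
    (hφm : Measurable fun z : S × A => φ z.1 z.2) (hφ : ∀ s a, ‖φ s a‖ ≤ 1)
    (hO : OptimisticClosure M H φ f Γ) {ε ℓ : ℝ}
    (hε1 : 16 * T * (K * (d * ε)) ≤ 1) (hε2 : 16 * T * (γ * (d * √ε)) ≤ 1)
    (hγℓ : K * κ⁻¹ * √(72 * ℓ + 8) ≤ γ)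
    {N₁ : Finset (Vec d)} {N₂ : Finset (Matrix (Fin d) (Fin d) ℝ)}
    (hN₁ : ∀ θ : Vec d, ‖θ‖ ≤ 1 → ∃ q ∈ N₁, ∀ i, |θ.ofLp i - q.ofLp i| ≤ ε)
    (hN₂ : ∀ B : Matrix (Fin d) (Fin d) ℝ, (∀ i j, |B i j| ≤ 1) →
      ∃ q ∈ N₂, ∀ i j, |B i j - q i j| ≤ ε)
    {ω : Ω} {h t : ℕ} (hh : h ∈ Icc 1 H) (ht : t ∈ Icc 1 T)
    (hθ : ∀ h' ∈ Icc 1 H, ‖X.θ h' t ω‖ ≤ 1)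
    (hmin : ∀ ϑ : Vec d, ‖ϑ‖ ≤ 1 → X.loss φ f γ H h t ω (X.θ h t ω) ≤ X.loss φ f γ H h t ω ϑ)
    (hnoise : ∀ τ ∈ Icc 1 T, ∀ V : S → ℝ, (∀ s, |V s| ≤ 1) → |X.noise M H h τ V ω| ≤ 3)
    (hstat : ∀ θ ∈ N₁, ∀ B ∈ N₂, ∀ θ₁ ∈ N₁, ∀ θ₂ ∈ N₁,
      regressionStat M H φ f γ X h t θ B θ₁ θ₂ ω ≤ ℓ) (s : S) (a : A) :
    |clampLink f (inner ℝ (φ s a) (X.θ h t ω)) -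
        M.bellman H h (X.Qbar φ f γ H (h + 1) t ω) s a| ≤
      γ * mahalanobis (X.Lam φ h t ω)⁻¹ (φ s a) := by
  obtain ⟨θb, hθb, hmodel⟩ := exists_bellman_model hh ht.1 hγ hγΓ hφ hO
    (X := X) (t := t) (ω := ω) fun hH => hθ (h + 1) ⟨by omega, by omega⟩
  rw [hmodel]
  have hK := hf.K_pos
  have hx : ∀ τ, ‖X.x φ h τ ω‖ ≤ 1 := fun τ => hφ _ _
  have hθh := hθ h hh
  -- the parameters of the value function at the next time point
  obtain ⟨θ₀, hθ₀, hθ₀e⟩ : ∃ θ₀ : Vec d, ‖θ₀‖ ≤ 1 ∧ (h < H → θ₀ = X.θ (h + 1) t ω) := by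
    by_cases hH : h < H
    · exact ⟨_, hθ (h + 1) ⟨by omega, by omega⟩, fun _ => rfl⟩
    · exact ⟨0, by simp, fun h' => absurd h' hH⟩
  set B : Matrix (Fin d) (Fin d) ℝ := (X.Lam φ (h + 1) t ω)⁻¹ with hB
  have hB1 : ∀ i j, |B i j| ≤ 1 := fun i j => by
    have h1 := norm_gram_inv_mulVec_le (fun τ => X.x φ (h + 1) τ ω) t (EuclideanSpace.single j 1)
    have h2 := (abs_coord_le_norm _ i).trans h1
    simpa [hB, Execution.Lam_eq_gram, Matrix.mulVec_single] using h2
  obtain ⟨q₀, hq₀, hq₀'⟩ := hN₁ θ₀ hθ₀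
  obtain ⟨q₁, hq₁, hq₁'⟩ := hN₁ _ hθh
  obtain ⟨q₂, hq₂, hq₂'⟩ := hN₁ θb hθb
  obtain ⟨B', hB', hB''⟩ := hN₂ B hB1
  set V : S → ℝ := maxQ (upFun φ f γ θ₀ B) with hV
  set V' : S → ℝ := maxQ (upFun φ f γ q₀ B') with hV'
  have hVb : ∀ s, |V s| ≤ 1 := fun s => abs_maxQ_le fun a => abs_upFun_le hf hγ _ _ _ _
  have hVb' : ∀ s, |V' s| ≤ 1 := fun s => abs_maxQ_le fun a => abs_upFun_le hf hγ _ _ _ _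
  have hVV : ∀ s, |V s - V' s| ≤ K * (d * ε) + γ * (d * √ε) := fun s =>
    abs_maxQ_sub_le fun a => abs_upFun_sub_le hf hγ (hφ s a) hq₀' hB''
  let F : Vec d → ℕ → ℝ := fun θ i => clampLink f (inner ℝ (X.x φ h (i + 1) ω) θ)
  have hF1 : ∀ θ i, |F θ i| ≤ 1 := fun θ i => hf.abs_clampLink_le _
  have hFF : ∀ θ θ' i, |F θ i - F θ' i| ≤ 2 := fun θ θ' i => by
    have h1 := abs_le.1 (hF1 θ i)
    have h2 := abs_le.1 (hF1 θ' i)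
    rw [abs_le]; constructor <;> linarith
  have hFq : ∀ {θ q : Vec d}, (∀ i, |θ.ofLp i - q.ofLp i| ≤ ε) → ∀ i,
      |F θ i - F q i| ≤ K * (d * ε) := fun hq i =>
    (hf.abs_clampLink_sub_le _ _).trans (mul_le_mul_of_nonneg_left (abs_inner_sub_le (hx _) hq) hK.le)
  let ξ : ℕ → ℝ := fun i => X.noise M H h (i + 1) V ω
  -- the noise of the regression at `h` is the Bellman noise
  have hy : ∀ i, X.y φ f γ H h t (i + 1) ω = ξ i + F θb i := by
    intro i
    have h1 := hmodel (X.s h (i + 1) ω) (X.a h (i + 1) ω)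
    rw [MDP.bellman_eq] at h1
    simp only [F, Execution.x, ← h1, ξ, Execution.noise, Execution.y]
    by_cases hH : h < H
    · have e : X.Qbar φ f γ H (h + 1) t ω = upFun φ f γ θ₀ B := by
        rw [hθ₀e hH, Execution.Qbar_eq_upFun (by omega) ht.1 hφ (hθ (h + 1) ⟨by omega, by omega⟩)]
      simp only [if_pos hH, e, hV]
      ring
    · have e : X.Qbar φ f γ H (h + 1) t ω = fun _ _ => 0 := by
        funext s a
        rw [Execution.Qbar, if_pos (by omega)]
      simp only [if_neg hH, e, maxQ_zero]
      ring
  have hfit : ∑ i ∈ Finset.range t, (F (X.θ h t ω) i - F θb i) ^ 2 ≤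
      2 * ∑ i ∈ Finset.range t, ξ i * (F (X.θ h t ω) i - F θb i) := by
    have hl : ∀ ϑ : Vec d, ‖ϑ‖ ≤ 1 → X.loss φ f γ H h t ω ϑ =
        ∑ i ∈ Finset.range t, (ξ i + F θb i - F ϑ i) ^ 2 := fun ϑ hϑ => by
      rw [Execution.loss, ← Finset.Ico_add_one_right_eq_Icc, Finset.sum_Ico_eq_sum_range]
      refine Finset.sum_congr (by simp) fun i _ => ?_
      rw [add_comm 1 i, hy]
      simp only [F]
      rw [clampLink_of_mem (inner_mem_Icc (hx (i + 1)) hϑ)]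
    have h1 := hmin θb hθb
    rw [hl _ hθh, hl _ hθb] at h1
    rw [Finset.mul_sum, ← sub_nonpos, ← Finset.sum_sub_distrib]
    rw [← sub_nonpos, ← Finset.sum_sub_distrib] at h1
    refine le_trans (le_of_eq (Finset.sum_congr rfl fun i _ => ?_)) h1
    ring
  have htT : (t : ℝ) ≤ T := by exact_mod_cast ht.2
  have hε0 : 0 ≤ K * (d * ε) + γ * (d * √ε) := (abs_nonneg _).trans (hVV s)
  have hη0 : 0 ≤ K * (d * ε) := by
    have : d = 0 ∨ 0 ≤ ε := by
      rcases Nat.eq_zero_or_pos d with h0 | h0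
      · exact Or.inl h0
      · exact Or.inr ((abs_nonneg _).trans (hq₀' ⟨0, h0⟩))
    rcases this with h0 | h0
    · simp [h0]
    · positivity
  have hsq : ∑ i ∈ Finset.range t, (F (X.θ h t ω) i - F θb i) ^ 2 ≤ 72 * ℓ + 4 := by
    refine sum_sq_le_of_stat_le (ξ := ξ) (ξ' := fun i => X.noise M H h (i + 1) V' ω)
      (D' := fun i => F q₁ i - F q₂ i) (ε := K * (d * ε) + γ * (d * √ε)) (η := K * (d * ε))
      (fun i hi => hnoise (i + 1) ⟨by omega, by have := ht.2; omega⟩ V hVb)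
      (fun i _ => hFF _ _ i) (fun i _ => hFF _ _ i)
      (fun i _ => Execution.abs_noise_sub_le (measurable_maxQ_upFun_fixed hf hφm _ _)
        (measurable_maxQ_upFun_fixed hf hφm _ _) hVb hVb' hVV)
      (fun i _ => ?_) hfit (hstat q₀ hq₀ B' hB' q₁ hq₁ q₂ hq₂) ?_
    · have h1 := abs_le.1 (hFq hq₁' i)
      have h2 := abs_le.1 (hFq hq₂' i)
      rw [abs_le]; constructor <;> linarith
    · have : (t : ℝ) * (8 * (K * (d * ε)) + 4 * (K * (d * ε) + γ * (d * √ε))) ≤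
          T * (8 * (K * (d * ε)) + 4 * (K * (d * ε) + γ * (d * √ε))) :=
        mul_le_mul_of_nonneg_right htT (by linarith)
      linarith
  -- pass from the errors of the link function to the errors of the parameters
  set v : Vec d := X.θ h t ω - θb with hv
  have hκ := hf.kappa_pos
  have hlin : κ ^ 2 * ∑ τ ∈ Finset.Icc 1 t, inner ℝ (X.x φ h τ ω) v ^ 2 ≤ 72 * ℓ + 4 := by
    refine le_trans ?_ hsq
    rw [← Finset.Ico_add_one_right_eq_Icc, Finset.sum_Ico_eq_sum_range, Finset.mul_sum]
    refine le_of_eq_of_le (Finset.sum_congr (by simp) fun i _ => rfl)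
      (Finset.sum_le_sum (s := Finset.range t) fun i _ => ?_)
    rw [add_comm 1 i, ← mul_pow, hv, inner_sub_right]
    have h1 := hf.le_abs_clampLink_sub (inner_mem_Icc (hx (i + 1)) hθh)
      (inner_mem_Icc (hx (i + 1)) hθb)
    rw [← sq_abs (F _ i - F _ i), ← sq_abs (κ * _), abs_mul, abs_of_pos hκ]
    exact pow_le_pow_left₀ (by positivity) h1 2
  have hv2 : ‖v‖ ≤ 2 := (norm_sub_le _ _).trans (by linarith)
  have hnorm : κ ^ 2 * (∑ τ ∈ Finset.Icc 1 t, inner ℝ (X.x φ h τ ω) v ^ 2 + ‖v‖ ^ 2) ≤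
      72 * ℓ + 8 := by
    have h1 : ‖v‖ ^ 2 ≤ 4 := by nlinarith [norm_nonneg v]
    have h2 : κ ^ 2 ≤ 1 := pow_le_one₀ hκ.le hf.kappa_le_one
    nlinarith [sq_nonneg ‖v‖]
  have hcs := abs_inner_le_mahalanobis (fun τ => X.x φ h τ ω) t (φ s a) v
  have hroot : √(∑ τ ∈ Finset.Icc 1 t, inner ℝ (X.x φ h τ ω) v ^ 2 + ‖v‖ ^ 2) ≤
      κ⁻¹ * √(72 * ℓ + 8) := by
    rw [inv_mul_eq_div, le_div_iff₀ hκ, mul_comm]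
    refine Real.le_sqrt_of_sq_le ?_
    rw [mul_pow, Real.sq_sqrt (by positivity)]
    exact hnorm
  calc |clampLink f (inner ℝ (φ s a) (X.θ h t ω)) - clampLink f (inner ℝ (φ s a) θb)|
      ≤ K * |inner ℝ (φ s a) v| := by
        rw [hv, inner_sub_right]; exact hf.abs_clampLink_sub_le _ _
    _ ≤ K * (mahalanobis (X.Lam φ h t ω)⁻¹ (φ s a) * (κ⁻¹ * √(72 * ℓ + 8))) := by
        refine mul_le_mul_of_nonneg_left (hcs.trans ?_) hK.le
        exact mul_le_mul_of_nonneg_left hroot (mahalanobis_nonneg _ _)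
    _ = (K * κ⁻¹ * √(72 * ℓ + 8)) * mahalanobis (X.Lam φ h t ω)⁻¹ (φ s a) := by ring
    _ ≤ γ * mahalanobis (X.Lam φ h t ω)⁻¹ (φ s a) :=
        mul_le_mul_of_nonneg_right hγℓ (mahalanobis_nonneg _ _)

end Regression

/-! ### Regret decomposition -/

section Decomposition

theorem IsNoise.neg {Ω : Type*} {m0 : MeasurableSpace Ω} {P : Measure Ω}
    {m : ℕ → MeasurableSpace Ω} {n : ℕ} {c : ℝ} {ξ : ℕ → Ω → ℝ} (h : IsNoise P m n c ξ) :
    IsNoise P m n c (fun i ω => -ξ i ω) where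
  le := h.le
  measurable i hi := (h.measurable i hi).neg
  past i hi j hj := (h.past i hi j hj).neg
  bound i hi := (h.bound i hi).mono fun ω hω => by rwa [abs_neg]
  centered i hi := by
    refine (condExp_neg (ξ i) (m i)).trans ?_
    filter_upwards [h.centered i hi] with ω hω
    simp [hω]

variable {Ω : Type w} {S : Type u} {A : Type v} {d : ℕ}
  {H T : ℕ} {φ : S → A → Vec d} {f : ℝ → ℝ} {κ K M₂ γ Γ : ℝ} {X : Execution Ω S A d}

theorem Execution.Qbar_of_lt {h t : ℕ} (hh : H < h) (ω : Ω) :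
    X.Qbar φ f γ H h t ω = fun _ _ => 0 := by
  funext s a
  rw [Execution.Qbar, if_pos hh]

variable [MeasurableSpace S] [MeasurableSpace A] {M : MDP S A}

theorem Execution.noise_congr {h t : ℕ} {V V' : S → ℝ} (hV : h < H → V = V') (ω : Ω) :
    X.noise M H h t V ω = X.noise M H h t V' ω := by
  by_cases hH : h < H
  · rw [hV hH]
  · simp only [Execution.noise, if_neg hH]

/-- Optimism and accuracy: the confidence bound places `Q̄_{h,t}` between the Bellman update of
`Q̄_{h+1,t}` and this update plus twice the bonus. -/
theorem bellman_le_Qbar_le (hf : LinkRegular f κ K M₂) {h t : ℕ} (hh : h ∈ Icc 1 H) (ht : 1 ≤ t)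
    {ω : Ω} (hφ : ∀ s a, ‖φ s a‖ ≤ 1) (hγ : 0 ≤ γ) (hγΓ : γ ≤ Γ) (hO : OptimisticClosure M H φ f Γ)
    (hθ : ∀ h' ∈ Icc 1 H, ‖X.θ h' t ω‖ ≤ 1) {s : S} {a : A}
    (hconf : |clampLink f (inner ℝ (φ s a) (X.θ h t ω)) -
        M.bellman H h (X.Qbar φ f γ H (h + 1) t ω) s a| ≤
      γ * mahalanobis (X.Lam φ h t ω)⁻¹ (φ s a)) :
    M.bellman H h (X.Qbar φ f γ H (h + 1) t ω) s a ≤ X.Qbar φ f γ H h t ω s a ∧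
      X.Qbar φ f γ H h t ω s a ≤ M.bellman H h (X.Qbar φ f γ H (h + 1) t ω) s a +
        2 * (γ * mahalanobis (X.Lam φ h t ω)⁻¹ (φ s a)) := by
  obtain ⟨θb, -, hmodel⟩ := exists_bellman_model hh ht hγ hγΓ hφ hO
    (X := X) (t := t) (ω := ω) fun hH => hθ (h + 1) ⟨by omega, by omega⟩
  have h1 : M.bellman H h (X.Qbar φ f γ H (h + 1) t ω) s a ≤ 1 := by
    rw [hmodel]; exact (abs_le.1 (hf.abs_clampLink_le _)).2
  rw [abs_le] at hconf
  rw [Execution.Qbar_eq_upFun hh.2 ht hφ (hθ h hh), upFun]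
  constructor
  · exact le_min h1 (by linarith)
  · exact (min_le_right _ _).trans (by linarith)

theorem measurable_matrix_inv_entry (i j : Fin d) :
    Measurable fun w : Fin d → Fin d → ℝ => (Matrix.of w)⁻¹ i j := by
  have hc : Continuous fun w : Fin d → Fin d → ℝ => Matrix.of w :=
    continuous_matrix fun i j => (continuous_apply j).comp (continuous_apply i)
  have h1 : Measurable fun w : Fin d → Fin d → ℝ => (Matrix.of w).det := hc.matrix_det.measurable
  have h2 : Measurable fun w : Fin d → Fin d → ℝ => (Matrix.of w).adjugate i j :=
    (hc.matrix_adjugate.matrix_elem i j).measurable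
  simp only [Matrix.inv_def, Ring.inverse_eq_inv', Matrix.smul_apply, smul_eq_mul]
  exact h1.inv.mul h2

theorem Execution.measurable_Lam_inv (hφm : Measurable fun z : S × A => φ z.1 z.2) {h t : ℕ}
    (hh : h ∈ Icc 1 H) :
    Measurable[X.before H (t + 1)] fun ω => Matrix.of.symm (X.Lam φ h t ω)⁻¹ := by
  have hx : ∀ τ ∈ Finset.Icc 1 t, Measurable[X.before H (t + 1)] (X.x φ h τ) := fun τ hτ => by
    have hτ' := Finset.mem_Icc.1 hτ
    have h1 := X.measurable_before (t := t + 1) (Finset.mem_Ico.2 ⟨hτ'.1, by omega⟩)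
      (Finset.mem_Icc.2 hh)
    exact hφm.comp ((measurable_fst.comp h1).prodMk
      (measurable_fst.comp (measurable_snd.comp h1)))
  have hL : Measurable[X.before H (t + 1)]
      fun ω => (Matrix.of.symm (X.Lam φ h t ω) : Fin d → Fin d → ℝ) := by
    refine @measurable_pi_lambda _ _ _ (X.before H (t + 1)) _ _ fun i =>
      @measurable_pi_lambda _ _ _ (X.before H (t + 1)) _ _ fun j => ?_
    have e : (fun ω => (Matrix.of.symm (X.Lam φ h t ω) : Fin d → Fin d → ℝ) i j) = fun ω =>
        (∑ τ ∈ Finset.Icc 1 t, (X.x φ h τ ω).ofLp i * (X.x φ h τ ω).ofLp j) +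
          (1 : Matrix (Fin d) (Fin d) ℝ) i j := by
      funext ω
      simp [Execution.Lam, Matrix.sum_apply, Matrix.vecMulVec_apply]
    rw [e]
    refine Measurable.add (Finset.measurable_sum _ fun τ hτ => ?_) measurable_const
    have hc : Measurable fun x : Vec d => x.ofLp i * x.ofLp j := by fun_prop
    exact hc.comp (hx τ hτ)
  refine @measurable_pi_lambda _ _ _ (X.before H (t + 1)) _ _ fun i =>
    @measurable_pi_lambda _ _ _ (X.before H (t + 1)) _ _ fun j => ?_
  exact (measurable_matrix_inv_entry i j).comp hL

variable [Nonempty A]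

/-- The optimistic value of the initial state, minus the total reward of the episode, is at most
the sum of the bonuses and of the Bellman noise: telescope along the trajectory. -/
theorem maxQ_sub_totalReward_le [Finite A] {t : ℕ} {ω : Ω}
    (hconf : ∀ h ∈ Icc 1 H, ∀ s a, X.Qbar φ f γ H h t ω s a ≤
      M.bellman H h (X.Qbar φ f γ H (h + 1) t ω) s a +
        2 * (γ * mahalanobis (X.Lam φ h t ω)⁻¹ (φ s a)))
    (hgreedy : ∀ h ∈ Icc 1 H, ∀ a, X.Qbar φ f γ H h t ω (X.s h (t + 1) ω) a ≤
      X.Qbar φ f γ H h t ω (X.s h (t + 1) ω) (X.a h (t + 1) ω)) :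
    maxQ (X.Qbar φ f γ H 1 t ω) (X.s 1 (t + 1) ω) - X.totalReward H (t + 1) ω ≤
      ∑ h ∈ Finset.Icc 1 H,
        (2 * (γ * mahalanobis (X.Lam φ h t ω)⁻¹ (X.x φ h (t + 1) ω)) -
          X.noise M H h (t + 1) (maxQ (X.Qbar φ f γ H (h + 1) t ω)) ω) := by
  let v : ℕ → ℝ := fun h => maxQ (X.Qbar φ f γ H h t ω) (X.s h (t + 1) ω)
  have hlast : v (H + 1) = 0 := by
    simp only [v]
    rw [Execution.Qbar_of_lt (by omega), maxQ_zero]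
  have htel : ∑ h ∈ Finset.Icc 1 H, (v h - v (h + 1)) = v 1 := by
    rw [← Finset.Ico_add_one_right_eq_Icc]
    have h1 := Finset.sum_Ico_sub v (show 1 ≤ H + 1 by omega)
    rw [hlast] at h1
    have h2 : ∑ h ∈ Finset.Ico 1 (H + 1), (v h - v (h + 1)) =
        -∑ h ∈ Finset.Ico 1 (H + 1), (v (h + 1) - v h) := by
      rw [← Finset.sum_neg_distrib]
      exact Finset.sum_congr rfl fun h _ => by ring
    rw [h2, h1]
    ring
  have e : maxQ (X.Qbar φ f γ H 1 t ω) (X.s 1 (t + 1) ω) = v 1 := rfl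
  rw [e, ← htel, Execution.totalReward, ← Finset.sum_sub_distrib]
  refine Finset.sum_le_sum fun h hh => ?_
  have hh' := Finset.mem_Icc.1 hh
  have h1 : v h = X.Qbar φ f γ H h t ω (X.s h (t + 1) ω) (X.a h (t + 1) ω) :=
    maxQ_eq_of_greedy (hgreedy h hh')
  have h2 := hconf h hh' (X.s h (t + 1) ω) (X.a h (t + 1) ω)
  rw [MDP.bellman_eq] at h2
  have h3 : (if h < H then maxQ (X.Qbar φ f γ H (h + 1) t ω) (X.s (h + 1) (t + 1) ω) else 0) =
      v (h + 1) := by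
    split_ifs with hH
    · rfl
    · rw [show h = H by omega, hlast]
  rw [Execution.noise, h3, h1, Execution.x]
  linarith

/-- The regret at a sample point where all confidence bounds hold and the martingale terms are
bounded by `a`, `b` and `c`. The first episode, whose policy is arbitrary, contributes at most `1`. -/
theorem regret_le_of_confidence [Finite A] [MeasurableSpace Ω] {P : Measure Ω} {ω : Ω} {a b c : ℝ}
    (hd : 1 ≤ d) (hT : 1 ≤ T) (hγ : 0 ≤ γ) (hφ : ∀ s a, ‖φ s a‖ ≤ 1) (hV : M.optValue H ≤ 1)
    (hR : 0 ≤ (P[X.totalReward H 1 | X.before H 1]) ω)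
    (hopt : ∀ i < T - 1,
      M.optValue H ≤ ∫ s, maxQ (X.Qbar φ f γ H 1 (i + 1) ω) s ∂M.init)
    (hconf : ∀ i < T - 1, ∀ h ∈ Icc 1 H, ∀ s a, X.Qbar φ f γ H h (i + 1) ω s a ≤
      M.bellman H h (X.Qbar φ f γ H (h + 1) (i + 1) ω) s a +
        2 * (γ * mahalanobis (X.Lam φ h (i + 1) ω)⁻¹ (φ s a)))
    (hgreedy : ∀ i < T - 1, ∀ h ∈ Icc 1 H, ∀ a,
      X.Qbar φ f γ H h (i + 1) ω (X.s h (i + 2) ω) a ≤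
      X.Qbar φ f γ H h (i + 1) ω (X.s h (i + 2) ω) (X.a h (i + 2) ω))
    (ha : ∑ i ∈ Finset.range (T - 1),
      X.initNoise M (i + 2) (maxQ (X.Qbar φ f γ H 1 (i + 1) ω)) ω ≤ a)
    (hb : ∑ i ∈ Finset.range (T - 1), (X.totalReward H (i + 2) ω -
      (P[X.totalReward H (i + 2) | X.before H (i + 2)]) ω) ≤ b)
    (hc : ∀ h ∈ Icc 1 H, ∑ i ∈ Finset.range (T - 1),
      -X.noise M H h (i + 2) (maxQ (X.Qbar φ f γ H (h + 1) (i + 1) ω)) ω ≤ c) :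
    regret P M H T X ω ≤ 1 + a + b + H * c + H * (2 * (γ * √(2 * (T * d * Real.log (1 + T / d))))) := by
  let E : ℕ → ℝ := fun t => (P[X.totalReward H t | X.before H t]) ω
  let N : ℕ → ℕ → ℝ := fun h i =>
    -X.noise M H h (i + 2) (maxQ (X.Qbar φ f γ H (h + 1) (i + 1) ω)) ω
  let B : ℕ → ℕ → ℝ := fun h i => mahalanobis (X.Lam φ h (i + 1) ω)⁻¹ (X.x φ h (i + 2) ω)
  have hreg : regret P M H T X ω =
      (M.optValue H - E 1) + ∑ i ∈ Finset.range (T - 1), (M.optValue H - E (i + 2)) := by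
    have h1 : regret P M H T X ω = T * M.optValue H - ∑ t ∈ Finset.Icc 1 T, E t := rfl
    have h2 : (T : ℝ) * M.optValue H - ∑ t ∈ Finset.Icc 1 T, E t =
        ∑ t ∈ Finset.Icc 1 T, (M.optValue H - E t) := by
      rw [Finset.sum_sub_distrib]; simp
    rw [h1, h2, ← Finset.Ico_add_one_right_eq_Icc, Finset.sum_Ico_eq_sum_range]
    obtain ⟨n, rfl⟩ : ∃ n, T = n + 1 := ⟨T - 1, by omega⟩
    simp only [Nat.add_sub_cancel, Finset.sum_range_succ']
    rw [add_comm]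
    congr 1
    refine Finset.sum_congr rfl fun i _ => ?_
    rw [show 1 + (i + 1) = i + 2 by ring]
  have hterm : ∀ i ∈ Finset.range (T - 1), M.optValue H - E (i + 2) ≤
      X.initNoise M (i + 2) (maxQ (X.Qbar φ f γ H 1 (i + 1) ω)) ω +
        (X.totalReward H (i + 2) ω - E (i + 2)) +
        ∑ h ∈ Finset.Icc 1 H, (2 * (γ * B h i) + N h i) := by
    intro i hi
    have hi' := Finset.mem_range.1 hi
    have h1 := hopt i hi'
    have h2 := maxQ_sub_totalReward_le (hconf i hi') (hgreedy i hi')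
    have h3 : X.initNoise M (i + 2) (maxQ (X.Qbar φ f γ H 1 (i + 1) ω)) ω =
        ∫ s, maxQ (X.Qbar φ f γ H 1 (i + 1) ω) s ∂M.init -
          maxQ (X.Qbar φ f γ H 1 (i + 1) ω) (X.s 1 (i + 2) ω) := rfl
    have h4 : ∑ h ∈ Finset.Icc 1 H, (2 * (γ * B h i) + N h i) =
        ∑ h ∈ Finset.Icc 1 H,
        (2 * (γ * mahalanobis (X.Lam φ h (i + 1) ω)⁻¹ (X.x φ h (i + 1 + 1) ω)) -
          X.noise M H h (i + 1 + 1) (maxQ (X.Qbar φ f γ H (h + 1) (i + 1) ω)) ω) :=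
      Finset.sum_congr rfl fun h _ => (sub_eq_add_neg _ _).symm
    rw [h3, h4]
    linarith
  have hB : ∀ h, ∑ i ∈ Finset.range (T - 1), B h i ≤ √(2 * (T * d * Real.log (1 + T / d))) := by
    intro h
    refine le_trans ?_ (sum_mahalanobis_le hd (fun τ => X.x φ h τ ω) (fun τ => hφ _ _) T)
    obtain ⟨n, rfl⟩ : ∃ n, T = n + 1 := ⟨T - 1, by omega⟩
    rw [Nat.add_sub_cancel, Finset.sum_range_succ']
    exact le_add_of_nonneg_right (mahalanobis_nonneg _ _)
  have hsum := Finset.sum_le_sum hterm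
  rw [Finset.sum_add_distrib, Finset.sum_add_distrib, Finset.sum_comm] at hsum
  have hh : ∑ h ∈ Finset.Icc 1 H, ∑ i ∈ Finset.range (T - 1), (2 * (γ * B h i) + N h i) ≤
      ∑ h ∈ Finset.Icc 1 H, (2 * (γ * √(2 * (T * d * Real.log (1 + T / d)))) + c) := by
    refine Finset.sum_le_sum fun h hh => ?_
    rw [Finset.sum_add_distrib, ← Finset.mul_sum, ← Finset.mul_sum]
    exact add_le_add (mul_le_mul_of_nonneg_left (mul_le_mul_of_nonneg_left (hB h) hγ) zero_le_two)
      (hc h (Finset.mem_Icc.1 hh))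
  rw [Finset.sum_const, Nat.card_Icc, Nat.add_sub_cancel, nsmul_eq_mul, mul_add] at hh
  rw [hreg]
  linarith

end Decomposition

/-! ### The high-probability event -/

section Event

theorem IsNoise.congr {Ω : Type*} {m0 : MeasurableSpace Ω} {P : Measure Ω}
    {m : ℕ → MeasurableSpace Ω} {n : ℕ} {c : ℝ} {ξ ξ' : ℕ → Ω → ℝ} (h : IsNoise P m n c ξ)
    (he : ∀ i < n, ξ i = ξ' i) : IsNoise P m n c ξ' where
  le := h.le
  measurable i hi := he i hi ▸ h.measurable i hi
  past i hi j hj := he j (hj.trans hi) ▸ h.past i hi j hj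
  bound i hi := he i hi ▸ h.bound i hi
  centered i hi := he i hi ▸ h.centered i hi

theorem one_sub_le_measureReal {Ω : Type*} [MeasurableSpace Ω] {P : Measure Ω}
    [IsProbabilityMeasure P] {p : Ω → Prop} {bad : Set Ω} (h : ∀ᵐ ω ∂P, ω ∉ bad → p ω) {δ : ℝ}
    (hδ : P.real bad ≤ δ) : 1 - δ ≤ P.real {ω | p ω} := by
  have h1 : P.real univ ≤ P.real (bad ∪ {ω | p ω}) := by
    refine ENNReal.toReal_mono (measure_ne_top _ _) (measure_mono_ae ?_)
    filter_upwards [h] with ω hω _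
    by_cases hb : ω ∈ bad
    · exact Or.inl hb
    · exact Or.inr (hω hb)
  have h2 := measureReal_union_le (μ := P) bad {ω | p ω}
  rw [probReal_univ] at h1
  linarith

variable {Ω : Type w} {S : Type u} {A : Type v} {d : ℕ} [MeasurableSpace Ω]
  [MeasurableSpace S] [MeasurableSpace A] {P : Measure Ω} {M : MDP S A} {H T : ℕ}
  {φ : S → A → Vec d} {f : ℝ → ℝ} {κ K M₂ γ Γ : ℝ} {X : Execution Ω S A d}

namespace IsLSVIUCB

/-- The data that determine `Q̄_{h,t}` are known after episode `t`. -/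
theorem measurable_params (hX : IsLSVIUCB P M H T φ f γ X)
    (hφm : Measurable fun z : S × A => φ z.1 z.2) {h t : ℕ} (hh : h ∈ Icc 1 H) (ht : t ∈ Icc 1 T) :
    Measurable[X.before H (t + 1)] fun ω => (X.θ h t ω, Matrix.of.symm (X.Lam φ h t ω)⁻¹) :=
  (hX.measurable_est t ht h hh).prodMk (Execution.measurable_Lam_inv hφm hh)

variable [IsProbabilityMeasure P] [Finite A] [Nonempty A]

theorem isNoise_initNoise_Qbar (hX : IsLSVIUCB P M H T φ f γ X) (hT : 1 ≤ T) (hH : 1 ≤ H)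
    (hf : LinkRegular f κ K M₂) (hφm : Measurable fun z : S × A => φ z.1 z.2)
    (hφ : ∀ s a, ‖φ s a‖ ≤ 1) (hγ : 0 ≤ γ) :
    IsNoise P (fun i => X.before H (i + 2)) (T - 1) 2
      (fun i ω => X.initNoise M (i + 2) (maxQ (X.Qbar φ f γ H 1 (i + 1) ω)) ω) := by
  refine (hX.isNoise_initNoise hH (k := 2) (n := T - 1) (by norm_num) (by omega)
    (Z := fun t ω => (X.θ 1 (t - 1) ω, Matrix.of.symm (X.Lam φ 1 (t - 1) ω)⁻¹))
    (fun i hi => hX.measurable_params hφm ⟨le_rfl, hH⟩ ⟨by omega, by omega⟩)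
    (measurable_maxQ_upFun (γ := γ) hf hφm)
    (fun z => abs_maxQ_le fun a => abs_upFun_le hf hγ _ _ _ _)).congr fun i hi => ?_
  funext ω
  rw [Execution.Qbar_eq_upFun hH (by omega) hφ
    (hX.est_mem (i + 1) ⟨by omega, by omega⟩ 1 ⟨le_rfl, hH⟩ ω)]
  rfl

theorem isNoise_noise_Qbar (hX : IsLSVIUCB P M H T φ f γ X) (hT : 1 ≤ T) {h : ℕ} (hh : h ∈ Icc 1 H)
    (hf : LinkRegular f κ K M₂) (hφm : Measurable fun z : S × A => φ z.1 z.2)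
    (hφ : ∀ s a, ‖φ s a‖ ≤ 1) (hγ : 0 ≤ γ) :
    IsNoise P (fun i => X.historySA H h (i + 2)) (T - 1) 3
      (fun i ω => X.noise M H h (i + 2) (maxQ (X.Qbar φ f γ H (h + 1) (i + 1) ω)) ω) := by
  by_cases hH : h < H
  · have hh1 : h + 1 ∈ Icc 1 H := ⟨by omega, by omega⟩
    refine (hX.isNoise_noise hh (k := 2) (n := T - 1) (by norm_num) (by omega)
      (Z := fun t ω => (X.θ (h + 1) (t - 1) ω, Matrix.of.symm (X.Lam φ (h + 1) (t - 1) ω)⁻¹))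
      (fun i hi => (hX.measurable_params hφm hh1 ⟨by omega, by omega⟩).mono
        (X.before_le_historySA H h (i + 2)) le_rfl)
      (measurable_maxQ_upFun (γ := γ) hf hφm)
      (fun z => abs_maxQ_le fun a => abs_upFun_le hf hγ _ _ _ _)).congr fun i hi => ?_
    funext ω
    rw [Execution.Qbar_eq_upFun hh1.2 (by omega) hφ
      (hX.est_mem (i + 1) ⟨by omega, by omega⟩ (h + 1) hh1 ω)]
    rfl
  · refine (hX.isNoise_noise hh (k := 2) (n := T - 1) (by norm_num) (by omega)
      (Z := fun _ _ => ()) (fun i hi => measurable_const) (G := fun _ => 0) measurable_const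
      (by simp)).congr fun i hi => ?_
    funext ω
    exact Execution.noise_congr (fun h' => absurd h' hH) ω

theorem measureReal_regressionStat_le (hX : IsLSVIUCB P M H T φ f γ X) {h t : ℕ} (hh : h ∈ Icc 1 H)
    (ht : t ∈ Icc 1 T) (hf : LinkRegular f κ K M₂) (hφm : Measurable fun z : S × A => φ z.1 z.2)
    (hγ : 0 ≤ γ) (θ : Vec d) (B : Matrix (Fin d) (Fin d) ℝ) (θ₁ θ₂ : Vec d) (ℓ : ℝ) :
    P.real {ω | ℓ ≤ regressionStat M H φ f γ X h t θ B θ₁ θ₂ ω} ≤ Real.exp (-ℓ) := by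
  have hG : Measurable fun z : Unit × S => maxQ (upFun φ f γ θ B) z.2 :=
    (measurable_maxQ_upFun_fixed hf hφm θ B).comp measurable_snd
  have hn := hX.isNoise_noise hh (k := 1) (n := t) le_rfl (by have := ht.2; omega)
    (Z := fun _ _ => ()) (fun i hi => measurable_const) hG
    (fun z => abs_maxQ_le fun a => abs_upFun_le hf hγ _ _ _ _)
  refine hn.tail_bound (b := 1) (D := fun i ω => (clampLink f (inner ℝ (X.x φ h (i + 1) ω) θ₁) -
        clampLink f (inner ℝ (X.x φ h (i + 1) ω) θ₂)) / 18) (by norm_num) ?_ ?_ ℓ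
  · intro i hi j hj
    have hle : X.historySA H h (j + 1) ≤ X.historySA H h (i + 1) := by
      rcases hj.eq_or_lt with rfl | hlt
      · exact le_rfl
      · exact (X.historySA_le_before_succ (Finset.mem_Icc.2 hh) (by omega)).trans
          ((X.before_mono H (by omega)).trans (X.before_le_historySA H h (i + 1)))
    have hx : Measurable[X.historySA H h (i + 1)] (X.x φ h (j + 1)) :=
      (hφm.comp (X.measurable_historySA H h (j + 1))).mono hle le_rfl
    have hc : Measurable fun x : Vec d =>
        (clampLink f (inner ℝ x θ₁) - clampLink f (inner ℝ x θ₂)) / 18 := by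
      have := hf.continuous_clampLink.measurable
      fun_prop
    exact hc.comp hx
  · intro i hi ω
    have h1 := abs_le.1 (hf.abs_clampLink_le (inner ℝ (X.x φ h (i + 1) ω) θ₁))
    have h2 := abs_le.1 (hf.abs_clampLink_le (inner ℝ (X.x φ h (i + 1) ω) θ₂))
    rw [abs_le]
    constructor <;> linarith

/-- The regret bound, given nets of mesh `ε` and a confidence level `ℓ`. -/
theorem measureReal_regret_le (hX : IsLSVIUCB P M H T φ f γ X) (hd : 1 ≤ d) (hH : 1 ≤ H)
    (hT : 1 ≤ T) (hN : M.Normalized H)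
    (hf : LinkRegular f κ K M₂) (hγ : 0 ≤ γ) (hγΓ : γ ≤ Γ)
    (hφm : Measurable fun z : S × A => φ z.1 z.2) (hφ : ∀ s a, ‖φ s a‖ ≤ 1)
    (hO : OptimisticClosure M H φ f Γ) {ε ℓ : ℝ}
    (hε1 : 16 * T * (K * (d * ε)) ≤ 1) (hε2 : 16 * T * (γ * (d * √ε)) ≤ 1)
    (hℓ : 0 < ℓ) (hγℓ : K * κ⁻¹ * √(72 * ℓ + 8) ≤ γ)
    {N₁ : Finset (Vec d)} {N₂ : Finset (Matrix (Fin d) (Fin d) ℝ)}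
    (hN₁ : ∀ θ : Vec d, ‖θ‖ ≤ 1 → ∃ q ∈ N₁, ∀ i, |θ.ofLp i - q.ofLp i| ≤ ε)
    (hN₂ : ∀ B : Matrix (Fin d) (Fin d) ℝ, (∀ i j, |B i j| ≤ 1) →
      ∃ q ∈ N₂, ∀ i j, |B i j - q i j| ≤ ε) :
    1 - (H * T * (N₁.card ^ 3 * N₂.card) + 2 + H) * Real.exp (-ℓ) ≤
      P.real {ω | regret P M H T X ω ≤ 1 + 6 * H * √(2 * T * ℓ) +
        H * (2 * (γ * √(2 * (T * d * Real.log (1 + T / d)))))} := by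
  set q : ℝ := √(2 * ((T - 1 : ℕ) : ℝ) * ℓ) with hq
  have hqT : q ≤ √(2 * T * ℓ) := Real.sqrt_le_sqrt (by
    have : ((T - 1 : ℕ) : ℝ) ≤ T := by exact_mod_cast Nat.sub_le T 1
    nlinarith)
  let I := (Finset.Icc 1 H ×ˢ Finset.Icc 1 T) ×ˢ (N₁ ×ˢ N₂ ×ˢ N₁ ×ˢ N₁)
  let bad₁ : Set Ω := ⋃ j ∈ I,
    {ω | ℓ ≤ regressionStat M H φ f γ X j.1.1 j.1.2 j.2.1 j.2.2.1 j.2.2.2.1 j.2.2.2.2 ω}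
  let bad₂ : Set Ω := {ω | 2 * q < ∑ i ∈ Finset.range (T - 1),
    X.initNoise M (i + 2) (maxQ (X.Qbar φ f γ H 1 (i + 1) ω)) ω}
  let bad₃ : Set Ω := {ω | H * q < ∑ i ∈ Finset.range (T - 1), (X.totalReward H (i + 2) ω -
      (P[X.totalReward H (i + 2) | X.before H (i + 2)]) ω)}
  let bad₄ : Set Ω := ⋃ h ∈ Finset.Icc 1 H, {ω | 3 * q < ∑ i ∈ Finset.range (T - 1),
      -X.noise M H h (i + 2) (maxQ (X.Qbar φ f γ H (h + 1) (i + 1) ω)) ω}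
  have hb₁ : P.real bad₁ ≤ H * T * (N₁.card ^ 3 * N₂.card) * Real.exp (-ℓ) := by
    refine (measureReal_biUnion_finset_le _ _).trans ((Finset.sum_le_card_nsmul _ _
      (Real.exp (-ℓ)) fun j hj => ?_).trans (le_of_eq ?_))
    · have h1 := Finset.mem_product.1 (Finset.mem_product.1 hj).1
      exact hX.measureReal_regressionStat_le (Finset.mem_Icc.1 h1.1) (Finset.mem_Icc.1 h1.2)
        hf hφm hγ _ _ _ _ ℓ
    · simp only [I, Finset.card_product, Nat.card_Icc, Nat.add_sub_cancel, nsmul_eq_mul]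
      push_cast
      ring
  have hb₂ : P.real bad₂ ≤ Real.exp (-ℓ) :=
    (hX.isNoise_initNoise_Qbar hT hH hf hφm hφ hγ).azuma (by norm_num) hℓ
  have hb₃ : P.real bad₃ ≤ Real.exp (-ℓ) :=
    (hX.isNoise_totalReward (k := 2) (n := T - 1) (by norm_num) (by omega)).azuma
      (by exact_mod_cast hH) hℓ
  have hb₄ : P.real bad₄ ≤ H * Real.exp (-ℓ) := by
    refine (measureReal_biUnion_finset_le _ _).trans ((Finset.sum_le_card_nsmul _ _
      (Real.exp (-ℓ)) fun h hh => ?_).trans (le_of_eq (by simp)))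
    exact (hX.isNoise_noise_Qbar hT (Finset.mem_Icc.1 hh) hf hφm hφ hγ).neg.azuma (by norm_num) hℓ
  refine one_sub_le_measureReal (bad := bad₁ ∪ bad₂ ∪ (bad₃ ∪ bad₄)) ?_ ?_
  · have hR := hX.condExp_totalReward_mem (t := 1) ⟨le_rfl, hT⟩
    have hnoise : ∀ᵐ ω ∂P, ∀ h ∈ Finset.Icc 1 H, ∀ t ∈ Finset.Icc 1 T, ∀ V : S → ℝ,
        (∀ s, |V s| ≤ 1) → |X.noise M H h t V ω| ≤ 3 :=
      (Finset.eventually_all _).2 fun h hh => (Finset.eventually_all _).2 fun t ht =>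
        hX.ae_abs_noise_le (Finset.mem_Icc.1 hh) (Finset.mem_Icc.1 ht)
    filter_upwards [hR, hnoise] with ω hRω hnω hω
    have hω₁ : ω ∉ bad₁ := fun h => hω (Or.inl (Or.inl h))
    have hω₂ : ω ∉ bad₂ := fun h => hω (Or.inl (Or.inr h))
    have hω₃ : ω ∉ bad₃ := fun h => hω (Or.inr (Or.inl h))
    have hω₄ : ω ∉ bad₄ := fun h => hω (Or.inr (Or.inr h))
    have hθ : ∀ t ∈ Icc 1 T, ∀ h ∈ Icc 1 H, ‖X.θ h t ω‖ ≤ 1 := fun t ht h hh =>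
      hX.est_mem t ht h hh ω
    have hsand : ∀ i < T - 1, ∀ h ∈ Icc 1 H, ∀ s a,
        M.bellman H h (X.Qbar φ f γ H (h + 1) (i + 1) ω) s a ≤ X.Qbar φ f γ H h (i + 1) ω s a ∧
        X.Qbar φ f γ H h (i + 1) ω s a ≤ M.bellman H h (X.Qbar φ f γ H (h + 1) (i + 1) ω) s a +
          2 * (γ * mahalanobis (X.Lam φ h (i + 1) ω)⁻¹ (φ s a)) := fun i hi h hh s a => by
      have ht : i + 1 ∈ Icc 1 T := ⟨by omega, by omega⟩
      refine bellman_le_Qbar_le hf hh ht.1 hφ hγ hγΓ hO (hθ _ ht) (s := s) (a := a) ?_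
      refine abs_clampLink_sub_le_bonus hf hγ hγΓ hφm hφ hO hε1 hε2 hγℓ hN₁ hN₂ hh ht (hθ _ ht)
        (hX.est_min (i + 1) ht h hh ω)
        (fun τ hτ => hnω h (Finset.mem_Icc.2 hh) τ (Finset.mem_Icc.2 hτ)) ?_ s a
      intro θ hθm B hB θ₁ hθ₁ θ₂ hθ₂
      by_contra hcon
      refine hω₁ (mem_biUnion (x := ((h, i + 1), (θ, B, θ₁, θ₂))) ?_ (not_le.1 hcon).le)
      simp only [I, Finset.coe_product, mem_prod, Finset.mem_coe, Finset.mem_Icc]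
      exact ⟨⟨hh, ht⟩, hθm, hB, hθ₁, hθ₂⟩
    have hdet := regret_le_of_confidence (a := 2 * q) (b := H * q) (c := 3 * q) hd hT hγ hφ
      (M.optValue_le (M.value_le_one hN)) hRω.1 ?_ (fun i hi h hh s a => (hsand i hi h hh s a).2)
      ?_ (not_lt.1 hω₂) (not_lt.1 hω₃) ?_
    · have hH' : (1 : ℝ) ≤ H := by exact_mod_cast hH
      have h6 : 2 * q + H * q + H * (3 * q) ≤ 6 * H * √(2 * T * ℓ) := by
        have hq0 : 0 ≤ q := Real.sqrt_nonneg _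
        nlinarith
      linarith
    · intro i hi
      have ht : i + 1 ∈ Icc 1 T := ⟨by omega, by omega⟩
      have hQ : ∀ h, 1 ≤ h → h ≤ H →
          X.Qbar φ f γ H h (i + 1) ω = upFun φ f γ (X.θ h (i + 1) ω) (X.Lam φ h (i + 1) ω)⁻¹ :=
        fun h h1 h2 => Execution.Qbar_eq_upFun h2 (by omega) hφ (hθ _ ht h ⟨h1, h2⟩)
      refine M.optValue_le fun π => M.value_le_of_bellman_le hH
        (fun h => X.Qbar φ f γ H h (i + 1) ω) ?_ ?_ ?_ π
      · intro h h1 h2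
        simp only [hQ h h1 h2]
        exact measurable_maxQ_upFun_fixed hf hφm _ _
      · intro h h1 h2 s
        simp only [hQ h h1 h2]
        exact abs_maxQ_le fun a => abs_upFun_le hf hγ _ _ _ _
      · exact fun h h1 h2 s a => (hsand i hi h ⟨h1, h2⟩ s a).1
    · intro i hi h hh a
      have ht : i + 2 ∈ Icc 1 T := ⟨by omega, by omega⟩
      rw [hX.action (i + 2) ht h hh ω]
      exact hX.greedy (i + 2) ht h hh ω _ a
    · intro h hh
      by_contra hcon
      exact hω₄ (mem_biUnion (x := h) (Finset.mem_coe.2 (Finset.mem_Icc.2 hh)) (not_le.1 hcon))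
  · have h1 := measureReal_union_le (μ := P) (bad₁ ∪ bad₂) (bad₃ ∪ bad₄)
    have h2 := measureReal_union_le (μ := P) bad₁ bad₂
    have h3 := measureReal_union_le (μ := P) bad₃ bad₄
    linarith

end IsLSVIUCB

end Event

/-! ### Choice of the nets -/

section Core

theorem half_le_elliptical {d T : ℕ} (hd : 1 ≤ d) (hT : 1 ≤ T) :
    (T : ℝ) / 2 ≤ T * d * Real.log (1 + T / d) := by
  have hd' : (1 : ℝ) ≤ d := by exact_mod_cast hd
  have hT' : (1 : ℝ) ≤ T := by exact_mod_cast hT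
  have h1 := Real.one_sub_inv_le_log_of_pos (show (0 : ℝ) < 1 + T / d by positivity)
  have h2 : 1 - (1 + (T : ℝ) / d)⁻¹ = T / (d + T) := by field_simp; ring
  have h3 : (1 : ℝ) / 2 ≤ d * (T / (d + T)) := by
    rw [mul_div_assoc', le_div_iff₀ (by positivity)]
    nlinarith
  rw [h2] at h1
  have h4 : (1 : ℝ) / 2 ≤ d * Real.log (1 + T / d) :=
    h3.trans (mul_le_mul_of_nonneg_left h1 (by positivity))
  nlinarith

theorem log_mul_pow_le {W a b : ℝ} {d : ℕ} (hW : 1 ≤ W) (ha : 0 < a) (haW : a ≤ W ^ 4) (hb : 0 < b)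
    (hbW : b ≤ W ^ 16) (hd : 1 ≤ d) :
    Real.log (a * b ^ (4 * d ^ 2)) ≤ 68 * ((d : ℝ) ^ 2 * Real.log W) := by
  have hd' : (1 : ℝ) ≤ d := by exact_mod_cast hd
  have hd2 : (1 : ℝ) ≤ (d : ℝ) ^ 2 := one_le_pow₀ hd'
  have hlog : 0 ≤ Real.log W := Real.log_nonneg hW
  have l1 := Real.log_le_log ha haW
  have l2 := Real.log_le_log hb hbW
  rw [Real.log_pow] at l1 l2
  rw [Real.log_mul ha.ne' (pow_pos hb _).ne', Real.log_pow]
  push_cast at l1 l2 ⊢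
  have h1 := mul_le_mul_of_nonneg_left l2 (by positivity : (0 : ℝ) ≤ 4 * (d : ℝ) ^ 2)
  nlinarith

theorem mesh_le_pow {w T H m : ℝ} (hw : 1 ≤ w) (hT : 1 ≤ T) (hH : 1 ≤ H) (hTH : 2 ≤ T * H)
    (hm : 1 ≤ m) (hm2 : m ≤ 17 * w * T ^ 2) :
    1 ≤ w * T * H ∧ 4 * (T * H) ^ 2 ≤ (w * T * H) ^ 4 ∧ 2 * m ^ 2 + 1 ≤ (w * T * H) ^ 16 := by
  have hwTW : w * T ^ 2 ≤ (w * T * H) ^ 2 := by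
    calc w * T ^ 2 = w * 1 * T ^ 2 * 1 := by ring
      _ ≤ w * w * T ^ 2 * H ^ 2 := by gcongr; exact one_le_pow₀ hH
      _ = (w * T * H) ^ 2 := by ring
  have hTW : T * H ≤ w * T * H := by
    rw [mul_assoc]
    exact le_mul_of_one_le_left (by linarith) hw
  generalize w * T * H = W at hwTW hTW ⊢
  have hW2 : 2 ≤ W := by linarith
  have h4 : 4 ≤ W ^ 2 := by nlinarith
  have hW0 : 0 ≤ W := by linarith
  have hmW : m ≤ W ^ 5 * W ^ 2 := by
    have h32 : (2 : ℝ) ^ 5 ≤ W ^ 5 := pow_le_pow_left₀ zero_le_two hW2 5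
    calc m ≤ 17 * (w * T ^ 2) := by linarith
      _ ≤ W ^ 5 * W ^ 2 := mul_le_mul (by linarith) hwTW (by positivity) (by positivity)
  refine ⟨by linarith, ?_, ?_⟩
  · calc 4 * (T * H) ^ 2 ≤ W ^ 2 * W ^ 2 :=
          mul_le_mul h4 (pow_le_pow_left₀ (by linarith) hTW 2) (by positivity) (by positivity)
      _ = W ^ 4 := by ring
  · calc 2 * m ^ 2 + 1 ≤ 4 * m ^ 2 := by nlinarith
      _ ≤ W ^ 2 * (W ^ 5 * W ^ 2) ^ 2 :=
          mul_le_mul h4 (pow_le_pow_left₀ (by linarith) hmW 2) (by positivity) (by positivity)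
      _ = W ^ 16 := by ring

/-- A net of mesh `1 / m²`, whose confidence level `ℓ` has the order of `d² ln((1 + K + Γ) T H)`. -/
theorem exists_mesh {d H T : ℕ} {K γ Γ : ℝ} (hd : 1 ≤ d) (hdT : d ≤ T) (hTH : 2 ≤ T * H)
    (hK : 0 < K) (hγ : 0 ≤ γ) (hγΓ : γ ≤ Γ) :
    ∃ n : ℕ, 1 ≤ n ∧ 16 * T * (K * (d * (1 / (n : ℝ)))) ≤ 1 ∧
      16 * T * (γ * (d * √(1 / (n : ℝ)))) ≤ 1 ∧
      Real.log (4 * (T * H) ^ 2 * (2 * n + 1 : ℝ) ^ (4 * d ^ 2)) ≤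
        68 * ((d : ℝ) ^ 2 * Real.log ((1 + K + Γ) * T * H)) := by
  have hΓ : 0 ≤ Γ := hγ.trans hγΓ
  have hH : 1 ≤ H := Nat.pos_of_ne_zero fun h => by simp [h] at hTH
  have hT : 1 ≤ T := hd.trans hdT
  have hd' : (1 : ℝ) ≤ d := by exact_mod_cast hd
  have hT' : (1 : ℝ) ≤ T := by exact_mod_cast hT
  have hH' : (1 : ℝ) ≤ H := by exact_mod_cast hH
  have hdT' : (d : ℝ) ≤ T := by exact_mod_cast hdT
  have hTH' : (2 : ℝ) ≤ T * H := by exact_mod_cast hTH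
  set w : ℝ := 1 + K + Γ with hw
  have hw1 : 1 ≤ w := by linarith
  set m : ℕ := ⌈16 * w * T ^ 2⌉₊ with hm
  have hm1 : 16 * w * T ^ 2 ≤ m := Nat.le_ceil _
  have hm2 : (m : ℝ) ≤ 17 * w * T ^ 2 := by
    have h1 := Nat.ceil_lt_add_one (show 0 ≤ 16 * w * (T : ℝ) ^ 2 by positivity)
    have h2 : 1 ≤ w * (T : ℝ) ^ 2 := by nlinarith [mul_le_mul hw1 hT' zero_le_one (by linarith)]
    rw [← hm] at h1
    linarith
  have hwT : 1 ≤ w * (T : ℝ) ^ 2 := by nlinarith [mul_le_mul hw1 hT' zero_le_one (by linarith)]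
  have hmpos : (1 : ℝ) ≤ m := by linarith
  have hmpos' : (0 : ℝ) < m := by linarith
  refine ⟨m ^ 2, Nat.one_le_pow _ _ (by exact_mod_cast hmpos'), ?_, ?_, ?_⟩
  · push_cast
    have h1 : 16 * T * (K * (d * (1 / (m : ℝ) ^ 2))) = 16 * T * K * d / m ^ 2 := by ring
    rw [h1, div_le_one (by positivity)]
    calc 16 * T * K * d ≤ 16 * T * w * T := by gcongr; linarith
      _ = 16 * w * T ^ 2 := by ring
      _ ≤ m := hm1
      _ ≤ (m : ℝ) ^ 2 := by nlinarith
  · push_cast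
    have h0 : √(1 / (m : ℝ) ^ 2) = 1 / m := by
      rw [← one_div_pow, Real.sqrt_sq (by positivity)]
    have h1 : 16 * T * (γ * (d * (1 / (m : ℝ)))) = 16 * T * γ * d / m := by ring
    rw [h0, h1, div_le_one hmpos']
    calc 16 * T * γ * d ≤ 16 * T * w * T := by gcongr; linarith
      _ = 16 * w * T ^ 2 := by ring
      _ ≤ m := hm1
  · obtain ⟨h1, h2, h3⟩ := mesh_le_pow hw1 hT' hH' hTH' hmpos hm2
    push_cast
    exact log_mul_pow_le h1 (by positivity) h2 (by positivity) h3 hd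

/-- Nets of mesh `1 / n` for the unit ball and for the matrices with entries in `[-1,1]`. -/
theorem exists_parameter_nets {d : ℕ} (hd : 1 ≤ d) {n : ℕ} (hn : 1 ≤ n) :
    ∃ (N₁ : Finset (Vec d)) (N₂ : Finset (Matrix (Fin d) (Fin d) ℝ)),
      (∀ θ : Vec d, ‖θ‖ ≤ 1 → ∃ q ∈ N₁, ∀ i, |θ.ofLp i - q.ofLp i| ≤ 1 / (n : ℝ)) ∧
      (∀ B : Matrix (Fin d) (Fin d) ℝ, (∀ i j, |B i j| ≤ 1) →
        ∃ q ∈ N₂, ∀ i j, |B i j - q i j| ≤ 1 / (n : ℝ)) ∧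
      (N₁.card : ℝ) ^ 3 * N₂.card ≤ (2 * n + 1 : ℝ) ^ (4 * d ^ 2) := by
  obtain ⟨N₁, hN₁c, hN₁⟩ := exists_net {θ : Vec d | ‖θ‖ ≤ 1} (fun θ i => θ.ofLp i)
    (fun θ hθ i => (abs_coord_le_norm θ i).trans hθ) hn
  obtain ⟨N₂, hN₂c, hN₂⟩ := exists_net {B : Matrix (Fin d) (Fin d) ℝ | ∀ i j, |B i j| ≤ 1}
    (fun B (ij : Fin d × Fin d) => B ij.1 ij.2) (fun B hB ij => hB _ _) hn
  rw [Fintype.card_fin] at hN₁c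
  rw [Fintype.card_prod, Fintype.card_fin] at hN₂c
  refine ⟨N₁, N₂, hN₁, fun B hB => (hN₂ B hB).imp fun q hq => ⟨hq.1, fun i j => hq.2 (i, j)⟩, ?_⟩
  have h1 : N₁.card ^ 3 * N₂.card ≤ (2 * n + 1) ^ (4 * d ^ 2) := by
    calc N₁.card ^ 3 * N₂.card ≤ ((2 * n + 1) ^ d) ^ 3 * (2 * n + 1) ^ (d * d) :=
          Nat.mul_le_mul (Nat.pow_le_pow_left hN₁c 3) hN₂c
      _ = (2 * n + 1) ^ (d * 3 + d * d) := by rw [← pow_mul, ← pow_add]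
      _ ≤ (2 * n + 1) ^ (4 * d ^ 2) := Nat.pow_le_pow_right (by omega) (by nlinarith)
  exact_mod_cast h1

theorem count_mul_exp_le {H T N c ℓ : ℝ} (hH : 1 ≤ H) (hTH : 1 ≤ T * H) (hT : 1 ≤ T) (hN : 1 ≤ N)
    (hc : c ≤ N) (hℓ : ℓ = Real.log (4 * (T * H) ^ 2 * N)) :
    (H * T * c + 2 + H) * Real.exp (-ℓ) ≤ 1 / (T * H) := by
  have hHT : 0 < T * H := by linarith
  have hexp : Real.exp (-ℓ) = (4 * (T * H) ^ 2 * N)⁻¹ := by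
    rw [Real.exp_neg, hℓ, Real.exp_log (by positivity)]
  have h1 : H * T * c + 2 + H ≤ 4 * ((T * H) * N) := by
    have h2 : H * T * c ≤ H * T * N := mul_le_mul_of_nonneg_left hc (by positivity)
    have h3 : T * H ≤ (T * H) * N := by nlinarith
    have h4 : H ≤ T * H := by nlinarith
    linarith
  rw [hexp, ← div_eq_mul_inv, div_le_div_iff₀ (by positivity) hHT, one_mul]
  calc (H * T * c + 2 + H) * (T * H) ≤ 4 * ((T * H) * N) * (T * H) :=
        mul_le_mul_of_nonneg_right h1 hHT.le
    _ = 4 * (T * H) ^ 2 * N := by ring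

/-- The martingale terms are dominated by the sum of the bonuses. -/
theorem deviation_add_bonus_le {H T L γ ℓ : ℝ} (hH : 1 ≤ H) (hT : 1 ≤ T) (hL : T / 2 ≤ L)
    (hℓ : 0 < ℓ) (hγ : √(72 * ℓ + 8) ≤ γ) :
    1 + 6 * H * √(2 * T * ℓ) + H * (2 * (γ * √(2 * L))) ≤ 10 * (H * (γ * √L)) := by
  have hroot : ∀ x, x ≤ (72 * ℓ + 8) * L → √x ≤ γ * √L := fun x hx => by
    calc √x ≤ √((72 * ℓ + 8) * L) := Real.sqrt_le_sqrt hx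
      _ = √(72 * ℓ + 8) * √L := Real.sqrt_mul (by linarith) _
      _ ≤ γ * √L := mul_le_mul_of_nonneg_right hγ (Real.sqrt_nonneg _)
  have h1 : √(2 * T * ℓ) ≤ γ * √L := hroot _ (by nlinarith)
  have h2 : 1 ≤ γ * √L := by
    have := hroot 1 (by nlinarith)
    rwa [Real.sqrt_one] at this
  have h3 : √(2 * L) ≤ 3 / 2 * √L := by
    rw [Real.sqrt_mul (by norm_num)]
    refine mul_le_mul_of_nonneg_right ?_ (Real.sqrt_nonneg _)
    exact Real.sqrt_le_iff.2 ⟨by norm_num, by norm_num⟩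
  have hγ0 : 0 ≤ γ := (Real.sqrt_nonneg _).trans hγ
  have h4 := mul_le_mul_of_nonneg_left h3 hγ0
  set y := γ * √L with hy
  have h5 := mul_le_mul_of_nonneg_left h1 (by linarith : 0 ≤ 6 * H)
  have h6 := mul_le_mul_of_nonneg_left h4 (by linarith : 0 ≤ 2 * H)
  have h7 : 1 ≤ H * y := by nlinarith
  nlinarith

theorem mul_sqrt_le_bonusParam {C κ K M₂ Γ ℓ : ℝ} {d H T : ℕ} (hC : 70 ≤ C) (hκ : 0 < κ)
    (hK : 0 < K) (hM : 0 ≤ M₂) (hℓ : 0 ≤ ℓ)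
    (h : ℓ ≤ 68 * ((d : ℝ) ^ 2 * Real.log ((1 + K + Γ) * T * H))) :
    K * κ⁻¹ * √(72 * ℓ + 8) ≤ bonusParam C κ K M₂ Γ d H T := by
  rw [bonusParam]
  set G : ℝ := (d : ℝ) ^ 2 * Real.log ((1 + K + Γ) * T * H)
  have h1 : √(72 * ℓ + 8) ≤ C * √(1 + M₂ + K + G) := by
    calc √(72 * ℓ + 8) ≤ √(70 ^ 2 * (1 + M₂ + K + G)) := Real.sqrt_le_sqrt (by linarith)
      _ = 70 * √(1 + M₂ + K + G) := by
          rw [Real.sqrt_mul (by norm_num), Real.sqrt_sq (by norm_num)]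
      _ ≤ C * √(1 + M₂ + K + G) := mul_le_mul_of_nonneg_right hC (Real.sqrt_nonneg _)
  calc K * κ⁻¹ * √(72 * ℓ + 8) ≤ K * κ⁻¹ * (C * √(1 + M₂ + K + G)) :=
        mul_le_mul_of_nonneg_left h1 (by positivity)
    _ = C * K * κ⁻¹ * √(1 + M₂ + K + G) := by ring

variable {Ω : Type w} {S : Type u} {A : Type v} {d : ℕ} [MeasurableSpace Ω]
  [MeasurableSpace S] [MeasurableSpace A] {P : Measure Ω} {M : MDP S A} {H T : ℕ}
  {φ : S → A → Vec d} {f : ℝ → ℝ} {C κ K M₂ γ Γ : ℝ} {X : Execution Ω S A d}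

theorem bonusParam_nonneg (hC : 0 ≤ C) (hf : LinkRegular f κ K M₂) :
    0 ≤ bonusParam C κ K M₂ Γ d H T :=
  mul_nonneg (mul_nonneg (mul_nonneg hC hf.K_pos.le) (inv_nonneg.2 hf.kappa_pos.le))
    (Real.sqrt_nonneg _)

/-- Bounds for the optimal value and for the expected rewards of the episodes bound the regret. -/
theorem ae_regret_le {v e : ℝ} (hv : M.optValue H ≤ v)
    (he : ∀ t ∈ Icc 1 T, ∀ᵐ ω ∂P, e ≤ (P[X.totalReward H t | X.before H t]) ω) :
    ∀ᵐ ω ∂P, regret P M H T X ω ≤ T * (v - e) := by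
  have : ∀ᵐ ω ∂P, ∀ t ∈ Finset.Icc 1 T, e ≤ (P[X.totalReward H t | X.before H t]) ω :=
    (Finset.eventually_all _).2 fun t ht => he t (Finset.mem_Icc.1 ht)
  filter_upwards [this] with ω hω
  have h1 := Finset.sum_le_sum hω
  rw [Finset.sum_const, Nat.card_Icc, Nat.add_sub_cancel, nsmul_eq_mul] at h1
  have h2 : regret P M H T X ω =
    T * M.optValue H - ∑ t ∈ Finset.Icc 1 T, (P[X.totalReward H t | X.before H t]) ω := rfl
  rw [h2]
  nlinarith [mul_le_mul_of_nonneg_left hv (Nat.cast_nonneg (α := ℝ) T)]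

namespace IsLSVIUCB

variable [IsProbabilityMeasure P] [Nonempty A]

/-- The regret bound in terms of the bonus multiplier. -/
theorem measureReal_regret_le_bonus [Finite A] (hC : 70 ≤ C)
    (hX : IsLSVIUCB P M H T φ f (bonusParam C κ K M₂ Γ d H T) X) (hd : 1 ≤ d) (hdT : d ≤ T)
    (hTH : 2 ≤ T * H) (hN : M.Normalized H) (hf : LinkRegular f κ K M₂)
    (hγΓ : bonusParam C κ K M₂ Γ d H T ≤ Γ)
    (hφm : Measurable fun z : S × A => φ z.1 z.2) (hφ : ∀ s a, ‖φ s a‖ ≤ 1)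
    (hO : OptimisticClosure M H φ f Γ) :
    1 - 1 / ((T : ℝ) * H) ≤ P.real {ω | regret P M H T X ω ≤
      10 * (H * (bonusParam C κ K M₂ Γ d H T * √(T * d * Real.log (1 + T / d))))} := by
  have hγ0 : 0 ≤ bonusParam C κ K M₂ Γ d H T := bonusParam_nonneg (by linarith) hf
  obtain ⟨n, hn, hε1, hε2, hlog⟩ := exists_mesh hd hdT hTH hf.K_pos hγ0 hγΓ
  obtain ⟨N₁, N₂, hN₁, hN₂, hcard⟩ := exists_parameter_nets hd hn
  have hH : 1 ≤ H := Nat.pos_of_ne_zero fun h => by simp [h] at hTH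
  have hT : 1 ≤ T := hd.trans hdT
  have hT' : (1 : ℝ) ≤ T := by exact_mod_cast hT
  have hH' : (1 : ℝ) ≤ H := by exact_mod_cast hH
  have hTH' : (2 : ℝ) ≤ T * H := by exact_mod_cast hTH
  have hNn1 : (1 : ℝ) ≤ (2 * n + 1 : ℝ) ^ (4 * d ^ 2) :=
    one_le_pow₀ (by linarith [Nat.cast_nonneg (α := ℝ) n])
  generalize (2 * n + 1 : ℝ) ^ (4 * d ^ 2) = Nn at hlog hcard hNn1
  obtain ⟨ℓ, hℓ⟩ : ∃ ℓ, ℓ = Real.log (4 * ((T : ℝ) * H) ^ 2 * Nn) := ⟨_, rfl⟩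
  rw [← hℓ] at hlog
  have hℓ0 : 0 < ℓ := by
    rw [hℓ]
    exact Real.log_pos (by nlinarith)
  have hγℓ := mul_sqrt_le_bonusParam hC hf.kappa_pos hf.K_pos hf.M_nonneg hℓ0.le hlog
  have hmain := hX.measureReal_regret_le hd hH hT hN hf hγ0 hγΓ hφm hφ hO hε1 hε2 hℓ0 hγℓ hN₁ hN₂
  have hprob := count_mul_exp_le hH' (by linarith) hT' hNn1 hcard hℓ
  refine le_trans (by linarith) (hmain.trans (measureReal_mono fun ω hω => ?_))
  refine le_trans hω (deviation_add_bonus_le hH' hT' (half_le_elliptical hd hT) hℓ0 ?_)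
  exact (le_mul_of_one_le_left (Real.sqrt_nonneg _) hf.one_le_ratio).trans hγℓ

theorem ae_regret_le_episodes (hX : IsLSVIUCB P M H T φ f γ X) (hN : M.Normalized H) :
    ∀ᵐ ω ∂P, regret P M H T X ω ≤ T := by
  have := ae_regret_le (X := X) (M.optValue_le (M.value_le_one hN)) (e := 0)
    fun t ht => (hX.condExp_totalReward_mem ht).mono fun ω h => h.1
  simpa using this

/-- All mean rewards lie in an interval of length `2 K`, so no policy is much better than another
if `K` is small. -/
theorem ae_regret_le_slope (hX : IsLSVIUCB P M H T φ f γ X) (hH : 1 ≤ H) (hf : LinkRegular f κ K M₂)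
    (hγ : 0 ≤ Γ) (hφ : ∀ s a, ‖φ s a‖ ≤ 1) (hO : OptimisticClosure M H φ f Γ) :
    ∀ᵐ ω ∂P, regret P M H T X ω ≤ T * (H * (2 * K)) := by
  obtain ⟨θ, hθ, hmodel⟩ := exists_bellman_model (X := X) (t := 1) (h := H) (γ := 0) ⟨hH, le_rfl⟩
    le_rfl (ω := Classical.choice (nonempty_of_isProbabilityMeasure P)) le_rfl hγ hφ hO
    fun h => absurd h (lt_irrefl _)
  have hr : ∀ s a, |M.meanReward s a - clampLink f 0| ≤ K := fun s a => by
    have h1 := hmodel s a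
    rw [MDP.bellman_eq, if_neg (lt_irrefl _), add_zero] at h1
    rw [h1]
    refine (hf.abs_clampLink_sub_le _ _).trans ?_
    have h2 : |inner ℝ (φ s a) θ| ≤ 1 := abs_le.2 (inner_mem_Icc (hφ s a) hθ)
    rw [sub_zero]
    nlinarith [hf.K_pos]
  have := ae_regret_le (X := X) (M.optValue_le (M.value_le_mul (H := H) (c := clampLink f 0 + K)
    fun s a => by linarith [(abs_le.1 (hr s a)).2]))
    (fun t ht => hX.le_condExp_totalReward ht (c := clampLink f 0 - K)
    fun s a => by linarith [(abs_le.1 (hr s a)).1])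
  filter_upwards [this] with ω hω
  refine hω.trans (le_of_eq (by ring))

end IsLSVIUCB

end Core

/-! ### Comparison with the explicit bounds -/

section Arithmetic

theorem one_third_le_half_log {m : ℝ} (hm : 2 ≤ m) : 1 / 3 ≤ Real.log m / 2 := by
  have h1 := Real.log_le_log two_pos hm
  have h2 := Real.log_two_gt_d9
  linarith

variable {κ K M Γ C : ℝ} {d H T p : ℕ}

theorem second_term_nonneg (hκ : 0 < κ) (hK : 0 < K) : 0 ≤ H * K * κ⁻¹ *
    √((M + K + (d : ℝ) ^ 2 * Real.log (K * T * H)) * (T * d * Real.log (1 + T / d))) := by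
  positivity

/-- The explicit bound when the slopes of the link function are small. -/
theorem small_slope_le_regretBound (hκ : 0 < κ) (hK : 0 < K) (hT : 1 ≤ T) (hTH : 2 ≤ T * H)
    (h : K * T * H ≤ √(T * H)) : T * (H * (2 * K)) ≤ 3 * regretBound κ K M d H T := by
  have hTH' : (2 : ℝ) ≤ T * H := by exact_mod_cast hTH
  have hT' : (1 : ℝ) ≤ T := by exact_mod_cast hT
  have hH : 1 ≤ H := Nat.pos_of_ne_zero fun h => by simp [h] at hTH
  have hH' : (1 : ℝ) ≤ H := by exact_mod_cast hH
  have h1 : √((T : ℝ) * H) ≤ H * √T := by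
    rw [Real.sqrt_mul (by linarith), mul_comm]
    refine mul_le_mul_of_nonneg_right ?_ (Real.sqrt_nonneg _)
    exact Real.sqrt_le_iff.2 ⟨by linarith, by nlinarith⟩
  have h2 : 2 / 3 * √T ≤ √(T * Real.log (T * H)) := by
    rw [Real.sqrt_mul (by linarith), mul_comm]
    refine mul_le_mul_of_nonneg_left ?_ (Real.sqrt_nonneg _)
    refine Real.le_sqrt_of_sq_le ?_
    have := one_third_le_half_log hTH'
    norm_num at this ⊢
    linarith
  have h3 := second_term_nonneg (M := M) (d := d) (H := H) (T := T) hκ hK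
  have h4 := mul_le_mul_of_nonneg_left h2 (by linarith : (0 : ℝ) ≤ 3 * H)
  rw [regretBound]
  linarith

/-- The explicit bound is trivial when one of the parameters is large. -/
theorem episodes_le_regretBound (hκ : 0 < κ) (hκK : 1 ≤ K * κ⁻¹) (hK : 0 < K) (hM : 0 ≤ M)
    (hd : 1 ≤ d) (hT : 1 ≤ T) (hH : 1 ≤ H) (hlog : 1 / 3 ≤ Real.log (K * T * H))
    (h : T ≤ d ∨ (T : ℝ) ≤ M + K ∨ (T : ℝ) ≤ K * κ⁻¹) : T ≤ 3 * regretBound κ K M d H T := by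
  have hT' : (1 : ℝ) ≤ T := by exact_mod_cast hT
  have hH' : (1 : ℝ) ≤ H := by exact_mod_cast hH
  have hd' : (1 : ℝ) ≤ d := by exact_mod_cast hd
  have hd2 : (1 : ℝ) ≤ (d : ℝ) ^ 2 := one_le_pow₀ hd'
  have hL := half_le_elliptical hd hT
  have h1 : 0 ≤ H * √(T * Real.log (T * H)) := by positivity
  have hlog' : (d : ℝ) ^ 2 * (1 / 3) ≤ (d : ℝ) ^ 2 * Real.log (K * T * H) :=
    mul_le_mul_of_nonneg_left hlog (by linarith)
  rw [regretBound]
  generalize Real.log (K * T * H) = a at hlog hlog' ⊢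
  suffices h2 : T ≤ 3 * (1 * (K * κ⁻¹) *
      √((M + K + (d : ℝ) ^ 2 * a) * (T * d * Real.log (1 + T / d)))) by
    refine h2.trans ?_
    have h3 : 1 * (K * κ⁻¹) * √((M + K + (d : ℝ) ^ 2 * a) * (T * d * Real.log (1 + T / d))) ≤
        H * (K * κ⁻¹) * √((M + K + (d : ℝ) ^ 2 * a) * (T * d * Real.log (1 + T / d))) := by
      gcongr
    rw [← mul_assoc (H : ℝ)] at h3
    linarith
  generalize (T : ℝ) * d * Real.log (1 + T / d) = L at hL ⊢
  rw [one_mul]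
  rcases h with h | h | h
  · have h' : (T : ℝ) ≤ d := by exact_mod_cast h
    have h3 : (T : ℝ) / 3 ≤ √((M + K + (d : ℝ) ^ 2 * a) * L) := by
      refine Real.le_sqrt_of_sq_le ?_
      have h4 : (T : ℝ) ^ 2 / 3 ≤ M + K + (d : ℝ) ^ 2 * a := by nlinarith
      calc ((T : ℝ) / 3) ^ 2 ≤ (T : ℝ) ^ 2 / 3 * (T / 2) := by nlinarith
        _ ≤ (M + K + (d : ℝ) ^ 2 * a) * L := mul_le_mul h4 hL (by positivity) (by nlinarith)
    nlinarith [Real.sqrt_nonneg ((M + K + (d : ℝ) ^ 2 * a) * L)]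
  · have h3 : (T : ℝ) / 3 ≤ √((M + K + (d : ℝ) ^ 2 * a) * L) := by
      refine Real.le_sqrt_of_sq_le ?_
      have h4 : (T : ℝ) ≤ M + K + (d : ℝ) ^ 2 * a := by nlinarith
      calc ((T : ℝ) / 3) ^ 2 ≤ (T : ℝ) * (T / 2) := by nlinarith
        _ ≤ (M + K + (d : ℝ) ^ 2 * a) * L := mul_le_mul h4 hL (by positivity) (by nlinarith)
    nlinarith [Real.sqrt_nonneg ((M + K + (d : ℝ) ^ 2 * a) * L)]
  · have h3 : (1 : ℝ) / 3 ≤ √((M + K + (d : ℝ) ^ 2 * a) * L) := by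
      refine Real.le_sqrt_of_sq_le ?_
      have h4 : (1 : ℝ) / 3 ≤ M + K + (d : ℝ) ^ 2 * a := by nlinarith
      calc ((1 : ℝ) / 3) ^ 2 ≤ (1 : ℝ) / 3 * (1 / 2) := by norm_num
        _ ≤ (M + K + (d : ℝ) ^ 2 * a) * L := mul_le_mul h4 (by linarith) (by positivity) (by linarith)
    nlinarith [Real.sqrt_nonneg ((M + K + (d : ℝ) ^ 2 * a) * L)]

/-- If `Γ` is polynomial in the parameters and all parameters are at most `T`, then the logarithm in
the bonus multiplier has the order of `ln(TH)`. -/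
theorem log_le_of_polynomial (hK : 0 < K) (hTH : 2 ≤ T * H) (hT : 1 ≤ T) (hd : 1 ≤ d)
    (hΓ0 : 0 ≤ Γ) (hdT : d ≤ T) (hMK : M + K ≤ T) (hM : 0 ≤ M) (hκK : K * κ⁻¹ ≤ T)
    (hκ0 : 0 ≤ K * κ⁻¹) (hΓ : Γ ≤ ((2 + M + K + K * κ⁻¹) * d * T * H) ^ p) :
    Real.log ((1 + K + Γ) * T * H) ≤ (5 * p + 4) * Real.log (T * H) := by
  have hTH' : (2 : ℝ) ≤ T * H := by exact_mod_cast hTH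
  have hT' : (1 : ℝ) ≤ T := by exact_mod_cast hT
  have hH : 1 ≤ H := Nat.pos_of_ne_zero fun h => by simp [h] at hTH
  have hH' : (1 : ℝ) ≤ H := by exact_mod_cast hH
  have hd' : (d : ℝ) ≤ T := by exact_mod_cast hdT
  have hTm : (T : ℝ) ≤ T * H := by nlinarith
  rw [mul_assoc _ (T : ℝ)] at hΓ ⊢
  generalize (T : ℝ) * H = m at hTH' hTm hΓ ⊢
  have hm0 : 0 ≤ m := by linarith
  have hbase : (2 + M + K + K * κ⁻¹) * d * m ≤ m ^ 5 := by
    have h1 : 2 + M + K + K * κ⁻¹ ≤ m ^ 3 := by nlinarith [mul_nonneg hm0 hm0]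
    have h2 : (d : ℝ) ≤ m := hd'.trans hTm
    calc (2 + M + K + K * κ⁻¹) * d * m ≤ m ^ 3 * m * m := by gcongr
      _ = m ^ 5 := by ring
  have hΓm : Γ ≤ m ^ (5 * p) := by
    rw [pow_mul]
    exact hΓ.trans (pow_le_pow_left₀ (by positivity) hbase p)
  have h1m : 1 ≤ m := by linarith
  have hp1 : 1 ≤ m ^ (5 * p) := one_le_pow₀ h1m
  have hfin : (1 + K + Γ) * m ≤ m ^ (5 * p + 4) := by
    have h2 : 1 + K + Γ ≤ m ^ (5 * p) * m ^ 3 := by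
      have h3 : 1 + K ≤ m ^ 2 := by nlinarith
      have h4 : m ^ 2 + 1 ≤ m ^ 3 := by nlinarith [sq_nonneg m]
      have h5 : 0 ≤ m ^ 2 := sq_nonneg m
      calc 1 + K + Γ ≤ m ^ 2 + m ^ (5 * p) := by linarith
        _ ≤ m ^ (5 * p) * (m ^ 2 + 1) := by nlinarith
        _ ≤ m ^ (5 * p) * m ^ 3 := by gcongr
    calc (1 + K + Γ) * m ≤ m ^ (5 * p) * m ^ 3 * m := by gcongr
      _ = m ^ (5 * p + 4) := by ring
  have hpos : 0 < (1 + K + Γ) * m := by nlinarith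
  refine (Real.log_le_log hpos hfin).trans (le_of_eq ?_)
  rw [Real.log_pow]
  push_cast
  ring

theorem bonus_le_regretBound (hC : 70 ≤ C) (hκ : 0 < κ) (hK : 0 < K) (hM : 0 ≤ M) (hd : 1 ≤ d)
    (hT : 1 ≤ T) (hH : 1 ≤ H) (ha : 1 / 3 ≤ Real.log (K * T * H))
    (hlog : Real.log ((1 + K + Γ) * T * H) ≤ (10 * p + 8) * Real.log (K * T * H)) :
    10 * (H * (bonusParam C κ K M Γ d H T * √(T * d * Real.log (1 + T / d)))) ≤
      10 * C * (10 * p + 11) * regretBound κ K M d H T := by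
  have hT' : (1 : ℝ) ≤ T := by exact_mod_cast hT
  have hd' : (1 : ℝ) ≤ d := by exact_mod_cast hd
  have hd2 : (1 : ℝ) ≤ (d : ℝ) ^ 2 := one_le_pow₀ hd'
  have hp : (0 : ℝ) ≤ p := Nat.cast_nonneg p
  have h1 : 0 ≤ H * √(T * Real.log (T * H)) := by positivity
  rw [regretBound, bonusParam]
  have hlog' := mul_le_mul_of_nonneg_left hlog (by linarith : (0 : ℝ) ≤ (d : ℝ) ^ 2)
  generalize Real.log (K * T * H) = a at ha hlog' ⊢
  generalize (d : ℝ) ^ 2 * Real.log ((1 + K + Γ) * T * H) = G at hlog' ⊢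
  generalize (T : ℝ) * d * Real.log (1 + T / d) = L
  set R : ℝ := M + K + (d : ℝ) ^ 2 * a with hR
  have hda : 1 / 3 ≤ (d : ℝ) ^ 2 * a := by nlinarith
  have hR0 : 0 ≤ R := by linarith
  have hle : 1 + M + K + G ≤ (10 * p + 11) ^ 2 * R := by
    have h2 : 1 + M + K + G ≤ (10 * p + 11) * R := by nlinarith
    refine h2.trans (mul_le_mul_of_nonneg_right ?_ hR0)
    nlinarith
  have hs : √(1 + M + K + G) ≤ (10 * p + 11) * √R := by
    calc √(1 + M + K + G) ≤ √((10 * p + 11) ^ 2 * R) := Real.sqrt_le_sqrt hle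
      _ = (10 * p + 11) * √R := by
          rw [Real.sqrt_mul (by positivity), Real.sqrt_sq (by positivity)]
  have hcoef : 0 ≤ 10 * C * (10 * p + 11) := by positivity
  calc 10 * (H * (C * K * κ⁻¹ * √(1 + M + K + G) * √L))
      ≤ 10 * (H * (C * K * κ⁻¹ * ((10 * p + 11) * √R) * √L)) := by gcongr
    _ = 10 * C * (10 * p + 11) * (H * K * κ⁻¹ * √(R * L)) := by
        rw [Real.sqrt_mul hR0]; ring
    _ ≤ 10 * C * (10 * p + 11) * (H * √(T * Real.log (T * H)) + H * K * κ⁻¹ * √(R * L)) :=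
        mul_le_mul_of_nonneg_left (by linarith) hcoef

theorem bonus_le_order (hC : 70 ≤ C) (hκ : 0 < κ) (hK : 0 < K) (hM : 0 ≤ M) (hΓ : 0 ≤ Γ)
    (hd : 1 ≤ d) (hT : 1 ≤ T) (hH : 1 ≤ H) :
    10 * (H * (bonusParam C κ K M Γ d H T * √(T * d * Real.log (1 + T / d)))) ≤
      10 * C * (10 * p + 11) * ((1 + K * κ⁻¹ * √(1 + M + K + Real.log (1 + K + Γ))) *
        (H * √((d : ℝ) ^ 3 * T)) * (1 + Real.log (T * H))) := by
  have hT' : (1 : ℝ) ≤ T := by exact_mod_cast hT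
  have hH' : (1 : ℝ) ≤ H := by exact_mod_cast hH
  have hd' : (1 : ℝ) ≤ d := by exact_mod_cast hd
  have hd2 : (1 : ℝ) ≤ (d : ℝ) ^ 2 := one_le_pow₀ hd'
  have hp : (0 : ℝ) ≤ p := Nat.cast_nonneg p
  have hTH1 : (1 : ℝ) ≤ T * H := by nlinarith
  have hb0 : 0 ≤ Real.log (T * H) := Real.log_nonneg hTH1
  have hg0 : 0 ≤ Real.log (1 + K + Γ) := Real.log_nonneg (by linarith)
  have hlogW : Real.log ((1 + K + Γ) * T * H) = Real.log (1 + K + Γ) + Real.log (T * H) := by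
    rw [mul_assoc, Real.log_mul (by linarith) (by linarith)]
  have hlogT : Real.log (1 + T / d) ≤ 1 + Real.log (T * H) := by
    have h1 : (T : ℝ) / d ≤ T := div_le_self (by linarith) hd'
    have h2 : 1 + (T : ℝ) / d ≤ 2 * (T * H) := by nlinarith
    have h3 := Real.log_le_log (by positivity) h2
    rw [Real.log_mul two_ne_zero (by linarith)] at h3
    have h4 := Real.log_two_lt_d9
    linarith
  rw [bonusParam, hlogW]
  generalize Real.log (1 + K + Γ) = g at hg0 ⊢
  generalize Real.log (T * H) = b at hb0 hlogT ⊢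
  set R : ℝ := 1 + M + K + g with hR
  have hR1 : 1 ≤ R := by linarith
  have h1 : √(1 + M + K + (d : ℝ) ^ 2 * (g + b)) ≤ d * √R * √(1 + b) := by
    calc √(1 + M + K + (d : ℝ) ^ 2 * (g + b)) ≤ √((d : ℝ) ^ 2 * R * (1 + b)) := by
          refine Real.sqrt_le_sqrt ?_
          have h2 : 1 + M + K + (d : ℝ) ^ 2 * g ≤ (d : ℝ) ^ 2 * R := by nlinarith
          have h3 : (d : ℝ) ^ 2 * b ≤ (d : ℝ) ^ 2 * b * R :=
            le_mul_of_one_le_right (by positivity) hR1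
          nlinarith
      _ = d * √R * √(1 + b) := by
          rw [Real.sqrt_mul (by positivity), Real.sqrt_mul (by positivity),
            Real.sqrt_sq (by linarith)]
  have h2 : √(T * d * Real.log (1 + T / d)) ≤ √((T : ℝ) * d) * √(1 + b) := by
    rw [← Real.sqrt_mul (by positivity)]
    exact Real.sqrt_le_sqrt (mul_le_mul_of_nonneg_left hlogT (by positivity))
  have h3 : √((d : ℝ) ^ 3 * T) = d * √((T : ℝ) * d) := by
    rw [show (d : ℝ) ^ 3 * T = (d : ℝ) ^ 2 * (T * d) by ring, Real.sqrt_mul (by positivity),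
      Real.sqrt_sq (by linarith)]
  have h4 : √(1 + b) * √(1 + b) = 1 + b := Real.mul_self_sqrt (by linarith)
  rw [h3]
  have hq : (1 : ℝ) ≤ 10 * p + 11 := by linarith
  calc 10 * (H * (C * K * κ⁻¹ * √(1 + M + K + (d : ℝ) ^ 2 * (g + b)) *
        √(T * d * Real.log (1 + T / d))))
      ≤ 10 * (H * (C * K * κ⁻¹ * (d * √R * √(1 + b)) * (√((T : ℝ) * d) * √(1 + b)))) := by gcongr
    _ = 10 * C * 1 * ((0 + K * κ⁻¹ * √R) * (H * (d * √((T : ℝ) * d))) *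
          (√(1 + b) * √(1 + b))) := by ring
    _ ≤ 10 * C * (10 * p + 11) * ((1 + K * κ⁻¹ * √R) * (H * (d * √((T : ℝ) * d))) * (1 + b)) := by
        rw [h4]
        gcongr
        exact zero_le_one

theorem episodes_le_order (hκ : 0 < κ) (hK : 0 < K) (hT : 1 ≤ T) (hH : 1 ≤ H) (hdT : T ≤ d) :
    (T : ℝ) ≤ (1 + K * κ⁻¹ * √(1 + M + K + Real.log (1 + K + Γ))) *
        (H * √((d : ℝ) ^ 3 * T)) * (1 + Real.log (T * H)) := by
  have hT' : (1 : ℝ) ≤ T := by exact_mod_cast hT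
  have hH' : (1 : ℝ) ≤ H := by exact_mod_cast hH
  have hd' : (T : ℝ) ≤ d := by exact_mod_cast hdT
  have hb0 : 0 ≤ Real.log (T * H) := Real.log_nonneg (by nlinarith)
  have h1 : (T : ℝ) ≤ √((d : ℝ) ^ 3 * T) := by
    refine Real.le_sqrt_of_sq_le ?_
    calc (T : ℝ) ^ 2 = T ^ 1 * T := by ring
      _ ≤ (d : ℝ) ^ 3 * T := by
          refine mul_le_mul_of_nonneg_right ?_ (by linarith)
          exact (pow_le_pow_right₀ hT' (by norm_num)).trans (pow_le_pow_left₀ (by linarith) hd' 3)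
  have h2 : 0 ≤ K * κ⁻¹ * √(1 + M + K + Real.log (1 + K + Γ)) := by positivity
  calc (T : ℝ) = 1 * (1 * T) * 1 := by ring
    _ ≤ (1 + K * κ⁻¹ * √(1 + M + K + Real.log (1 + K + Γ))) *
        (H * √((d : ℝ) ^ 3 * T)) * (1 + Real.log (T * H)) := by
      gcongr <;> linarith

end Arithmetic

end GLMRL

end

theorem theorem1 :
    ∃ C₀ : ℝ, 0 < C₀ ∧ ∀ C : ℝ, C₀ ≤ C → ∀ p : ℕ, ∃ C₁ : ℝ, 0 < C₁ ∧
      ∀ (S : Type u) (A : Type v) (Ω : Type w)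
        [MeasurableSpace S] [MeasurableSpace A] [MeasurableSingletonClass A]
        [Finite A] [Nonempty A] [MeasurableSpace Ω]
        (P : Measure Ω) [IsProbabilityMeasure P]
        (M : GLMRL.MDP S A) (d H T : ℕ) (_ : 1 ≤ d) (_ : 1 ≤ H) (_ : 1 ≤ T)
        (_ : M.Normalized H)
        (φ : S → A → GLMRL.Vec d) (_ : Measurable fun z : S × A => φ z.1 z.2)
        (_ : ∀ s a, ‖φ s a‖ ≤ 1)
        (f : ℝ → ℝ) (κ K M₂ : ℝ) (_ : GLMRL.LinkRegular f κ K M₂)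
        (Γ : ℝ) (_ : GLMRL.bonusParam C κ K M₂ Γ d H T ≤ Γ)
        (_ : GLMRL.OptimisticClosure M H φ f Γ)
        (X : GLMRL.Execution Ω S A d)
        (_ : GLMRL.IsLSVIUCB P M H T φ f (GLMRL.bonusParam C κ K M₂ Γ d H T) X),
        -- the explicit bound, when `Γ` is at most polynomial in the parameters
        (Γ ≤ ((2 + M₂ + K + K * κ⁻¹) * d * T * H) ^ p →
          1 - 1 / ((T : ℝ) * H) ≤
            P.real {ω | GLMRL.regret P M H T X ω ≤ C₁ * GLMRL.regretBound κ K M₂ d H T}) ∧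
        -- the order `H √(d³ T)` up to factors of `M₂, K, κ, Γ` and logarithms
        1 - 1 / ((T : ℝ) * H) ≤
          P.real {ω | GLMRL.regret P M H T X ω ≤
            C₁ * ((1 + K * κ⁻¹ * √(1 + M₂ + K + Real.log (1 + K + Γ))) *
              (H * √((d : ℝ) ^ 3 * T)) * (1 + Real.log (T * H)))} := by
  refine ⟨70, by norm_num, fun C hC p => ⟨10 * C * (10 * p + 11), by positivity, ?_⟩⟩
  intro S A Ω _ _ _ _ _ _ P _ M d H T hd hH hT hN φ hφm hφ f κ K M₂ hf Γ hγΓ hO X hX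
  have hC₁ : (3 : ℝ) ≤ 10 * C * (10 * p + 11) := by
    have : (0 : ℝ) ≤ p := Nat.cast_nonneg p
    nlinarith
  have hK := hf.K_pos
  have hκ := hf.kappa_pos
  have hM := hf.M_nonneg
  have hratio := hf.one_le_ratio
  have hΓ0 : 0 ≤ Γ := (GLMRL.bonusParam_nonneg (by linarith) hf).trans hγΓ
  have hT' : (1 : ℝ) ≤ T := by exact_mod_cast hT
  have hH' : (1 : ℝ) ≤ H := by exact_mod_cast hH
  -- for `T H = 1` there is nothing to prove
  by_cases hTH : 2 ≤ T * H
  swap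
  · have h1 : T * H = 1 := by have := Nat.mul_pos hT hH; omega
    have h2 : (T : ℝ) * H = 1 := by exact_mod_cast h1
    rw [h2]
    norm_num
  have hTH' : (2 : ℝ) ≤ T * H := by exact_mod_cast hTH
  have hδ : (0 : ℝ) ≤ 1 / ((T : ℝ) * H) := by positivity
  have hsure : ∀ b c : ℝ, (∀ᵐ ω ∂P, GLMRL.regret P M H T X ω ≤ b) → b ≤ c →
      1 - 1 / ((T : ℝ) * H) ≤ P.real {ω | GLMRL.regret P M H T X ω ≤ c} := fun b c h hbc =>
    GLMRL.one_sub_le_measureReal (bad := ∅) (h.mono fun ω hω _ => hω.trans hbc) (by simpa using hδ)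
  have hcore : d ≤ T → ∀ c : ℝ, 10 * (H * (GLMRL.bonusParam C κ K M₂ Γ d H T *
      √(T * d * Real.log (1 + T / d)))) ≤ c →
      1 - 1 / ((T : ℝ) * H) ≤ P.real {ω | GLMRL.regret P M H T X ω ≤ c} := fun hdT c hc =>
    (hX.measureReal_regret_le_bonus hC hd hdT hTH hN hf hγΓ hφm hφ hO).trans
      (measureReal_mono fun ω hω => le_trans hω hc)
  constructor
  · intro hΓ
    by_cases hsmall : K * T * H ≤ √(T * H)
    · refine hsure _ _ (hX.ae_regret_le_slope hH hf hΓ0 hφ hO)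
        ((GLMRL.small_slope_le_regretBound (M := M₂) (d := d) hκ hK hT hTH hsmall).trans ?_)
      refine mul_le_mul_of_nonneg_right hC₁ ?_
      exact add_nonneg (by positivity) (GLMRL.second_term_nonneg hκ hK)
    · have hhalf : Real.log (T * H) / 2 ≤ Real.log (K * T * H) := by
        rw [← Real.log_sqrt (by linarith)]
        exact Real.log_le_log (Real.sqrt_pos.2 (by linarith)) (not_le.1 hsmall).le
      have hthird : 1 / 3 ≤ Real.log (K * T * H) :=
        (GLMRL.one_third_le_half_log hTH').trans hhalf
      by_cases hlarge : T ≤ d ∨ (T : ℝ) ≤ M₂ + K ∨ (T : ℝ) ≤ K * κ⁻¹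
      · refine hsure _ _ (hX.ae_regret_le_episodes hN)
          ((GLMRL.episodes_le_regretBound hκ hratio hK hM hd hT hH hthird hlarge).trans ?_)
        refine mul_le_mul_of_nonneg_right hC₁ ?_
        exact add_nonneg (by positivity) (GLMRL.second_term_nonneg hκ hK)
      · push Not at hlarge
        refine hcore hlarge.1.le _ (GLMRL.bonus_le_regretBound hC hκ hK hM hd hT hH hthird ?_)
        have h1 := GLMRL.log_le_of_polynomial hK hTH hT hd hΓ0 hlarge.1.le hlarge.2.1.le hM
          hlarge.2.2.le (by linarith) hΓ
        have h2 : (0 : ℝ) ≤ 5 * p + 4 := by positivity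
        nlinarith
  · by_cases hdT : T ≤ d
    · refine hsure _ _ (hX.ae_regret_le_episodes hN)
        ((GLMRL.episodes_le_order (M := M₂) (Γ := Γ) hκ hK hT hH hdT).trans ?_)
      have h1 := GLMRL.episodes_le_order (M := M₂) (Γ := Γ) hκ hK hT hH hdT
      exact le_mul_of_one_le_left (by linarith) (by linarith)
    · exact hcore (by omega) _ (GLMRL.bonus_le_order hC hκ hK hM hΓ0 hd hT hH)
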